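/- Let $a,b\in C^0([0,1])$ with $a(0)=0$, $a>0$ on $(0,1]$, $\frac ba\in L^1(0,1)$, and suppose that for some $\alpha>0$ the function $x\mapsto x^\alpha/a(x)$ is non-decreasing in a right neighbourhood of $0$. Let $c>0$, $m\in[0,1]$, and let $\mu:(0,\infty)\to[0,\infty)$ satisfy $\mu\in L^1(0,\infty)\cap C^1(0,\infty)$, $\int_0^\infty\mu(s)\,ds>0$, $\lim_{s\to0^+}\mu(s)<\infty$ and $\mu'(s)\le -K_\mu\,\mu(s)$ for all $s>0$, with some $K_\mu>0$. Put $$\eta(x)=\exp\Big(\int_{1/2}^x\frac{b(s)}{a(s)}\,ds\Big),\qquad \sigma=\frac a\eta \qquad\text{on }[0,1].$$ All spaces are complex. Let $L^2_{1/\sigma}(0,1)$ be the $L^2$-space of the measure $\frac1\sigma dx$ on $(0,1)$, let $H^1_{1/\sigma,L}(0,1)=\{u\in H^1(0,1): u(0)=0,\ u\in L^2_{1/\sigma}(0,1)\}$ and $H^2_{1/\sigma,L}(0,1)=\{u\in H^1_{1/\sigma,L}(0,1):\sigma(\eta u_x)_x\in L^2_{1/\sigma}(0,1)\}$, let $H^1_R(1,2)=\{y\in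 H^1(1,2):y(2)=0\}$ with norm $\|y_x\|_{L^2(1,2)}$, and let $W$ be the space of $H^1_R(1,2)$-valued functions on $(0,\infty)$ that are square integrable for the measure $c\,m\,\mu(s)\,ds$, functions that agree almost everywhere for this measure being identified (so $W=\{0\}$ if $m=0$). The energy space is $$\mathcal H=H^1_{1/\sigma,L}(0,1)\times L^2_{1/\sigma}(0,1)\times L^2(1,2)\times W,$$ $$\langle U_1,U_2\rangle_{\mathcal H}=\int_0^1\eta u_{1x}\overline{u_{2x}}\,dx+\int_0^1\frac1\sigma v_1\overline{v_2}\,dx+\int_1^2y_1\overline{y_2}\,dx+cm\int_1^2\int_0^\infty\mu(s)\gamma_{1x}\overline{\gamma_{2x}}\,ds\,dx,$$ where $U_i=(u_i,v_i,y_i,\gamma_i)$. For $y\in H^1_R(1,2)$ and $\gamma\in W$ put $\zeta=c(1-m)y+cm\int_0^\infty\mu(s)\gamma(s)\,ds$. Define the operator $$\mathcal A(u,v,y,\gamma)=\big(v,\ \sigma(\eta u_x)_x,\ \zeta_{xx},\ -\gamma_s+y\big)$$ on the domain $D(\mathcal A)$ of all $(u,v,y,\gamma)\in\mathcal H$ with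 $u\in H^2_{1/\sigma,L}(0,1)$, $v\in H^1_{1/\sigma,L}(0,1)$, $y\in H^1_R(1,2)$, $\zeta\in H^2(1,2)$, $\gamma_s\in W$, $\gamma(\cdot,0)=0$, $\eta(1)u_x(1)=\zeta_x(1)$ and $v(1)=y(1)$ (for $m=0$ the conditions on $\gamma$ are void). Then $\mathcal A$ is m-dissipative in $\mathcal H$: $\operatorname{Re}\langle\mathcal AU,U\rangle_{\mathcal H}\le0$ for all $U\in D(\mathcal A)$, and $\lambda I-\mathcal A$ maps $D(\mathcal A)$ onto $\mathcal H$ for every $\lambda>0$. Hence $D(\mathcal A)$ is dense in $\mathcal H$ and $\mathcal A$ is the infinitesimal generator of a $C_0$-semigroup $(T(t))_{t\ge0}$ of contractions on $\mathcal H$; in particular, for every $U_0\in D(\mathcal A)$ the problem $U_t=\mathcal AU$, $U(0)=U_0$, has exactly one solution $U\in C^1([0,\infty),\mathcal H)$ with values in $D(\mathcal A)$, namely $U(t)=T(t)U_0$. -/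

import Mathlib

open MeasureTheory Set Filter Topology
open scoped ENNReal

noncomputable section

namespace DegenerateWaveHeat

/-! ### Local absolute continuity -/

/-- `F` is locally absolutely continuous on the interval `I`, with (weak) derivative `f`. -/
def IsPrimitiveOn {E : Type*} [NormedAddCommGroup E] [NormedSpace ℝ E]
    (I : Set ℝ) (F f : ℝ → E) : Prop :=
  ∀ x ∈ I, ∀ y ∈ I, IntervalIntegrable f volume x y ∧ F y - F x = ∫ t in x..y, f t

section IsPrimitiveOn

variable {E : Type*} [NormedAddCommGroup E] [NormedSpace ℝ E] {I : Set ℝ} {F G f g : ℝ → E}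

theorem IsPrimitiveOn.zero : IsPrimitiveOn I (0 : ℝ → E) 0 := by
  intro x _ y _
  exact ⟨intervalIntegrable_const (c := (0 : E)), by simp⟩

theorem IsPrimitiveOn.add (h : IsPrimitiveOn I F f) (k : IsPrimitiveOn I G g) :
    IsPrimitiveOn I (F + G) (f + g) := by
  intro x hx y hy
  obtain ⟨h1, h2⟩ := h x hx y hy
  obtain ⟨k1, k2⟩ := k x hx y hy
  refine ⟨h1.add k1, ?_⟩
  simp only [Pi.add_apply]
  rw [intervalIntegral.integral_add h1 k1, ← h2, ← k2]
  abel

theorem IsPrimitiveOn.smul [NormedSpace ℂ E] (r : ℂ)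
    (h : IsPrimitiveOn I F f) : IsPrimitiveOn I (r • F) (r • f) := by
  intro x hx y hy
  obtain ⟨h1, h2⟩ := h x hx y hy
  refine ⟨h1.smul r, ?_⟩
  simp only [Pi.smul_apply]
  rw [intervalIntegral.integral_smul, ← h2, smul_sub]

theorem IsPrimitiveOn.congr [I.OrdConnected] (h : IsPrimitiveOn I F f) (hF : EqOn F G I)
    (hf : ∀ᵐ x, x ∈ I → f x = g x) : IsPrimitiveOn I G g := by
  intro x hx y hy
  obtain ⟨h1, h2⟩ := h x hx y hy
  have hsub : uIoc x y ⊆ I := uIoc_subset_uIcc.trans (OrdConnected.uIcc_subset ‹_› hx hy)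
  have hae : ∀ᵐ t, t ∈ uIoc x y → f t = g t := by
    filter_upwards [hf] with t ht h't using ht (hsub h't)
  refine ⟨h1.congr_ae ?_, ?_⟩
  · exact (ae_restrict_iff' measurableSet_uIoc).2 hae
  · rw [← hF hx, ← hF hy, h2]
    exact intervalIntegral.integral_congr_ae hae

theorem IsPrimitiveOn.ae_eq_zero [CompleteSpace E] [I.OrdConnected]
    (h : IsPrimitiveOn I F f) (hF : ∀ᵐ x, x ∈ I → F x = 0) :
    ∀ᵐ x, x ∈ I → f x = 0 := by
  refine ae_of_mem_of_ae_of_mem_inter_Ioo (fun p q hp hq hpq => ?_)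
  have hsub : Icc p q ⊆ I := OrdConnected.out ‹_› hp hq
  have hint := (h p hp q hq).1
  have hcont : ContinuousOn (fun x => ∫ t in p..x, f t) (Icc p q) := by
    have := intervalIntegral.continuousOn_primitive_interval' hint left_mem_uIcc
    rwa [uIcc_of_le hpq.le] at this
  have hconst : EqOn (fun x => ∫ t in p..x, f t) (fun _ => - F p) (Ioo p q) := by
    refine Measure.eqOn_Ioo_of_ae_eq (μ := volume) ?_ (hcont.mono Ioo_subset_Icc_self)
      continuousOn_const
    refine (ae_restrict_iff' measurableSet_Ioo).2 ?_
    filter_upwards [hF] with x hx hxI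
    have hxI' := hsub (Ioo_subset_Icc_self hxI)
    rw [← (h p hp x hxI').2, hx hxI']
    simp
  filter_upwards [hint.ae_hasDerivAt_integral] with x hx hxI
  have h1 := hx (by rw [uIcc_of_le hpq.le]; exact Ioo_subset_Icc_self hxI.2) p left_mem_uIcc
  have h2 : HasDerivAt (fun x => ∫ t in p..x, f t) 0 x := by
    refine (hasDerivAt_const x (- F p)).congr_of_eventuallyEq ?_
    filter_upwards [isOpen_Ioo.mem_nhds hxI.2] with z hz using hconst hz
  exact h1.unique h2

end IsPrimitiveOn

/-! ### Sobolev spaces of order one on a bounded interval -/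

/-- The complex space `L²(p, q)`. -/
abbrev L2 (p q : ℝ) : Type := Lp ℂ 2 (volume.restrict (Ioo p q))

/-- A continuous function on `[p, q]`, extended by zero to the real line. -/
def zeroExt {p q : ℝ} (u : C(Icc p q, ℂ)) : ℝ → ℂ := Function.extend Subtype.val u 0

theorem zeroExt_apply {p q : ℝ} (u : C(Icc p q, ℂ)) {x : ℝ} (hx : x ∈ Icc p q) :
    zeroExt u x = u ⟨x, hx⟩ :=
  Subtype.val_injective.extend_apply u 0 (⟨x, hx⟩ : Icc p q)

theorem zeroExt_of_notMem {p q : ℝ} (u : C(Icc p q, ℂ)) {x : ℝ} (hx : x ∉ Icc p q) :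
    zeroExt u x = 0 :=
  Function.extend_apply' (f := Subtype.val) u (0 : ℝ → ℂ) x (by rintro ⟨z, rfl⟩; exact hx z.2)

theorem zeroExt_zero {p q : ℝ} : zeroExt (0 : C(Icc p q, ℂ)) = 0 := by
  funext x
  by_cases hx : x ∈ Icc p q
  · simp [zeroExt_apply _ hx]
  · simp [zeroExt_of_notMem _ hx]

theorem zeroExt_add {p q : ℝ} (u v : C(Icc p q, ℂ)) :
    zeroExt (u + v) = zeroExt u + zeroExt v := by
  funext x
  by_cases hx : x ∈ Icc p q
  · simp [zeroExt_apply _ hx]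
  · simp [zeroExt_of_notMem _ hx]

theorem zeroExt_smul {p q : ℝ} (r : ℂ) (u : C(Icc p q, ℂ)) :
    zeroExt (r • u) = r • zeroExt u := by
  funext x
  by_cases hx : x ∈ Icc p q
  · simp [zeroExt_apply _ hx]
  · simp [zeroExt_of_notMem _ hx]

theorem ae_mem_Icc_of_ae_restrict {p q : ℝ} {P : ℝ → Prop}
    (h : ∀ᵐ x ∂(volume.restrict (Ioo p q)), P x) : ∀ᵐ x, x ∈ Icc p q → P x := by
  rw [restrict_Ioo_eq_restrict_Icc] at h
  exact (ae_restrict_iff' measurableSet_Icc).1 h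

/-- `H¹(p, q)`: an element is a continuous function on `[p, q]` together with its (unique)
derivative in `L²(p, q)`. -/
def H1 (p q : ℝ) : Submodule ℂ (C(Icc p q, ℂ) × L2 p q) where
  carrier := {w | IsPrimitiveOn (Icc p q) (zeroExt w.1) w.2}
  zero_mem' := by
    refine IsPrimitiveOn.zero.congr (fun x _ => by simp [zeroExt_zero]) ?_
    apply ae_mem_Icc_of_ae_restrict
    filter_upwards [Lp.coeFn_zero ℂ 2 (volume.restrict (Ioo p q))] with x hx
    exact hx.symm
  add_mem' := by
    intro w z hw hz
    refine (IsPrimitiveOn.add hw hz).congr (fun x _ => by simp [zeroExt_add]) ?_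
    apply ae_mem_Icc_of_ae_restrict
    filter_upwards [Lp.coeFn_add w.2 z.2] with x hx
    exact hx.symm
  smul_mem' := by
    intro r w hw
    refine (IsPrimitiveOn.smul r hw).congr (fun x _ => by simp [zeroExt_smul]) ?_
    apply ae_mem_Icc_of_ae_restrict
    filter_upwards [Lp.coeFn_smul r w.2] with x hx
    exact hx.symm

/-! ### The space `H¹_R(1, 2)` -/

/-- The elements of `H¹(1, 2)` that vanish at `2`. -/
def h1R : Submodule ℂ (C(Icc (1 : ℝ) 2, ℂ) × L2 1 2) where
  carrier := {w | w ∈ H1 1 2 ∧ zeroExt w.1 2 = 0}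
  zero_mem' := ⟨(H1 1 2).zero_mem, by simp [zeroExt_zero]⟩
  add_mem' := by
    intro w z hw hz
    exact ⟨(H1 1 2).add_mem hw.1 hz.1, by simp [zeroExt_add, hw.2, hz.2]⟩
  smul_mem' := by
    intro r w hw
    exact ⟨(H1 1 2).smul_mem r hw.1, by simp [zeroExt_smul, hw.2]⟩

/-- `H¹_R(1, 2)`, normed below by `‖y‖² = ∫₁² |y_x|² dx`. -/
def H1R : Type := ↥h1R

instance : AddCommGroup H1R := inferInstanceAs (AddCommGroup ↥h1R)

instance : Module ℂ H1R := inferInstanceAs (Module ℂ ↥h1R)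

/-- The function underlying an element of `H¹_R(1, 2)`. -/
def H1R.fn (y : H1R) : ℝ → ℂ := zeroExt (Subtype.val (p := (· ∈ h1R)) y).1

/-- The derivative `y_x` of an element of `H¹_R(1, 2)`. -/
def H1R.dx : H1R →ₗ[ℂ] L2 1 2 := (LinearMap.snd ℂ C(Icc (1 : ℝ) 2, ℂ) (L2 1 2)).comp h1R.subtype

theorem H1R.fn_add (y z : H1R) : (y + z).fn = y.fn + z.fn := zeroExt_add _ _

theorem H1R.fn_smul (r : ℂ) (y : H1R) : (r • y).fn = r • y.fn := zeroExt_smul _ _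

theorem H1R.isPrimitiveOn (y : H1R) : IsPrimitiveOn (Icc 1 2) y.fn y.dx := y.2.1

theorem H1R.fn_two (y : H1R) : y.fn 2 = 0 := y.2.2

theorem H1R.ext_fn {y z : H1R} (h : EqOn y.fn z.fn (Icc 1 2)) (h' : y.dx = z.dx) : y = z := by
  refine Subtype.ext (Prod.ext (ContinuousMap.ext fun x => ?_) h')
  have := h x.2
  simpa [H1R.fn, zeroExt_apply _ x.2] using this

theorem H1R.dx_injective : Function.Injective H1R.dx := by
  intro y z h
  refine H1R.ext_fn (fun x hx => ?_) h
  have h1 := (y.isPrimitiveOn x hx 2 (by norm_num)).2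
  have h2 := (z.isPrimitiveOn x hx 2 (by norm_num)).2
  rw [H1R.fn_two, h, ← h2, H1R.fn_two] at h1
  simpa using h1

/-- The inner product of `H¹_R(1, 2)`. -/
@[reducible]
def H1R.core : InnerProductSpace.Core ℂ H1R where
  inner y z := inner ℂ y.dx z.dx
  conj_inner_symm y z := inner_conj_symm _ _
  re_inner_nonneg y := inner_self_nonneg
  add_left x y z := by simp [inner_add_left]
  smul_left x y r := by simp [inner_smul_left]
  definite x hx := by
    apply H1R.dx_injective
    simpa using hx

instance : NormedAddCommGroup H1R := H1R.core.toNormedAddCommGroup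

instance : InnerProductSpace ℂ H1R := InnerProductSpace.ofCore H1R.core.toCore

theorem H1R.dx_surjective : Function.Surjective H1R.dx := by
  intro g
  have hg : Integrable g (volume.restrict (Ioo (1 : ℝ) 2)) :=
    (Lp.memLp g).integrable (by norm_num)
  have hI : IntervalIntegrable g volume 1 2 := by
    rw [intervalIntegrable_iff_integrableOn_Ioo_of_le (by norm_num)]
    exact hg
  have hsub : ∀ x ∈ Icc (1 : ℝ) 2, ∀ y ∈ Icc (1 : ℝ) 2, IntervalIntegrable g volume x y := by
    intro x hx y hy
    refine hI.mono_set ?_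
    rw [uIcc_of_le (by norm_num : (1 : ℝ) ≤ 2)]
    exact OrdConnected.uIcc_subset inferInstance hx hy
  have hc : ContinuousOn (fun x => ∫ t in (2 : ℝ)..x, g t) (Icc 1 2) := by
    have := intervalIntegral.continuousOn_primitive_interval' hI right_mem_uIcc
    rwa [uIcc_of_le (by norm_num : (1 : ℝ) ≤ 2)] at this
  let u : C(Icc (1 : ℝ) 2, ℂ) := ⟨fun x => ∫ t in (2 : ℝ)..x, g t, hc.domRestrict⟩
  have hu : ∀ x ∈ Icc (1 : ℝ) 2, zeroExt u x = ∫ t in (2 : ℝ)..x, g t := fun x hx =>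
    zeroExt_apply u hx
  have h2 : (2 : ℝ) ∈ Icc (1 : ℝ) 2 := by norm_num
  refine ⟨⟨(u, g), ?_, ?_⟩, rfl⟩
  · intro x hx y hy
    refine ⟨hsub x hx y hy, ?_⟩
    simp only [hu x hx, hu y hy]
    exact intervalIntegral.integral_interval_sub_left (hsub 2 h2 y hy) (hsub 2 h2 x hx)
  · simp [hu 2 h2]

/-- `y ↦ y_x` identifies `H¹_R(1, 2)` isometrically with `L²(1, 2)`. -/
def H1R.dxIso : H1R ≃ₗᵢ[ℂ] L2 1 2 where
  toLinearEquiv := LinearEquiv.ofBijective H1R.dx ⟨H1R.dx_injective, H1R.dx_surjective⟩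
  norm_map' y := by
    rw [norm_eq_sqrt_re_inner (𝕜 := ℂ) y, norm_eq_sqrt_re_inner (𝕜 := ℂ)]
    rfl

instance : CompleteSpace H1R :=
  (completeSpace_congr (e := H1R.dxIso.toEquiv) H1R.dxIso.isometry.isUniformEmbedding).2
    inferInstance

/-! ### The data of the transmission system -/

/-- The coefficients `a`, `b` of the degenerate wave equation on `(0, 1)`, the heat conductivity
`c`, the memory kernel `μ` and the parameter `m`, with all the assumptions made on them. -/
structure TransmissionData where
  /-- the leading coefficient -/
  a : ℝ → ℝ
  /-- the drift coefficient -/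
  b : ℝ → ℝ
  /-- the memory kernel; `μ 0` stands for its limit at `0` -/
  μ : ℝ → ℝ
  /-- the heat conductivity -/
  c : ℝ
  /-- `0` for the law of Fourier, in `(0, 1)` for Coleman-Gurtin, `1` for Gurtin-Pipkin -/
  m : ℝ
  a_cont : ContinuousOn a (Icc 0 1)
  b_cont : ContinuousOn b (Icc 0 1)
  b_div_a_integrable : IntegrableOn (fun x => b x / a x) (Ioo 0 1)
  a_zero : a 0 = 0
  a_pos : ∀ x ∈ Ioc (0 : ℝ) 1, 0 < a x
  a_mono : ∃ α > (0 : ℝ), ∃ δ ∈ Ioc (0 : ℝ) 1, MonotoneOn (fun x => x ^ α / a x) (Ioo 0 δ)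
  c_pos : 0 < c
  m_mem : m ∈ Icc (0 : ℝ) 1
  μ_nonneg : ∀ s > 0, 0 ≤ μ s
  μ_integrable : IntegrableOn μ (Ioi 0)
  μ_contDiff : ContDiffOn ℝ 1 μ (Ioi 0)
  μ_integral_pos : 0 < ∫ s in Ioi 0, μ s
  μ_tendsto : Tendsto μ (𝓝[>] 0) (𝓝 (μ 0))
  μ_dafermos : ∃ K > 0, ∀ s > 0, deriv μ s ≤ -K * μ s

namespace TransmissionData

variable (S : TransmissionData)

/-- The weight `η`. -/
def η (x : ℝ) : ℝ := Real.exp (∫ s in (1 / 2 : ℝ)..x, S.b s / S.a s)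

/-- The weight `σ = a / η`. -/
def σ (x : ℝ) : ℝ := S.a x / S.η x

theorem b_div_a_intervalIntegrable : IntervalIntegrable (fun x => S.b x / S.a x) volume 0 1 := by
  rw [intervalIntegrable_iff_integrableOn_Ioo_of_le zero_le_one]
  exact S.b_div_a_integrable

theorem η_pos (x : ℝ) : 0 < S.η x := Real.exp_pos _

theorem η_cont : ContinuousOn S.η (Icc 0 1) := by
  have h := intervalIntegral.continuousOn_primitive_interval' (a := 1 / 2)
    S.b_div_a_intervalIntegrable (by rw [uIcc_of_le zero_le_one]; norm_num)
  rw [uIcc_of_le zero_le_one] at h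
  exact h.rexp

theorem σ_pos {x : ℝ} (hx : x ∈ Ioc (0 : ℝ) 1) : 0 < S.σ x := div_pos (S.a_pos x hx) (S.η_pos x)

theorem σ_cont : ContinuousOn S.σ (Icc 0 1) :=
  S.a_cont.div S.η_cont fun x _ => (S.η_pos x).ne'

/-! ### The weighted spaces on `(0, 1)` -/

/-- The measure `(1/σ) dx` on `(0, 1)`. -/
def invσMeasure : Measure ℝ :=
  (volume.restrict (Ioo 0 1)).withDensity fun x => ENNReal.ofReal (1 / S.σ x)

/-- The space `L²_{1/σ}(0, 1)`. -/
abbrev L2σ : Type := Lp ℂ 2 S.invσMeasure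

/-- The elements `u` of `H¹(0, 1)` with `u 0 = 0` that lie in `L²_{1/σ}(0, 1)`. -/
def h1σL : Submodule ℂ (C(Icc (0 : ℝ) 1, ℂ) × L2 0 1) where
  carrier := {w | w ∈ H1 0 1 ∧ zeroExt w.1 0 = 0 ∧ MemLp (zeroExt w.1) 2 S.invσMeasure}
  zero_mem' := ⟨(H1 0 1).zero_mem, by simp [zeroExt_zero], by simp [zeroExt_zero]⟩
  add_mem' := by
    intro w z hw hz
    refine ⟨(H1 0 1).add_mem hw.1 hz.1, by simp [zeroExt_add, hw.2.1, hz.2.1], ?_⟩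
    rw [Prod.fst_add, zeroExt_add]
    exact hw.2.2.add hz.2.2
  smul_mem' := by
    intro r w hw
    refine ⟨(H1 0 1).smul_mem r hw.1, by simp [zeroExt_smul, hw.2.1], ?_⟩
    rw [Prod.smul_fst, zeroExt_smul]
    exact hw.2.2.const_smul r

/-- `H¹_{1/σ,L}(0, 1)`, normed below by the energy norm `‖u‖² = ∫₀¹ η |u_x|² dx`. -/
def H1σL : Type := ↥S.h1σL

instance : AddCommGroup S.H1σL := inferInstanceAs (AddCommGroup ↥S.h1σL)

instance : Module ℂ S.H1σL := inferInstanceAs (Module ℂ ↥S.h1σL)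

variable {S}

/-- The function underlying an element of `H¹_{1/σ,L}(0, 1)`. -/
def H1σL.fn (u : S.H1σL) : ℝ → ℂ := zeroExt (Subtype.val (p := (· ∈ S.h1σL)) u).1

/-- The derivative `u_x` of an element of `H¹_{1/σ,L}(0, 1)`. -/
def H1σL.dx : S.H1σL →ₗ[ℂ] L2 0 1 :=
  (LinearMap.snd ℂ C(Icc (0 : ℝ) 1, ℂ) (L2 0 1)).comp S.h1σL.subtype

theorem H1σL.fn_add (u v : S.H1σL) : (u + v).fn = u.fn + v.fn := zeroExt_add _ _

theorem H1σL.fn_smul (r : ℂ) (u : S.H1σL) : (r • u).fn = r • u.fn := zeroExt_smul _ _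

theorem H1σL.isPrimitiveOn (u : S.H1σL) : IsPrimitiveOn (Icc 0 1) u.fn u.dx := u.2.1

theorem H1σL.fn_zero (u : S.H1σL) : u.fn 0 = 0 := u.2.2.1

theorem H1σL.dx_injective : Function.Injective (H1σL.dx (S := S)) := by
  intro y z h
  have hfn : EqOn y.fn z.fn (Icc 0 1) := fun x hx => by
    have h1 := (y.isPrimitiveOn 0 (by norm_num) x hx).2
    have h2 := (z.isPrimitiveOn 0 (by norm_num) x hx).2
    rw [H1σL.fn_zero, h, ← h2, H1σL.fn_zero] at h1
    simpa using h1
  refine Subtype.ext (Prod.ext (ContinuousMap.ext fun x => ?_) h)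
  have := hfn x.2
  simpa [H1σL.fn, zeroExt_apply _ x.2] using this

theorem integrable_η_mul (f g : L2 0 1) :
    Integrable (fun x => (S.η x : ℂ) * (starRingEnd ℂ (f x) * g x))
      (volume.restrict (Ioo 0 1)) := by
  have h1 : Integrable (fun x => starRingEnd ℂ (f x) * g x) (volume.restrict (Ioo 0 1)) := by
    have := L2.integrable_inner (𝕜 := ℂ) f g
    refine this.congr (Eventually.of_forall fun x => ?_)
    simp [mul_comm]
  obtain ⟨C, hC⟩ := isCompact_Icc.exists_bound_of_continuousOn S.η_cont
  refine h1.bdd_mul (c := C) ?_ ?_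
  · exact (Complex.continuous_ofReal.comp_continuousOn
      (S.η_cont.mono Ioo_subset_Icc_self)).aestronglyMeasurable measurableSet_Ioo
  · refine (ae_restrict_iff' measurableSet_Ioo).2 (Eventually.of_forall fun x hx => ?_)
    simpa using hC x (Ioo_subset_Icc_self hx)

/-- The inner product of `H¹_{1/σ,L}(0, 1)` used in the energy space. -/
@[reducible]
def H1σL.core : InnerProductSpace.Core ℂ S.H1σL where
  inner u v := ∫ x in Ioo (0 : ℝ) 1, (S.η x : ℂ) * (starRingEnd ℂ (u.dx x) * v.dx x)
  conj_inner_symm u v := by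
    rw [← integral_conj]
    refine integral_congr_ae (Eventually.of_forall fun x => ?_)
    simp [mul_comm]
  re_inner_nonneg u := by
    have : ∀ x, (S.η x : ℂ) * (starRingEnd ℂ (u.dx x) * u.dx x)
        = ((S.η x * ‖u.dx x‖ ^ 2 : ℝ) : ℂ) := fun x => by
      rw [Complex.conj_mul']
      push_cast
      ring
    simp_rw [this]
    rw [integral_complex_ofReal]
    change 0 ≤ (∫ x in Ioo (0 : ℝ) 1, S.η x * ‖u.dx x‖ ^ 2)
    exact integral_nonneg fun x => mul_nonneg (S.η_pos x).le (by positivity)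
  add_left u v w := by
    rw [← integral_add (integrable_η_mul _ _) (integrable_η_mul _ _)]
    refine integral_congr_ae ?_
    filter_upwards [Lp.coeFn_add u.dx v.dx] with x hx
    rw [map_add, hx]
    simp only [Pi.add_apply, map_add]
    ring
  smul_left u v r := by
    rw [← integral_const_mul]
    refine integral_congr_ae ?_
    filter_upwards [Lp.coeFn_smul r u.dx] with x hx
    rw [map_smul, hx]
    simp only [Pi.smul_apply, smul_eq_mul, map_mul]
    ring
  definite u hu := by
    have h0 : ∀ x, (S.η x : ℂ) * (starRingEnd ℂ (u.dx x) * u.dx x)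
        = ((S.η x * ‖u.dx x‖ ^ 2 : ℝ) : ℂ) := fun x => by
      rw [Complex.conj_mul']
      push_cast
      ring
    have hi := (integrable_η_mul (S := S) u.dx u.dx)
    simp_rw [h0] at hu hi
    rw [integral_complex_ofReal] at hu
    have hu' := Complex.ofReal_eq_zero.1 hu
    have hi' : Integrable (fun x => S.η x * ‖u.dx x‖ ^ 2) (volume.restrict (Ioo 0 1)) := by
      exact hi.re
    rw [integral_eq_zero_iff_of_nonneg
      (fun x => mul_nonneg (S.η_pos x).le (by positivity)) hi'] at hu'
    apply H1σL.dx_injective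
    rw [map_zero]
    refine Lp.ext ?_
    filter_upwards [hu', Lp.coeFn_zero ℂ 2 (volume.restrict (Ioo (0 : ℝ) 1))] with x hx h'x
    rw [h'x]
    have hη := (S.η_pos x).ne'
    simpa [hη] using hx

instance : NormedAddCommGroup S.H1σL := H1σL.core.toNormedAddCommGroup

instance : InnerProductSpace ℂ S.H1σL := InnerProductSpace.ofCore H1σL.core.toCore

variable (S)

/-! ### The memory space and the energy space -/

/-- The measure `c m μ(s) ds` on `(0, ∞)`. -/
def memoryMeasure : Measure ℝ :=
  (volume.restrict (Ioi 0)).withDensity fun s => ENNReal.ofReal (S.c * S.m * S.μ s)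

/-- The memory space `W`: square integrable functions of `s > 0` with values in `H¹_R(1, 2)`, for
the measure `c m μ(s) ds`. For `m = 0` this measure, hence the norm of `W`, vanishes, and `W` is
the zero space. -/
abbrev W : Type := Lp H1R 2 S.memoryMeasure

/-- The energy space
`H¹_{1/σ,L}(0, 1) × L²_{1/σ}(0, 1) × L²(1, 2) × W`, with the sum of the four inner products. -/
abbrev Energy : Type := WithLp 2 (S.H1σL × WithLp 2 (S.L2σ × WithLp 2 (L2 1 2 × S.W)))

variable {S}

/-- The component `u` of `(u, v, y, γ)`. -/
def Energy.u (U : S.Energy) : S.H1σL := U.fst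

/-- The component `v` of `(u, v, y, γ)`. -/
def Energy.v (U : S.Energy) : S.L2σ := U.snd.fst

/-- The component `y` of `(u, v, y, γ)`. -/
def Energy.y (U : S.Energy) : L2 1 2 := U.snd.snd.fst

/-- The component `γ` of `(u, v, y, γ)`. -/
def Energy.γ (U : S.Energy) : S.W := U.snd.snd.snd

/-- The inner product of the energy space, written out (conjugate linear in the first variable). -/
theorem energy_inner (U V : S.Energy) : inner ℂ U V =
    (∫ x in Ioo (0 : ℝ) 1, (S.η x : ℂ) * (starRingEnd ℂ (U.u.dx x) * V.u.dx x)) +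
      ((∫ x, inner ℂ (U.v x) (V.v x) ∂S.invσMeasure) +
        ((∫ x in Ioo (1 : ℝ) 2, inner ℂ (U.y x) (V.y x)) +
          ∫ s, inner ℂ (U.γ s) (V.γ s) ∂S.memoryMeasure)) := rfl

/-! ### The operator -/

theorem μ_antitone : AntitoneOn S.μ (Ioi 0) := by
  obtain ⟨K, hK, h⟩ := S.μ_dafermos
  refine antitoneOn_of_deriv_nonpos (convex_Ioi 0) S.μ_contDiff.continuousOn ?_ ?_
  · rw [interior_Ioi]
    exact S.μ_contDiff.differentiableOn one_ne_zero
  · rw [interior_Ioi]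
    intro s hs
    have h1 := h s hs
    have h2 := mul_nonneg hK.le (S.μ_nonneg s hs)
    linarith

variable (S) in
/-- The interval of all `s ≥ 0` that the memory sees: `0` and the points where `c m μ > 0`. Up to
null sets, the classes in `W` are functions on this interval. -/
def memoryInterval : Set ℝ := insert 0 {s | 0 < s ∧ 0 < S.c * S.m * S.μ s}

instance : S.memoryInterval.OrdConnected := by
  refine ⟨fun x hx y hy z hz => ?_⟩
  rcases (show 0 ≤ x by rcases hx with rfl | hx; exacts [le_rfl, hx.1.le]).trans hz.1 |>.eq_or_lt
    with h | h
  · exact Or.inl h.symm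
  · rcases hy with rfl | hy
    · exact absurd (h.trans_le hz.2) (lt_irrefl _)
    · refine Or.inr ⟨h, hy.2.trans_le ?_⟩
      exact mul_le_mul_of_nonneg_left (S.μ_antitone h hy.1 hz.2)
        (mul_nonneg S.c_pos.le S.m_mem.1)

/-- `ζ = c (1 - m) y + c m ∫₀^∞ μ(s) γ(s) ds`. -/
def zeta (y : H1R) (γ : S.W) : H1R :=
  ((S.c * (1 - S.m) : ℝ) : ℂ) • y +
    ((S.c * S.m : ℝ) : ℂ) • ∫ s in Ioi 0, (S.μ s : ℂ) • γ s

/-- `IsValue U F q y z Γ γs` says that `U = (u, v, y, γ)` lies in the domain of the operator and is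
mapped to `F`. Here `q` is the continuous representative of `η u_x` on `(0, 1]`, `y` the
representative of the third component in `H¹_R(1, 2)`, `z` is `ζ_x`, `Γ` is the continuous
representative of `γ`, and `γs` is the derivative of `γ` in `s`. -/
structure IsValue (U F : S.Energy) (q : ℝ → ℂ) (y : H1R) (z : H1 1 2) (Γ : ℝ → H1R)
    (γs : S.W) : Prop where
  /-- `v ∈ H¹_{1/σ,L}(0, 1)`, and the first component of the value is `v` -/
  v_eq : U.v =ᵐ[S.invσMeasure] F.u.fn
  /-- `q = η u_x` -/
  flux_eq : q =ᵐ[volume.restrict (Ioo 0 1)] fun x => (S.η x : ℂ) * U.u.dx x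
  /-- `u ∈ H²_{1/σ,L}(0, 1)`, and the second component of the value is `σ (η u_x)_x` -/
  flux_deriv : IsPrimitiveOn (Ioc 0 1) q fun x => F.v x / (S.σ x : ℂ)
  /-- `y ∈ H¹_R(1, 2)` -/
  y_eq : U.y =ᵐ[volume.restrict (Ioo 1 2)] y.fn
  /-- `ζ ∈ H²(1, 2)`, since `ζ_x = z ∈ H¹(1, 2)` -/
  zeta_eq : (zeta y U.γ).dx =ᵐ[volume.restrict (Ioo 1 2)] zeroExt z.1.1
  /-- the third component of the value is `ζ_xx` -/
  zeta_deriv : F.y = z.1.2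
  /-- `Γ` represents `γ` -/
  γ_eq : U.γ =ᵐ[S.memoryMeasure] Γ
  /-- `γ(·, 0) = 0` -/
  γ_zero : Γ 0 = 0
  /-- `γ_s ∈ W` -/
  γ_deriv : IsPrimitiveOn S.memoryInterval Γ γs
  /-- the fourth component of the value is `-γ_s + y` -/
  γ_value : F.γ =ᵐ[S.memoryMeasure] fun s => -γs s + y
  /-- `η(1) u_x(1) = ζ_x(1)` -/
  flux_one : q 1 = zeroExt z.1.1 1
  /-- `v(1) = y(1)` -/
  v_one : F.u.fn 1 = y.fn 1

theorem integrable_μ : Integrable (fun s => S.c * S.m * S.μ s) (volume.restrict (Ioi 0)) :=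
  S.μ_integrable.const_mul _

instance : IsFiniteMeasure S.memoryMeasure :=
  isFiniteMeasure_withDensity_ofReal S.integrable_μ.2

theorem zeta_eq_integral (y : H1R) (γ : S.W) :
    zeta y γ = ((S.c * (1 - S.m) : ℝ) : ℂ) • y + ∫ s, γ s ∂S.memoryMeasure := by
  have hW : ∫ s, γ s ∂S.memoryMeasure
      = ∫ s in Ioi 0, (ENNReal.ofReal (S.c * S.m * S.μ s)).toReal • γ s :=
    integral_withDensity_eq_integral_toReal_smul₀
    S.integrable_μ.aestronglyMeasurable.aemeasurable.ennreal_ofReal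
    (Eventually.of_forall fun _ => ENNReal.ofReal_lt_top) _
  rw [zeta, hW, ← integral_smul]
  congr 1
  refine setIntegral_congr_fun measurableSet_Ioi fun s hs => ?_
  rw [ENNReal.toReal_ofReal
    (mul_nonneg (mul_nonneg S.c_pos.le S.m_mem.1) (S.μ_nonneg s hs)), smul_smul,
    ← Complex.ofReal_mul, Complex.coe_smul]

theorem integrable_memory (γ : S.W) : Integrable γ S.memoryMeasure :=
  (Lp.memLp γ).integrable (by norm_num)

theorem zeta_add (y y' : H1R) (γ γ' : S.W) : zeta (y + y') (γ + γ') = zeta y γ + zeta y' γ' := by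
  simp only [zeta_eq_integral]
  rw [integral_congr_ae (Lp.coeFn_add γ γ')]
  simp only [Pi.add_apply]
  rw [integral_add (integrable_memory γ) (integrable_memory γ'), smul_add]
  abel

theorem zeta_smul (r : ℂ) (y : H1R) (γ : S.W) : zeta (r • y) (r • γ) = r • zeta y γ := by
  simp only [zeta_eq_integral]
  rw [integral_congr_ae (Lp.coeFn_smul r γ)]
  simp only [Pi.smul_apply]
  rw [integral_smul, smul_add, smul_comm]

theorem ae_memory {P : ℝ → Prop} :
    (∀ᵐ s ∂S.memoryMeasure, P s) ↔ ∀ᵐ s, s ∈ S.memoryInterval → P s := by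
  rw [memoryMeasure, ae_withDensity_iff'
    S.integrable_μ.aestronglyMeasurable.aemeasurable.ennreal_ofReal,
    ae_restrict_iff' measurableSet_Ioi]
  have h0 : ∀ᵐ s : ℝ, s ≠ 0 := by simp [ae_iff]
  constructor
  · intro h
    filter_upwards [h, h0] with s hs hs0 hsI
    rcases hsI with rfl | hsI
    · exact absurd rfl hs0
    · exact hs hsI.1 (by simpa using hsI.2)
  · intro h
    filter_upwards [h] with s hs hs1 hs2
    exact hs (Or.inr ⟨hs1, by simpa using hs2⟩)

theorem ae_invσ {P : ℝ → Prop} :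
    (∀ᵐ x ∂S.invσMeasure, P x) ↔ ∀ᵐ x ∂(volume.restrict (Ioo 0 1)), P x := by
  have hm : AEMeasurable (fun x => ENNReal.ofReal (1 / S.σ x)) (volume.restrict (Ioo 0 1)) := by
    refine AEMeasurable.ennreal_ofReal ?_
    refine ContinuousOn.aemeasurable ?_ measurableSet_Ioo
    exact continuousOn_const.div (S.σ_cont.mono Ioo_subset_Icc_self)
      fun x hx => (S.σ_pos (Ioo_subset_Ioc_self hx)).ne'
  rw [invσMeasure, ae_withDensity_iff' hm, ae_restrict_iff' measurableSet_Ioo,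
    ae_restrict_iff' measurableSet_Ioo]
  refine eventually_congr (Eventually.of_forall fun x => ?_)
  refine forall_congr' fun hx => ?_
  have : ENNReal.ofReal (1 / S.σ x) ≠ 0 := by
    simpa using S.σ_pos (Ioo_subset_Ioc_self hx)
  exact ⟨fun h => h this, fun h _ => h⟩

theorem ae_mem_Ioc_of_ae_restrict {p q : ℝ} {P : ℝ → Prop}
    (h : ∀ᵐ x ∂(volume.restrict (Ioo p q)), P x) : ∀ᵐ x, x ∈ Ioc p q → P x := by
  filter_upwards [ae_mem_Icc_of_ae_restrict h] with x hx h'x using hx (Ioc_subset_Icc_self h'x)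

theorem IsValue.add {U F U' F' : S.Energy} {q q' : ℝ → ℂ} {y y' : H1R} {z z' : H1 1 2}
    {Γ Γ' : ℝ → H1R} {γs γs' : S.W} (h : IsValue U F q y z Γ γs)
    (h' : IsValue U' F' q' y' z' Γ' γs') :
    IsValue (U + U') (F + F') (q + q') (y + y') (z + z') (Γ + Γ') (γs + γs') where
  v_eq := by
    filter_upwards [h.v_eq, h'.v_eq, Lp.coeFn_add U.v U'.v] with x h1 h2 h3
    change (U.v + U'.v : S.L2σ) x = (F.u + F'.u).fn x
    rw [h3, H1σL.fn_add, Pi.add_apply, Pi.add_apply, h1, h2]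
  flux_eq := by
    filter_upwards [h.flux_eq, h'.flux_eq, Lp.coeFn_add U.u.dx U'.u.dx] with x h1 h2 h3
    change q x + q' x = S.η x * (H1σL.dx (U.u + U'.u)) x
    rw [map_add, h3, Pi.add_apply, h1, h2, mul_add]
  flux_deriv := by
    refine (h.flux_deriv.add h'.flux_deriv).congr (fun _ _ => rfl) ?_
    apply ae_mem_Ioc_of_ae_restrict
    filter_upwards [ae_invσ.1 (Lp.coeFn_add F.v F'.v)] with x h3
    change F.v x / S.σ x + F'.v x / S.σ x = (F.v + F'.v : S.L2σ) x / S.σ x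
    rw [h3, Pi.add_apply, add_div]
  y_eq := by
    filter_upwards [h.y_eq, h'.y_eq, Lp.coeFn_add U.y U'.y] with x h1 h2 h3
    change (U.y + U'.y : L2 1 2) x = (y + y').fn x
    rw [h3, H1R.fn_add, Pi.add_apply, Pi.add_apply, h1, h2]
  zeta_eq := by
    change (zeta (y + y') (U.γ + U'.γ)).dx =ᵐ[_] zeroExt (z.1.1 + z'.1.1)
    rw [zeta_add, map_add, zeroExt_add]
    exact (Lp.coeFn_add _ _).trans (h.zeta_eq.add h'.zeta_eq)
  zeta_deriv := by
    change F.y + F'.y = z.1.2 + z'.1.2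
    rw [h.zeta_deriv, h'.zeta_deriv]
  γ_eq := (Lp.coeFn_add _ _).trans (h.γ_eq.add h'.γ_eq)
  γ_zero := by simp [h.γ_zero, h'.γ_zero]
  γ_deriv := by
    refine (h.γ_deriv.add h'.γ_deriv).congr (fun _ _ => rfl) ?_
    filter_upwards [ae_memory.1 (Lp.coeFn_add γs γs')] with s hs h's
    exact (hs h's).symm
  γ_value := by
    filter_upwards [h.γ_value, h'.γ_value, Lp.coeFn_add F.γ F'.γ, Lp.coeFn_add γs γs']
      with s h1 h2 h3 h4
    change (F.γ + F'.γ : S.W) s = _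
    rw [h3, h4, Pi.add_apply, Pi.add_apply, h1, h2]
    abel
  flux_one := by
    change q 1 + q' 1 = zeroExt (z.1.1 + z'.1.1) 1
    rw [zeroExt_add, h.flux_one, h'.flux_one, Pi.add_apply]
  v_one := by
    change (F.u + F'.u).fn 1 = _
    rw [H1σL.fn_add, H1R.fn_add, Pi.add_apply, Pi.add_apply, h.v_one, h'.v_one]

theorem IsValue.smul {U F : S.Energy} {q : ℝ → ℂ} {y : H1R} {z : H1 1 2}
    {Γ : ℝ → H1R} {γs : S.W} (r : ℂ) (h : IsValue U F q y z Γ γs) :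
    IsValue (r • U) (r • F) (r • q) (r • y) (r • z) (r • Γ) (r • γs) where
  v_eq := by
    filter_upwards [h.v_eq, Lp.coeFn_smul r U.v] with x h1 h3
    change (r • U.v : S.L2σ) x = (r • F.u).fn x
    rw [h3, H1σL.fn_smul, Pi.smul_apply, Pi.smul_apply, h1]
  flux_eq := by
    filter_upwards [h.flux_eq, Lp.coeFn_smul r U.u.dx] with x h1 h3
    change r * q x = S.η x * (H1σL.dx (r • U.u)) x
    rw [map_smul, h3, Pi.smul_apply, h1, smul_eq_mul]
    ring
  flux_deriv := by
    refine (h.flux_deriv.smul r).congr (fun _ _ => rfl) ?_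
    apply ae_mem_Ioc_of_ae_restrict
    filter_upwards [ae_invσ.1 (Lp.coeFn_smul r F.v)] with x h3
    change r * (F.v x / S.σ x) = (r • F.v : S.L2σ) x / S.σ x
    rw [h3, Pi.smul_apply, smul_eq_mul, mul_div_assoc]
  y_eq := by
    filter_upwards [h.y_eq, Lp.coeFn_smul r U.y] with x h1 h3
    change (r • U.y : L2 1 2) x = (r • y).fn x
    rw [h3, H1R.fn_smul, Pi.smul_apply, Pi.smul_apply, h1]
  zeta_eq := by
    change (zeta (r • y) (r • U.γ)).dx =ᵐ[_] zeroExt (r • z.1.1)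
    rw [zeta_smul, map_smul, zeroExt_smul]
    exact (Lp.coeFn_smul _ _).trans (h.zeta_eq.const_smul r)
  zeta_deriv := by
    change r • F.y = r • z.1.2
    rw [h.zeta_deriv]
  γ_eq := (Lp.coeFn_smul _ _).trans (h.γ_eq.const_smul r)
  γ_zero := by simp [h.γ_zero]
  γ_deriv := by
    refine (h.γ_deriv.smul r).congr (fun _ _ => rfl) ?_
    filter_upwards [ae_memory.1 (Lp.coeFn_smul r γs)] with s hs h's
    exact (hs h's).symm
  γ_value := by
    filter_upwards [h.γ_value, Lp.coeFn_smul r F.γ, Lp.coeFn_smul r γs] with s h1 h3 h4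
    change (r • F.γ : S.W) s = _
    rw [h3, h4, Pi.smul_apply, Pi.smul_apply, h1, smul_add, smul_neg]
  flux_one := by
    change r * q 1 = zeroExt (r • z.1.1) 1
    rw [zeroExt_smul, h.flux_one, Pi.smul_apply, smul_eq_mul]
  v_one := by
    change (r • F.u).fn 1 = _
    rw [H1σL.fn_smul, H1R.fn_smul, Pi.smul_apply, Pi.smul_apply, h.v_one]

theorem IsValue.zero : IsValue (0 : S.Energy) 0 0 0 0 0 0 where
  v_eq := by
    filter_upwards [Lp.coeFn_zero ℂ 2 S.invσMeasure] with x h1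
    change (0 : S.L2σ) x = zeroExt 0 x
    rw [h1, zeroExt_zero]
  flux_eq := by
    filter_upwards [Lp.coeFn_zero ℂ 2 (volume.restrict (Ioo (0 : ℝ) 1))] with x h1
    change 0 = (S.η x : ℂ) * (0 : L2 0 1) x
    rw [h1]
    simp
  flux_deriv := by
    refine IsPrimitiveOn.zero.congr (fun _ _ => rfl) ?_
    apply ae_mem_Ioc_of_ae_restrict
    filter_upwards [ae_invσ.1 (Lp.coeFn_zero ℂ 2 S.invσMeasure)] with x h3
    change 0 = (0 : S.L2σ) x / S.σ x
    rw [h3]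
    simp
  y_eq := by
    filter_upwards [Lp.coeFn_zero ℂ 2 (volume.restrict (Ioo (1 : ℝ) 2))] with x h1
    change (0 : L2 1 2) x = zeroExt 0 x
    rw [h1, zeroExt_zero]
  zeta_eq := by
    change (zeta 0 (0 : S.W)).dx =ᵐ[_] zeroExt 0
    have h : zeta 0 (0 : S.W) = 0 := by simpa using zeta_smul (0 : ℂ) 0 (0 : S.W)
    rw [h, map_zero, zeroExt_zero]
    exact Lp.coeFn_zero _ _ _
  zeta_deriv := rfl
  γ_eq := Lp.coeFn_zero _ _ _
  γ_zero := rfl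
  γ_deriv := by
    refine IsPrimitiveOn.zero.congr (fun _ _ => rfl) ?_
    filter_upwards [ae_memory.1 (Lp.coeFn_zero H1R 2 S.memoryMeasure)] with s hs h's
    exact (hs h's).symm
  γ_value := by
    filter_upwards [Lp.coeFn_zero H1R 2 S.memoryMeasure] with s h1
    change (0 : S.W) s = -(0 : S.W) s + 0
    rw [h1]
    simp
  flux_one := by
    change 0 = zeroExt 0 1
    rw [zeroExt_zero, Pi.zero_apply]
  v_one := by
    change zeroExt 0 1 = zeroExt 0 1
    rw [zeroExt_zero, zeroExt_zero]

variable (S) in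
/-- The graph of the operator. -/
def graph : Submodule ℂ (S.Energy × S.Energy) where
  carrier := {p | ∃ q y z Γ γs, IsValue p.1 p.2 q y z Γ γs}
  zero_mem' := ⟨_, _, _, _, _, IsValue.zero⟩
  add_mem' := by
    rintro p p' ⟨_, _, _, _, _, h⟩ ⟨_, _, _, _, _, h'⟩
    exact ⟨_, _, _, _, _, h.add h'⟩
  smul_mem' := by
    rintro r p ⟨_, _, _, _, _, h⟩
    exact ⟨_, _, _, _, _, h.smul r⟩

theorem graph_single_valued (p : S.Energy × S.Energy) (hp : p ∈ S.graph) (h0 : p.1 = 0) :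
    p.2 = 0 := by
  obtain ⟨U, F⟩ := p
  obtain ⟨q, y, z, Γ, γs, h⟩ := hp
  dsimp only at h0 h ⊢
  subst h0
  have hu : F.u = 0 := by
    apply H1σL.dx_injective
    rw [map_zero]
    have h1 := F.u.isPrimitiveOn.ae_eq_zero (ae_mem_Icc_of_ae_restrict (ae_invσ.1 (by
      filter_upwards [h.v_eq, Lp.coeFn_zero ℂ 2 S.invσMeasure] with x h1 h2
      exact h1.symm.trans h2)))
    refine Lp.ext ?_
    filter_upwards [Lp.coeFn_zero ℂ 2 (volume.restrict (Ioo (0 : ℝ) 1)),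
      ae_restrict_of_ae h1, ae_restrict_mem measurableSet_Ioo] with x h2 h3 h4
    rw [h2, h3 (Ioo_subset_Icc_self h4), Pi.zero_apply]
  have hv : F.v = 0 := by
    have h1 := h.flux_deriv.ae_eq_zero (ae_mem_Ioc_of_ae_restrict (by
      filter_upwards [h.flux_eq, Lp.coeFn_zero ℂ 2 (volume.restrict (Ioo (0 : ℝ) 1))]
        with x h1 h2
      rw [h1]
      change (S.η x : ℂ) * (0 : L2 0 1) x = 0
      rw [h2]
      simp))
    refine Lp.ext ?_
    filter_upwards [Lp.coeFn_zero ℂ 2 S.invσMeasure, ae_invσ.2 (ae_restrict_of_ae h1),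
      ae_invσ.2 (ae_restrict_mem measurableSet_Ioo)] with x h2 h3 h4
    have h5 := h3 (Ioo_subset_Ioc_self h4)
    have h6 := (S.σ_pos (Ioo_subset_Ioc_self h4)).ne'
    rw [h2]
    simpa [h6] using h5
  have hy : y = 0 := by
    apply H1R.dx_injective
    rw [map_zero]
    have h1 := y.isPrimitiveOn.ae_eq_zero (ae_mem_Icc_of_ae_restrict (by
      filter_upwards [h.y_eq, Lp.coeFn_zero ℂ 2 (volume.restrict (Ioo (1 : ℝ) 2))] with x h1 h2
      exact h1.symm.trans h2))
    refine Lp.ext ?_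
    filter_upwards [Lp.coeFn_zero ℂ 2 (volume.restrict (Ioo (1 : ℝ) 2)),
      ae_restrict_of_ae h1, ae_restrict_mem measurableSet_Ioo] with x h2 h3 h4
    rw [h2, h3 (Ioo_subset_Icc_self h4), Pi.zero_apply]
  subst hy
  have hz : F.y = 0 := by
    rw [h.zeta_deriv]
    have hzp : IsPrimitiveOn (Icc 1 2) (zeroExt z.1.1) z.1.2 := z.2
    have h0 : zeta 0 (0 : S.W) = 0 := by simpa using zeta_smul (0 : ℂ) 0 (0 : S.W)
    have h1 := hzp.ae_eq_zero (ae_mem_Icc_of_ae_restrict (by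
      have h2 : (zeta 0 (0 : S.W)).dx =ᵐ[volume.restrict (Ioo 1 2)] zeroExt z.1.1 := h.zeta_eq
      rw [h0, map_zero] at h2
      filter_upwards [h2, Lp.coeFn_zero ℂ 2 (volume.restrict (Ioo (1 : ℝ) 2))] with x h1 h2
      exact h1.symm.trans h2))
    refine Lp.ext ?_
    filter_upwards [Lp.coeFn_zero ℂ 2 (volume.restrict (Ioo (1 : ℝ) 2)),
      ae_restrict_of_ae h1, ae_restrict_mem measurableSet_Ioo] with x h2 h3 h4
    rw [h2, h3 (Ioo_subset_Icc_self h4), Pi.zero_apply]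
  have hγ : F.γ = 0 := by
    have h1 := h.γ_deriv.ae_eq_zero (ae_memory.1 (by
      filter_upwards [h.γ_eq, Lp.coeFn_zero H1R 2 S.memoryMeasure] with s h1 h2
      exact h1.symm.trans h2))
    refine Lp.ext ?_
    filter_upwards [h.γ_value, Lp.coeFn_zero H1R 2 S.memoryMeasure, ae_memory.2 h1]
      with s h2 h3 h4
    rw [h2, h3, h4]
    simp
  exact congrArg (WithLp.toLp 2) (Prod.ext hu (congrArg (WithLp.toLp 2)
    (Prod.ext hv (congrArg (WithLp.toLp 2) (Prod.ext hz hγ)))))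

variable (S) in
/-- The operator `𝒜 (u, v, y, γ) = (v, σ (η u_x)_x, ζ_xx, -γ_s + y)` with its domain. -/
def operator : S.Energy →ₗ.[ℂ] S.Energy := S.graph.toLinearPMap

/-- The operator has the graph from which it was defined. -/
theorem operator_graph : S.operator.graph = S.graph :=
  Submodule.toLinearPMap_graph_eq _ graph_single_valued

end TransmissionData

/-! ### Dissipative operators and semigroups -/

section Semigroup

variable {H : Type*} [NormedAddCommGroup H] [InnerProductSpace ℂ H]

/-- `A` is m-dissipative: `Re ⟨A U, U⟩ ≤ 0` on the domain, and `λ - A` maps the domain onto the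
whole space for all `λ > 0`. -/
def IsMDissipative (A : H →ₗ.[ℂ] H) : Prop :=
  (∀ U : A.domain, (inner ℂ (U : H) (A U)).re ≤ 0) ∧
    ∀ l : ℝ, 0 < l → ∀ F : H, ∃ U : A.domain, (l : ℂ) • (U : H) - A U = F

/-- `T` is a `C₀`-semigroup of contractions (only its values at `t ≥ 0` matter). -/
structure IsContractionSemigroup (T : ℝ → H →L[ℂ] H) : Prop where
  zero : T 0 = ContinuousLinearMap.id ℂ H
  add : ∀ s t, 0 ≤ s → 0 ≤ t → T (s + t) = (T s).comp (T t)
  continuous : ∀ U : H, ContinuousOn (fun t => T t U) (Ici 0)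
  contraction : ∀ t, 0 ≤ t → ‖T t‖ ≤ 1

/-- `A` is the infinitesimal generator of `T`: the limit of `(T t U - U) / t` as `t → 0⁺` exists
exactly for `U` in the domain of `A`, and is `A U`. -/
def IsGenerator (A : H →ₗ.[ℂ] H) (T : ℝ → H →L[ℂ] H) : Prop :=
  ∀ U F : H, (U, F) ∈ A.graph ↔
    Tendsto (fun t : ℝ => ((t⁻¹ : ℝ) : ℂ) • (T t U - U)) (𝓝[>] 0) (𝓝 F)

/-- `U` is a classical solution of `U_t = A U`, `U(0) = U₀`, on `[0, ∞)`. -/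
structure IsClassicalSolution (A : H →ₗ.[ℂ] H) (U₀ : H) (U : ℝ → H) : Prop where
  initial : U 0 = U₀
  equation : ∃ U' : ℝ → H, ContinuousOn U' (Ici 0) ∧
    ∀ t, 0 ≤ t → HasDerivWithinAt U (U' t) (Ici 0) t ∧ (U t, U' t) ∈ A.graph

end Semigroup

end DegenerateWaveHeat

end

/-!
Integrating by parts, the boundary terms at `x = 1` cancel by the transmission conditions and
`μ' ≤ 0` gives a sign to the memory term, so the operator is dissipative. For the resolvent
equation, the memory variable is found by solving an ordinary differential equation in `s`, which
leaves an elliptic transmission problem for `u` and for the flux `ζ`; its weak solution is an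
orthogonal projection in a Hilbert space, and its regularity is recovered by testing with
functions that vanish near the degenerate point.

The energy norm alone need not be complete, because it does not control `u` in `L²_{1/σ}(0, 1)`.
Adding this term to the norm gives a Hilbert space on which the operator is dissipative up to a
multiple of the identity, so that the Yosida approximation yields a semigroup there. Dissipativity
for the energy norm makes it contractive in that norm.
-/

namespace DegenerateWaveHeat

/-! ### Contraction semigroups on inner product spaces -/

section StrongConvergence

variable {ι 𝕜 E F : Type*} [NontriviallyNormedField 𝕜] [SeminormedAddCommGroup E]
  [SeminormedAddCommGroup F] [NormedSpace 𝕜 E] [NormedSpace 𝕜 F] {l : Filter ι}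
  {T : ι → E →L[𝕜] F} {C : ℝ}

theorem tendsto_apply_of_dense (hT : ∀ i x, ‖T i x‖ ≤ C * ‖x‖) {L : E → F} (hL : Continuous L)
    {s : Set E} (hs : Dense s) (h : ∀ x ∈ s, Tendsto (fun i => T i x) l (𝓝 (L x))) (x : E) :
    Tendsto (fun i => T i x) l (𝓝 (L x)) := by
  have hequi : Equicontinuous ((↑) ∘ T : ι → E → F) :=
    ((NormedSpace.equicontinuous_TFAE T).out 3 1 rfl rfl).1 ⟨C, hT⟩
  exact (hequi.isClosed_setOfPred_tendsto hL).closure_subset_iff.2 h (hs x)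

theorem tendsto_apply_tendsto (hT : ∀ i x, ‖T i x‖ ≤ C * ‖x‖) {w : ι → E} {x : E} {y : F}
    (hw : Tendsto w l (𝓝 x)) (h : Tendsto (fun i => T i x) l (𝓝 y)) :
    Tendsto (fun i => T i (w i)) l (𝓝 y) := by
  have hdiff : Tendsto (fun i => T i (w i - x)) l (𝓝 0) := by
    refine squeeze_zero_norm (fun i => hT i (w i - x)) ?_
    simpa using ((hw.sub_const x).norm).const_mul C
  simpa using hdiff.add h

theorem cauchySeq_apply_of_dense {T : ℕ → E →L[𝕜] F} (hT : ∀ n x, ‖T n x‖ ≤ ‖x‖) {s : Set E}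
    (hs : Dense s) (h : ∀ x ∈ s, CauchySeq fun n => T n x) (x : E) :
    CauchySeq fun n => T n x := by
  rw [Metric.cauchySeq_iff']
  intro ε hε
  obtain ⟨y, hy, hxy⟩ := hs.exists_dist_lt x (show 0 < ε / 3 by positivity)
  obtain ⟨N, hN⟩ := Metric.cauchySeq_iff'.1 (h y hy) (ε / 3) (by positivity)
  have hle : ∀ n, dist (T n x) (T n y) ≤ dist x y := fun n => by
    simpa only [dist_eq_norm, map_sub] using hT n (x - y)
  refine ⟨N, fun n hn => ?_⟩
  have hN' := dist_comm (T N x) (T N y) ▸ hle N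
  linarith [dist_triangle4 (T n x) (T n y) (T N y) (T N x), hle n, hN n hn]

end StrongConvergence

section Dissipative

variable {H : Type*} [NormedAddCommGroup H] [InnerProductSpace ℂ H]

theorem re_inner_sub_self_nonpos {x y : H} (h : ‖y‖ ≤ ‖x‖) : (inner ℂ x (y - x)).re ≤ 0 := by
  have hxy : (inner ℂ x y).re ≤ ‖x‖ * ‖y‖ := re_inner_le_norm (𝕜 := ℂ) x y
  have hxx : (inner ℂ x x).re = ‖x‖ ^ 2 := inner_self_eq_norm_sq (𝕜 := ℂ) x
  rw [inner_sub_right, Complex.sub_re, hxx]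
  nlinarith [norm_nonneg x]

theorem antitoneOn_norm_of_re_inner_deriv_nonpos {w w' : ℝ → H}
    (hw : ∀ t, 0 ≤ t → HasDerivWithinAt w (w' t) (Ici 0) t)
    (hd : ∀ t, 0 ≤ t → (inner ℂ (w t) (w' t)).re ≤ 0) :
    AntitoneOn (fun t => ‖w t‖) (Ici 0) := by
  let _ : InnerProductSpace ℝ H := InnerProductSpace.complexToReal
  have hsq : AntitoneOn (fun t => ‖w t‖ ^ 2) (Ici 0) := by
    refine antitoneOn_of_hasDerivWithinAt_nonpos (f' := fun t => 2 * (inner ℂ (w t) (w' t)).re)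
      (convex_Ici 0) (fun t ht => (hw t ht).continuousWithinAt.norm.pow 2) ?_ ?_ <;>
      rw [interior_Ici] <;> intro t ht
    · exact (hw t (le_of_lt ht)).norm_sq.mono Ioi_subset_Ici_self
    · linarith [hd t (le_of_lt ht)]
  exact fun s hs t ht hst =>
    (pow_le_pow_iff_left₀ (norm_nonneg _) (norm_nonneg _) two_ne_zero).1 (hsq hs ht hst)

theorem isMDissipative_iff_graph {A : H →ₗ.[ℂ] H} : IsMDissipative A ↔
    (∀ U F, (U, F) ∈ A.graph → (inner ℂ U F).re ≤ 0) ∧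
      ∀ l : ℝ, 0 < l → ∀ G, ∃ U F, (U, F) ∈ A.graph ∧ (l : ℂ) • U - F = G := by
  simp [IsMDissipative, LinearPMap.mem_graph_iff]

namespace IsMDissipative

variable {A : H →ₗ.[ℂ] H} {U F : H} {l : ℝ}

theorem re_inner_nonpos (hA : IsMDissipative A) (h : (U, F) ∈ A.graph) : (inner ℂ U F).re ≤ 0 :=
  (isMDissipative_iff_graph.1 hA).1 U F h

theorem mul_norm_le (hA : IsMDissipative A) (h : (U, F) ∈ A.graph) (l : ℝ) :
    l * ‖U‖ ≤ ‖(l : ℂ) • U - F‖ := by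
  have hinner : (inner ℂ U ((l : ℂ) • U - F)).re = l * ‖U‖ ^ 2 - (inner ℂ U F).re := by
    rw [inner_sub_right, inner_smul_right, Complex.sub_re, Complex.re_ofReal_mul,
      ← inner_self_eq_norm_sq (𝕜 := ℂ), RCLike.re_eq_complex_re]
  have hle : (inner ℂ U ((l : ℂ) • U - F)).re ≤ ‖U‖ * ‖(l : ℂ) • U - F‖ :=
    re_inner_le_norm (𝕜 := ℂ) _ _
  rcases (norm_nonneg U).eq_or_lt with hU | hU
  · simp [← hU]
  · nlinarith [hA.re_inner_nonpos h]

theorem injective_smul_sub (hA : IsMDissipative A) (hl : 0 < l) :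
    Function.Injective ((l : ℂ) • A.domain.subtype - A.toFun) := by
  refine (injective_iff_map_eq_zero _).2 fun U hU => ?_
  have hle := hA.mul_norm_le (A.mem_graph U) l
  rw [show (l : ℂ) • (U : H) - A U = 0 from hU, norm_zero] at hle
  exact Subtype.ext (norm_le_zero_iff.1 (nonpos_of_mul_nonpos_right hle hl))

/-- The bijection `l - A` of the domain of `A` onto `H`. -/
noncomputable def smulSubEquiv (hA : IsMDissipative A) (hl : 0 < l) : A.domain ≃ₗ[ℂ] H :=
  LinearEquiv.ofBijective ((l : ℂ) • A.domain.subtype - A.toFun)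
    ⟨hA.injective_smul_sub hl, hA.2 l hl⟩

theorem smul_symm_sub (hA : IsMDissipative A) (hl : 0 < l) (F : H) :
    (l : ℂ) • ((hA.smulSubEquiv hl).symm F : H) - A ((hA.smulSubEquiv hl).symm F) = F :=
  (hA.smulSubEquiv hl).apply_symm_apply F

/-- The resolvent `(l - A)⁻¹`. -/
noncomputable def resolvent (hA : IsMDissipative A) (hl : 0 < l) : H →L[ℂ] H :=
  LinearMap.mkContinuous (A.domain.subtype ∘ₗ (hA.smulSubEquiv hl).symm.toLinearMap) l⁻¹
    fun F => by
      rw [inv_mul_eq_div, le_div_iff₀ hl, mul_comm]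
      refine (hA.mul_norm_le (A.mem_graph ((hA.smulSubEquiv hl).symm F)) l).trans_eq ?_
      rw [smul_symm_sub]

theorem resolvent_mem_graph (hA : IsMDissipative A) (hl : 0 < l) (F : H) :
    (hA.resolvent hl F, (l : ℂ) • hA.resolvent hl F - F) ∈ A.graph := by
  convert! A.mem_graph ((hA.smulSubEquiv hl).symm F) using 2
  exact sub_eq_of_eq_add' (sub_eq_iff_eq_add.1 (hA.smul_symm_sub hl F))

theorem mul_norm_resolvent_le (hA : IsMDissipative A) (hl : 0 < l) (F : H) :
    l * ‖hA.resolvent hl F‖ ≤ ‖F‖ := by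
  simpa using hA.mul_norm_le (hA.resolvent_mem_graph hl F) l

theorem resolvent_eq (hA : IsMDissipative A) (hl : 0 < l) (h : (U, F) ∈ A.graph) :
    hA.resolvent hl ((l : ℂ) • U - F) = U := by
  obtain ⟨V, rfl, rfl⟩ := (LinearPMap.mem_graph_iff A).1 h
  exact congrArg Subtype.val ((hA.smulSubEquiv hl).symm_apply_apply V)

theorem resolvent_apply_snd (hA : IsMDissipative A) (hl : 0 < l) (h : (U, F) ∈ A.graph) :
    hA.resolvent hl F = (l : ℂ) • hA.resolvent hl U - U := by
  rw [eq_sub_iff_add_eq', ← eq_sub_iff_add_eq, ← map_smul, ← map_sub, hA.resolvent_eq hl h]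

theorem commute_resolvent (hA : IsMDissipative A) {k : ℝ} (hl : 0 < l) (hk : 0 < k) :
    Commute (hA.resolvent hl) (hA.resolvent hk) := by
  ext x
  have hlk := hA.resolvent_mem_graph hl (hA.resolvent hk x)
  rw [← hA.resolvent_apply_snd hl (hA.resolvent_mem_graph hk x)] at hlk
  have heq := hA.resolvent_eq hk hlk
  simp only [map_sub, map_smul, sub_sub_cancel] at heq
  exact heq.symm

theorem dense_domain [CompleteSpace H] (hA : IsMDissipative A) : Dense (A.domain : Set H) := by
  rw [Submodule.dense_iff_topologicalClosure_eq_top, Submodule.topologicalClosure_eq_top_iff,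
    Submodule.eq_bot_iff]
  intro x hx
  obtain ⟨U, hU⟩ := hA.2 1 one_pos x
  have horth : inner ℂ (U : H) x = 0 := (Submodule.mem_orthogonal _ _).1 hx U U.2
  have hdiss := hA.1 U
  rw [Complex.ofReal_one, one_smul] at hU
  rw [← hU, inner_sub_right, sub_eq_zero] at horth
  rw [← horth] at hdiss
  have hU0 : U = 0 := by
    have hnorm : ‖(U : H)‖ ^ 2 ≤ 0 := (inner_self_eq_norm_sq (𝕜 := ℂ) (U : H)).symm.trans_le hdiss
    exact Subtype.ext (by simpa using hnorm.antisymm (sq_nonneg _))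
  simpa [hU0] using hU.symm

/-- The Yosida approximation `l A (l - A)⁻¹ = l (l (l - A)⁻¹ - 1)`. -/
noncomputable def yosida (hA : IsMDissipative A) (hl : 0 < l) : H →L[ℂ] H :=
  (l : ℂ) • ((l : ℂ) • hA.resolvent hl - 1)

theorem commute_resolvent_yosida (hA : IsMDissipative A) {k : ℝ} (hl : 0 < l) (hk : 0 < k) :
    Commute (hA.resolvent hl) (hA.yosida hk) :=
  (((hA.commute_resolvent hl hk).smul_right _).sub_right (Commute.one_right _)).smul_right _

theorem commute_yosida (hA : IsMDissipative A) {k : ℝ} (hl : 0 < l) (hk : 0 < k) :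
    Commute (hA.yosida hl) (hA.yosida hk) :=
  (((hA.commute_resolvent_yosida hl hk).smul_left _).sub_left (Commute.one_left _)).smul_left _

theorem norm_smul_resolvent_le (hA : IsMDissipative A) (hl : 0 < l) (x : H) :
    ‖((l : ℂ) • hA.resolvent hl) x‖ ≤ ‖x‖ := by
  rw [smul_apply, norm_smul, Complex.norm_real, Real.norm_of_nonneg hl.le]
  exact hA.mul_norm_resolvent_le hl x

theorem re_inner_yosida_nonpos (hA : IsMDissipative A) (hl : 0 < l) (x : H) :
    (inner ℂ x (hA.yosida hl x)).re ≤ 0 := by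
  rw [yosida, smul_apply, inner_smul_right, Complex.re_ofReal_mul]
  exact mul_nonpos_of_nonneg_of_nonpos hl.le
    (re_inner_sub_self_nonpos (hA.norm_smul_resolvent_le hl x))

theorem yosida_apply_fst (hA : IsMDissipative A) (hl : 0 < l) (h : (U, F) ∈ A.graph) :
    hA.yosida hl U = ((l : ℂ) • hA.resolvent hl) F := by
  rw [smul_apply, hA.resolvent_apply_snd hl h]
  rfl

theorem norm_yosida_apply_fst_le (hA : IsMDissipative A) (hl : 0 < l) (h : (U, F) ∈ A.graph) :
    ‖hA.yosida hl U‖ ≤ ‖F‖ := by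
  rw [hA.yosida_apply_fst hl h]
  exact hA.norm_smul_resolvent_le hl F

theorem tendsto_smul_resolvent [CompleteSpace H] (hA : IsMDissipative A) (x : H) :
    Tendsto (fun n : ℕ => (((n + 1 : ℝ) : ℂ) • hA.resolvent (Nat.cast_add_one_pos n)) x) atTop
      (𝓝 x) := by
  refine tendsto_apply_of_dense (C := 1) (L := id)
    (fun n x => (hA.norm_smul_resolvent_le _ x).trans_eq (one_mul _).symm) continuous_id
    hA.dense_domain (fun U hU => ?_) x
  have hres : Tendsto (fun n : ℕ => hA.resolvent (Nat.cast_add_one_pos (α := ℝ) n) (A ⟨U, hU⟩))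
      atTop (𝓝 0) := by
    refine squeeze_zero_norm (fun n => ?_) (a := fun n : ℕ => ‖A ⟨U, hU⟩‖ * (1 / ((n : ℝ) + 1)))
      (by simpa using tendsto_one_div_add_atTop_nhds_zero_nat.const_mul ‖A ⟨U, hU⟩‖)
    rw [mul_one_div, le_div_iff₀ (Nat.cast_add_one_pos n), mul_comm]
    exact hA.mul_norm_resolvent_le _ _
  simpa [hA.resolvent_apply_snd _ (A.mem_graph ⟨U, hU⟩)] using hres.add_const U

theorem tendsto_yosida [CompleteSpace H] (hA : IsMDissipative A) (h : (U, F) ∈ A.graph) :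
    Tendsto (fun n : ℕ => hA.yosida (Nat.cast_add_one_pos (α := ℝ) n) U) atTop (𝓝 F) := by
  simp_rw [hA.yosida_apply_fst _ h]
  exact hA.tendsto_smul_resolvent F

end IsMDissipative

end Dissipative

section Exp

theorem hasDerivAt_exp_smul_mul_exp_smul {𝔸 : Type*} [NormedRing 𝔸] [NormedAlgebra ℝ 𝔸]
    [CompleteSpace 𝔸] {a b : 𝔸} (hab : Commute a b) (t s : ℝ) :
    HasDerivAt (fun s : ℝ => NormedSpace.exp (s • a) * NormedSpace.exp ((t - s) • b))
      (NormedSpace.exp (s • a) * NormedSpace.exp ((t - s) • b) * (a - b)) s := by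
  have hexp_b : HasDerivAt (fun s : ℝ => NormedSpace.exp ((t - s) • b))
      (-(NormedSpace.exp ((t - s) • b) * b)) s :=
    (hasDerivAt_exp_smul_const (𝕂 := ℝ) b (t - s)).comp_const_sub t s
  have hcomm : Commute a (NormedSpace.exp ((t - s) • b)) := (hab.smul_right _).exp_right
  refine ((hasDerivAt_exp_smul_const (𝕂 := ℝ) a s).mul hexp_b).congr_deriv ?_
  rw [mul_assoc, hcomm.eq, mul_neg, mul_sub, ← sub_eq_add_neg, mul_assoc, mul_assoc]

variable {H : Type*} [NormedAddCommGroup H] [InnerProductSpace ℂ H]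

theorem hasDerivAt_clm_apply {c : ℝ → H →L[ℂ] H} {c' : H →L[ℂ] H} {t : ℝ} (h : HasDerivAt c c' t)
    (x : H) : HasDerivAt (fun s => c s x) (c' x) t :=
  ((ContinuousLinearMap.apply ℂ H x).restrictScalars ℝ).hasFDerivAt.comp_hasDerivAt t h

variable [CompleteSpace H] {A B : H →L[ℂ] H}

theorem hasDerivAt_exp_smul_apply (A : H →L[ℂ] H) (x : H) (t : ℝ) :
    HasDerivAt (fun s : ℝ => NormedSpace.exp (s • A) x) (NormedSpace.exp (t • A) (A x)) t :=
  hasDerivAt_clm_apply (hasDerivAt_exp_smul_const (𝕂 := ℝ) A t) x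

theorem hasDerivAt_exp_smul_apply' (A : H →L[ℂ] H) (x : H) (t : ℝ) :
    HasDerivAt (fun s : ℝ => NormedSpace.exp (s • A) x) (A (NormedSpace.exp (t • A) x)) t :=
  hasDerivAt_clm_apply (hasDerivAt_exp_smul_const' (𝕂 := ℝ) A t) x

theorem norm_exp_smul_apply_le (hA : ∀ x, (inner ℂ x (A x)).re ≤ 0) {t : ℝ} (ht : 0 ≤ t)
    (x : H) : ‖NormedSpace.exp (t • A) x‖ ≤ ‖x‖ := by
  simpa using antitoneOn_norm_of_re_inner_deriv_nonpos
    (fun s _ => (hasDerivAt_exp_smul_apply' A x s).hasDerivWithinAt) (fun s _ => hA _)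
    self_mem_Ici ht ht

theorem norm_exp_smul_sub_exp_smul_le (hA : ∀ x, (inner ℂ x (A x)).re ≤ 0)
    (hB : ∀ x, (inner ℂ x (B x)).re ≤ 0) (hAB : Commute A B) {t : ℝ} (ht : 0 ≤ t) (x : H) :
    ‖NormedSpace.exp (t • A) x - NormedSpace.exp (t • B) x‖ ≤ ‖A x - B x‖ * t := by
  have hle := Convex.norm_image_sub_le_of_norm_hasDerivWithin_le (C := ‖A x - B x‖)
    (fun s _ => (hasDerivAt_clm_apply (hasDerivAt_exp_smul_mul_exp_smul hAB t s)
      x).hasDerivWithinAt) (fun s hs => ?_) (convex_Icc 0 t) (left_mem_Icc.2 ht)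
    (right_mem_Icc.2 ht)
  · simpa [abs_of_nonneg ht] using hle
  · exact (norm_exp_smul_apply_le hA hs.1 _).trans
      (norm_exp_smul_apply_le hB (sub_nonneg.2 hs.2) _)

theorem norm_exp_smul_apply_sub_le (hA : ∀ x, (inner ℂ x (A x)).re ≤ 0) {s t : ℝ} (hs : 0 ≤ s)
    (ht : 0 ≤ t) (x : H) :
    ‖NormedSpace.exp (t • A) x - NormedSpace.exp (s • A) x‖ ≤ ‖A x‖ * |t - s| :=
  Convex.norm_image_sub_le_of_norm_hasDerivWithin_le
    (fun r _ => (hasDerivAt_exp_smul_apply A x r).hasDerivWithinAt)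
    (fun _ hr => norm_exp_smul_apply_le hA hr _) (convex_Ici (0 : ℝ)) hs ht

end Exp

section CauchyProblem

variable {H : Type*} [NormedAddCommGroup H] [InnerProductSpace ℂ H] {A : H →ₗ.[ℂ] H}
  {T : ℝ → H →L[ℂ] H} {U F : H}

namespace IsContractionSemigroup

theorem norm_apply_le (hT : IsContractionSemigroup T) {t : ℝ} (ht : 0 ≤ t) (x : H) :
    ‖T t x‖ ≤ ‖x‖ := by
  simpa using (T t).le_of_opNorm_le (hT.contraction t ht) x

theorem hasDerivWithinAt_zero_iff (hT : IsContractionSemigroup T) :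
    HasDerivWithinAt (fun t => T t U) F (Ici 0) 0 ↔
      Tendsto (fun t : ℝ => ((t⁻¹ : ℝ) : ℂ) • (T t U - U)) (𝓝[>] 0) (𝓝 F) := by
  rw [hasDerivWithinAt_iff_tendsto_slope, Ici_sdiff_left]
  refine tendsto_congr fun t => ?_
  rw [slope_def_module, hT.zero, sub_zero, Complex.coe_smul, ContinuousLinearMap.id_apply]

theorem re_inner_generator_nonpos (hT : IsContractionSemigroup T)
    (h : Tendsto (fun t : ℝ => ((t⁻¹ : ℝ) : ℂ) • (T t U - U)) (𝓝[>] 0) (𝓝 F)) :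
    (inner ℂ U F).re ≤ 0 := by
  refine le_of_tendsto ((Complex.continuous_re.tendsto _).comp (tendsto_const_nhds.inner h)) ?_
  filter_upwards [self_mem_nhdsWithin] with t ht
  rw [Function.comp_apply, inner_smul_right, Complex.re_ofReal_mul]
  exact mul_nonpos_of_nonneg_of_nonpos (inv_nonneg.2 (le_of_lt ht))
    (re_inner_sub_self_nonpos (hT.norm_apply_le (le_of_lt ht) U))

end IsContractionSemigroup

/-- `T` is a `C₀`-semigroup of contractions that leaves the domain of `A` invariant, commutes with
`A` there, and whose orbits starting in the domain solve `U_t = A U`. -/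
structure SolvesCauchyProblem (A : H →ₗ.[ℂ] H) (T : ℝ → H →L[ℂ] H) : Prop
    extends IsContractionSemigroup T where
  mem_graph : ∀ ⦃U F⦄, (U, F) ∈ A.graph → ∀ t, 0 ≤ t → (T t U, T t F) ∈ A.graph
  hasDerivWithinAt : ∀ ⦃U F⦄, (U, F) ∈ A.graph → ∀ t, 0 ≤ t →
    HasDerivWithinAt (fun s => T s U) (T t F) (Ici 0) t

namespace SolvesCauchyProblem

theorem tendsto_of_mem_graph (hT : SolvesCauchyProblem A T) (h : (U, F) ∈ A.graph) :
    Tendsto (fun t : ℝ => ((t⁻¹ : ℝ) : ℂ) • (T t U - U)) (𝓝[>] 0) (𝓝 F) := by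
  rw [← hT.hasDerivWithinAt_zero_iff]
  simpa [hT.zero] using hT.hasDerivWithinAt h 0 le_rfl

-- The generator of a contraction semigroup is dissipative, and an m-dissipative operator has no
-- proper dissipative extension.
theorem isGenerator (hT : SolvesCauchyProblem A T) (hA : IsMDissipative A) : IsGenerator A T := by
  refine fun U F => ⟨hT.tendsto_of_mem_graph, fun hUF => ?_⟩
  obtain ⟨V, G, hVG, heq⟩ := (isMDissipative_iff_graph.1 hA).2 1 one_pos (U - F)
  rw [Complex.ofReal_one, one_smul] at heq
  have hsub : F - G = U - V := by
    rw [sub_eq_sub_iff_add_eq_add] at heq ⊢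
    rw [add_comm, heq, add_comm]
  have hlim : Tendsto (fun t : ℝ => ((t⁻¹ : ℝ) : ℂ) • (T t (U - V) - (U - V))) (𝓝[>] 0)
      (𝓝 (F - G)) := by
    refine (hUF.sub (hT.tendsto_of_mem_graph hVG)).congr fun t => ?_
    rw [map_sub, ← smul_sub, sub_sub_sub_comm]
  rw [hsub] at hlim
  have hnorm : ‖U - V‖ ^ 2 ≤ 0 :=
    (inner_self_eq_norm_sq (𝕜 := ℂ) (U - V)).symm.trans_le (hT.re_inner_generator_nonpos hlim)
  have hUV : U = V := by simpa [sub_eq_zero] using hnorm.antisymm (sq_nonneg _)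
  have hFG : F = G := by rwa [hUV, sub_self, sub_eq_zero] at hsub
  rwa [hUV, hFG]

theorem isClassicalSolution (hT : SolvesCauchyProblem A T) (hU : U ∈ A.domain) :
    IsClassicalSolution A U (fun t => T t U) := by
  have hgraph := A.mem_graph ⟨U, hU⟩
  exact ⟨by simp [hT.zero], fun t => T t (A ⟨U, hU⟩), hT.continuous _, fun t ht =>
    ⟨hT.hasDerivWithinAt hgraph t ht, hT.mem_graph hgraph t ht⟩⟩

end SolvesCauchyProblem

theorem IsClassicalSolution.eqOn (hA : IsMDissipative A) {u v : ℝ → H}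
    (hu : IsClassicalSolution A U u) (hv : IsClassicalSolution A U v) : EqOn u v (Ici 0) := by
  obtain ⟨u', -, hu'⟩ := hu.equation
  obtain ⟨v', -, hv'⟩ := hv.equation
  intro t ht
  have hanti := antitoneOn_norm_of_re_inner_deriv_nonpos
    (fun s hs => (hu' s hs).1.sub (hv' s hs).1)
    (fun s hs => hA.re_inner_nonpos (A.graph.sub_mem (hu' s hs).2 (hv' s hs).2))
    self_mem_Ici ht ht
  simpa [hu.initial, hv.initial, sub_eq_zero] using hanti

end CauchyProblem

namespace IsMDissipative

variable {H : Type*} [NormedAddCommGroup H] [InnerProductSpace ℂ H] [CompleteSpace H]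
  {A : H →ₗ.[ℂ] H} {U F : H} {s t : ℝ}

/-- The semigroup generated by the `n`-th Yosida approximation of `A`. -/
noncomputable def approx (hA : IsMDissipative A) (n : ℕ) (t : ℝ) : H →L[ℂ] H :=
  NormedSpace.exp (t • hA.yosida (Nat.cast_add_one_pos (α := ℝ) n))

theorem norm_approx_apply_le (hA : IsMDissipative A) (n : ℕ) (ht : 0 ≤ t) (x : H) :
    ‖hA.approx n t x‖ ≤ ‖x‖ :=
  norm_exp_smul_apply_le (hA.re_inner_yosida_nonpos _) ht x

theorem approx_add (hA : IsMDissipative A) (n : ℕ) (s t : ℝ) :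
    hA.approx n (s + t) = hA.approx n s * hA.approx n t := by
  let _ : NormedAlgebra ℚ (H →L[ℂ] H) := NormedAlgebra.restrictScalars ℚ ℝ _
  rw [approx, add_smul,
    NormedSpace.exp_add_of_commute (((Commute.refl _).smul_left s).smul_right t)]
  rfl

theorem cauchySeq_approx (hA : IsMDissipative A) (ht : 0 ≤ t) (x : H) :
    CauchySeq fun n => hA.approx n t x := by
  refine cauchySeq_apply_of_dense (fun n => hA.norm_approx_apply_le n ht) hA.dense_domain
    (fun U hU => ?_) x
  rw [Metric.cauchySeq_iff]
  intro ε hε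
  obtain ⟨N, hN⟩ := Metric.cauchySeq_iff.1 (hA.tendsto_yosida (A.mem_graph ⟨U, hU⟩)).cauchySeq
    (ε / (t + 1)) (by positivity)
  refine ⟨N, fun n hn k hk => ?_⟩
  have hyosida := hN n hn k hk
  rw [dist_eq_norm, lt_div_iff₀ (by positivity)] at hyosida
  rw [dist_eq_norm]
  refine (norm_exp_smul_sub_exp_smul_le (hA.re_inner_yosida_nonpos _)
    (hA.re_inner_yosida_nonpos _) (hA.commute_yosida _ _) ht U).trans_lt (lt_of_le_of_lt ?_ hyosida)
  exact mul_le_mul_of_nonneg_left (le_add_of_nonneg_right zero_le_one) (norm_nonneg _)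

/-- The strong limit of the semigroups generated by the Yosida approximations of `A`, extended to
negative times by its value at `0`. -/
noncomputable def semigroup (hA : IsMDissipative A) (t : ℝ) : H →L[ℂ] H :=
  continuousLinearMapOfTendsto (fun n => hA.approx n (max t 0))
    (f := fun x => (cauchySeq_tendsto_of_complete
      (hA.cauchySeq_approx (le_max_right t 0) x)).choose)
    (l := atTop) (tendsto_pi_nhds.2 fun x => (cauchySeq_tendsto_of_complete
      (hA.cauchySeq_approx (le_max_right t 0) x)).choose_spec)

theorem tendsto_approx_max (hA : IsMDissipative A) (t : ℝ) (x : H) :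
    Tendsto (fun n => hA.approx n (max t 0) x) atTop (𝓝 (hA.semigroup t x)) :=
  (cauchySeq_tendsto_of_complete (hA.cauchySeq_approx (le_max_right t 0) x)).choose_spec

theorem tendsto_approx (hA : IsMDissipative A) (ht : 0 ≤ t) (x : H) :
    Tendsto (fun n => hA.approx n t x) atTop (𝓝 (hA.semigroup t x)) := by
  simpa only [max_eq_left ht] using hA.tendsto_approx_max t x

theorem norm_semigroup_apply_le (hA : IsMDissipative A) (t : ℝ) (x : H) :
    ‖hA.semigroup t x‖ ≤ ‖x‖ :=
  le_of_tendsto' (hA.tendsto_approx_max t x).norm fun n =>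
    hA.norm_approx_apply_le n (le_max_right t 0) x

theorem semigroup_zero (hA : IsMDissipative A) :
    hA.semigroup 0 = ContinuousLinearMap.id ℂ H := by
  ext x
  refine tendsto_nhds_unique (hA.tendsto_approx le_rfl x) ?_
  simp [approx]

theorem semigroup_add (hA : IsMDissipative A) (hs : 0 ≤ s) (ht : 0 ≤ t) :
    hA.semigroup (s + t) = (hA.semigroup s).comp (hA.semigroup t) := by
  ext x
  refine tendsto_nhds_unique (hA.tendsto_approx (add_nonneg hs ht) x) ?_
  simp_rw [approx_add]
  exact tendsto_apply_tendsto (C := 1)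
    (fun n x => (hA.norm_approx_apply_le n hs x).trans_eq (one_mul _).symm)
    (hA.tendsto_approx ht x) (hA.tendsto_approx hs _)

theorem norm_semigroup_apply_sub_le (hA : IsMDissipative A) (h : (U, F) ∈ A.graph) (s t : ℝ) :
    ‖hA.semigroup t U - hA.semigroup s U‖ ≤ ‖F‖ * |t - s| := by
  refine le_of_tendsto' ((hA.tendsto_approx_max t U).sub (hA.tendsto_approx_max s U)).norm
    fun n => ?_
  refine (norm_exp_smul_apply_sub_le (hA.re_inner_yosida_nonpos _) (le_max_right s 0)
    (le_max_right t 0) U).trans ?_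
  exact mul_le_mul (hA.norm_yosida_apply_fst_le _ h)
    (by simpa using abs_max_sub_max_le_abs t s 0) (abs_nonneg _) (norm_nonneg _)

theorem continuous_semigroup_apply (hA : IsMDissipative A) (x : H) :
    Continuous fun t => hA.semigroup t x := by
  refine continuous_iff_continuousAt.2 fun t => tendsto_apply_of_dense (C := 1)
    (fun s x => (hA.norm_semigroup_apply_le s x).trans_eq (one_mul _).symm)
    (hA.semigroup t).continuous hA.dense_domain (fun U hU => ?_) x
  exact (LipschitzWith.of_dist_le_mul (K := ‖A ⟨U, hU⟩‖₊) fun s r => by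
    rw [dist_eq_norm, Real.dist_eq]
    exact hA.norm_semigroup_apply_sub_le (A.mem_graph ⟨U, hU⟩) r s).continuous.tendsto t

theorem isContractionSemigroup_semigroup (hA : IsMDissipative A) :
    IsContractionSemigroup hA.semigroup where
  zero := hA.semigroup_zero
  add _ _ hs ht := hA.semigroup_add hs ht
  continuous x := (hA.continuous_semigroup_apply x).continuousOn
  contraction t _ := ContinuousLinearMap.opNorm_le_bound _ zero_le_one fun x => by
    simpa using hA.norm_semigroup_apply_le t x

theorem resolvent_semigroup (hA : IsMDissipative A) {l : ℝ} (hl : 0 < l) (t : ℝ) (x : H) :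
    hA.resolvent hl (hA.semigroup t x) = hA.semigroup t (hA.resolvent hl x) := by
  refine tendsto_nhds_unique (((hA.resolvent hl).continuous.tendsto _).comp
    (hA.tendsto_approx_max t x)) ((hA.tendsto_approx_max t (hA.resolvent hl x)).congr fun n => ?_)
  have hcomm : Commute (hA.resolvent hl) (hA.approx n (max t 0)) :=
    ((hA.commute_resolvent_yosida hl _).smul_right _).exp_right
  exact (DFunLike.congr_fun hcomm.eq x).symm

-- The graph of `A` consists of the pairs `(R G, R G - G)` with `R = (1 - A)⁻¹`.
theorem semigroup_mem_graph (hA : IsMDissipative A) (h : (U, F) ∈ A.graph) (t : ℝ) :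
    (hA.semigroup t U, hA.semigroup t F) ∈ A.graph := by
  have hmem := hA.resolvent_mem_graph one_pos (hA.semigroup t (U - F))
  have hres : hA.resolvent one_pos (U - F) = U := by simpa using hA.resolvent_eq one_pos h
  rw [hA.resolvent_semigroup, hres] at hmem
  simpa using hmem

theorem semigroup_apply_sub (hA : IsMDissipative A) (h : (U, F) ∈ A.graph) (ht : 0 ≤ t) :
    hA.semigroup t U - U = ∫ s in 0..t, hA.semigroup s F := by
  have hcont : ∀ (n : ℕ) (x : H), Continuous fun s => hA.approx n s x := fun n x =>
    continuous_iff_continuousAt.2 fun s => (hasDerivAt_exp_smul_apply _ x s).continuousAt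
  have happrox : ∀ n : ℕ, ∫ s in 0..t, hA.approx n s (hA.yosida (Nat.cast_add_one_pos n) U) =
      hA.approx n t U - U := fun n => by
    refine (intervalIntegral.integral_eq_sub_of_hasDerivAt
      (fun s _ => hasDerivAt_exp_smul_apply (hA.yosida (Nat.cast_add_one_pos n)) U s)
      ((hcont n _).intervalIntegrable 0 t)).trans ?_
    simp [approx]
  refine tendsto_nhds_unique ((hA.tendsto_approx ht U).sub_const U) ?_
  simp_rw [← happrox]
  refine intervalIntegral.tendsto_integral_filter_of_dominated_convergence (fun _ => ‖F‖)
    (Eventually.of_forall fun n => (hcont n _).aestronglyMeasurable)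
    (Eventually.of_forall fun n => Eventually.of_forall fun s hs => ?_)
    intervalIntegrable_const (Eventually.of_forall fun s hs => ?_) <;> rw [uIoc_of_le ht] at hs
  · exact (hA.norm_approx_apply_le n hs.1.le _).trans (hA.norm_yosida_apply_fst_le _ h)
  · exact tendsto_apply_tendsto (C := 1) (T := fun n => hA.approx n s)
      (fun n x => (hA.norm_approx_apply_le n hs.1.le x).trans_eq (one_mul _).symm)
      (hA.tendsto_yosida h) (hA.tendsto_approx hs.1.le F)

theorem solvesCauchyProblem_semigroup (hA : IsMDissipative A) :
    SolvesCauchyProblem A hA.semigroup where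
  toIsContractionSemigroup := hA.isContractionSemigroup_semigroup
  mem_graph _ _ h t _ := hA.semigroup_mem_graph h t
  hasDerivWithinAt U F h t ht := by
    have hint : HasDerivAt (fun r => U + ∫ s in 0..r, hA.semigroup s F) (hA.semigroup t F) t :=
      ((hA.continuous_semigroup_apply F).integral_hasStrictDerivAt 0 t).hasDerivAt.const_add U
    refine hint.hasDerivWithinAt.congr_of_mem (fun r hr => ?_) ht
    rw [← hA.semigroup_apply_sub h hr, add_sub_cancel]

end IsMDissipative

section FinerNorm

variable {H K : Type*} [NormedAddCommGroup H] [InnerProductSpace ℂ H]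
  [NormedAddCommGroup K] [InnerProductSpace ℂ K] {A : H →ₗ.[ℂ] H} {e : K ≃ₗ[ℂ] H} {ω : ℝ}

/-- The operator `e⁻¹ A e - ω` on `K`, where `e` identifies `K` with `H`. -/
noncomputable def pullbackSub (A : H →ₗ.[ℂ] H) (e : K ≃ₗ[ℂ] H) (ω : ℝ) : K →ₗ.[ℂ] K :=
  (A.graph.comap (LinearMap.prod (e.toLinearMap ∘ₗ LinearMap.fst ℂ K K)
    (e.toLinearMap ∘ₗ (LinearMap.snd ℂ K K + (ω : ℂ) • LinearMap.fst ℂ K K)))).toLinearPMap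

theorem mem_graph_pullbackSub {x y : K} :
    (x, y) ∈ (pullbackSub A e ω).graph ↔ (e x, e (y + (ω : ℂ) • x)) ∈ A.graph := by
  rw [pullbackSub, Submodule.toLinearPMap_graph_eq]
  · rfl
  · intro p hp hp1
    have h := A.graph_fst_eq_zero_snd hp (by simp [hp1])
    simpa [hp1] using h

theorem symm_mem_graph_pullbackSub {U F : H} :
    (e.symm U, e.symm F - (ω : ℂ) • e.symm U) ∈ (pullbackSub A e ω).graph ↔
      (U, F) ∈ A.graph := by
  rw [mem_graph_pullbackSub, sub_add_cancel, e.apply_symm_apply, e.apply_symm_apply]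

theorem IsMDissipative.pullbackSub (hA : IsMDissipative A) (hω : 0 ≤ ω)
    (hq : ∀ x y : K, (e x, e y) ∈ A.graph → (inner ℂ x y).re ≤ ω * ‖x‖ ^ 2) :
    IsMDissipative (pullbackSub A e ω) := by
  refine isMDissipative_iff_graph.2 ⟨fun x y hxy => ?_, fun l hl G => ?_⟩
  · have hle := hq _ _ (mem_graph_pullbackSub.1 hxy)
    have hself : (inner ℂ x x).re = ‖x‖ ^ 2 := inner_self_eq_norm_sq (𝕜 := ℂ) x
    rw [inner_add_right, inner_smul_right, Complex.add_re, Complex.re_ofReal_mul, hself] at hle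
    linarith
  · obtain ⟨U, F, hUF, heq⟩ := (isMDissipative_iff_graph.1 hA).2 (l + ω) (by positivity) (e G)
    refine ⟨e.symm U, e.symm F - (ω : ℂ) • e.symm U, symm_mem_graph_pullbackSub.2 hUF, ?_⟩
    rw [← e.symm_apply_apply G, ← heq, map_sub, map_smul, Complex.ofReal_add, add_smul]
    abel

namespace SolvesCauchyProblem

variable {S : ℝ → K →L[ℂ] K}

/-- The family `e (exp (ω t) S t) e⁻¹` on `H`. -/
noncomputable def transport (S : ℝ → K →L[ℂ] K) (e : K ≃ₗ[ℂ] H) (ω t : ℝ) : H →ₗ[ℂ] H :=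
  e.toLinearMap ∘ₗ ((Real.exp (ω * t) : ℂ) • (S t).toLinearMap) ∘ₗ e.symm.toLinearMap

theorem transport_apply (S : ℝ → K →L[ℂ] K) (e : K ≃ₗ[ℂ] H) (ω t : ℝ) (U : H) :
    transport S e ω t U = e ((Real.exp (ω * t) : ℂ) • S t (e.symm U)) := rfl

theorem transport_mem_graph (hS : SolvesCauchyProblem (pullbackSub A e ω) S) {U F : H}
    (h : (U, F) ∈ A.graph) {t : ℝ} (ht : 0 ≤ t) :
    (transport S e ω t U, transport S e ω t F) ∈ A.graph := by
  have hmem := hS.mem_graph (symm_mem_graph_pullbackSub.2 h) t ht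
  rw [map_sub, map_smul, mem_graph_pullbackSub, sub_add_cancel] at hmem
  simpa only [transport_apply, map_smul, Prod.smul_mk] using
    A.graph.smul_mem (Real.exp (ω * t) : ℂ) hmem

theorem hasDerivWithinAt_transport (hS : SolvesCauchyProblem (pullbackSub A e ω) S)
    (he : Continuous e) {U F : H} (h : (U, F) ∈ A.graph) {t : ℝ} (ht : 0 ≤ t) :
    HasDerivWithinAt (fun s => transport S e ω s U) (transport S e ω t F) (Ici 0) t := by
  have hexp : HasDerivAt (fun s : ℝ => Real.exp (ω * s)) (Real.exp (ω * t) * ω) t := by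
    simpa using ((hasDerivAt_id t).const_mul ω).exp
  have hprod := hexp.hasDerivWithinAt.smul
    (hS.hasDerivWithinAt (symm_mem_graph_pullbackSub.2 h) t ht)
  let E : K →L[ℂ] H := ⟨e.toLinearMap, he⟩
  refine ((E.restrictScalars ℝ).hasFDerivAt.comp_hasDerivWithinAt t hprod).congr_deriv ?_
  refine congrArg e ?_
  rw [map_sub, map_smul, Complex.coe_smul, Complex.coe_smul, smul_sub, smul_smul,
    sub_add_cancel]
  rfl

theorem norm_transport_apply_le [CompleteSpace K] (hA : IsMDissipative A)
    (hP : IsMDissipative (pullbackSub A e ω)) (hS : SolvesCauchyProblem (pullbackSub A e ω) S)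
    (he : Continuous e) {t : ℝ} (ht : 0 ≤ t) (U : H) : ‖transport S e ω t U‖ ≤ ‖U‖ := by
  have hclosed : IsClosed {x : K | ‖e ((Real.exp (ω * t) : ℂ) • S t x)‖ ≤ ‖e x‖} :=
    isClosed_le (by fun_prop) (by fun_prop)
  have hdomain : ((pullbackSub A e ω).domain : Set K) ⊆
      {x : K | ‖e ((Real.exp (ω * t) : ℂ) • S t x)‖ ≤ ‖e x‖} := fun x hx => by
    have hgraph := mem_graph_pullbackSub.1 ((pullbackSub A e ω).mem_graph ⟨x, hx⟩)
    have hanti := antitoneOn_norm_of_re_inner_deriv_nonpos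
      (fun s hs => hS.hasDerivWithinAt_transport he hgraph hs)
      (fun s hs => hA.re_inner_nonpos (hS.transport_mem_graph hgraph hs)) self_mem_Ici ht ht
    simpa [transport_apply, hS.zero] using hanti
  simpa [transport_apply] using
    hclosed.closure_subset_iff.2 hdomain (hP.dense_domain (e.symm U))

theorem exists_transport [CompleteSpace K] (hA : IsMDissipative A)
    (hP : IsMDissipative (pullbackSub A e ω)) (hS : SolvesCauchyProblem (pullbackSub A e ω) S)
    (he : Continuous e) : ∃ T : ℝ → H →L[ℂ] H, SolvesCauchyProblem A T := by
  let T : ℝ → H →L[ℂ] H := fun t => LinearMap.mkContinuous (transport S e ω (max t 0)) 1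
    fun U => by simpa using hS.norm_transport_apply_le hA hP he (le_max_right t 0) U
  have hT : ∀ t, 0 ≤ t → ∀ U, T t U = transport S e ω t U := fun t ht U =>
    congrArg (transport S e ω · U) (max_eq_left ht)
  refine ⟨T, ⟨?_, fun s t hs ht => ?_, fun U => ?_, fun t _ => ?_⟩, fun U F h t ht => ?_,
    fun U F h t ht => ?_⟩
  · ext U
    simp [hT 0 le_rfl, transport_apply, hS.zero]
  · ext U
    rw [ContinuousLinearMap.comp_apply, hT _ (add_nonneg hs ht), hT t ht, hT s hs]
    simp only [transport_apply, hS.add s t hs ht, ContinuousLinearMap.comp_apply,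
      e.symm_apply_apply, map_smul, smul_smul, mul_add, Real.exp_add, Complex.ofReal_mul,
      mul_comm]
  · have hexp : Continuous fun t : ℝ => (Real.exp (ω * t) : ℂ) := by fun_prop
    exact (he.comp_continuousOn (hexp.continuousOn.smul (hS.continuous (e.symm U)))).congr
      fun t ht => hT t ht U
  · exact LinearMap.mkContinuous_norm_le _ zero_le_one _
  · rw [hT t ht, hT t ht]
    exact hS.transport_mem_graph h ht
  · rw [hT t ht]
    exact (hS.hasDerivWithinAt_transport he h ht).congr_of_mem (fun s hs => hT s hs U) ht

end SolvesCauchyProblem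

theorem IsMDissipative.exists_solvesCauchyProblem [CompleteSpace K] (hA : IsMDissipative A)
    (he : Continuous e) (hω : 0 ≤ ω)
    (hq : ∀ x y : K, (e x, e y) ∈ A.graph → (inner ℂ x y).re ≤ ω * ‖x‖ ^ 2) :
    Dense (A.domain : Set H) ∧ ∃ T : ℝ → H →L[ℂ] H, SolvesCauchyProblem A T := by
  have hP := hA.pullbackSub hω hq
  refine ⟨?_, hP.solvesCauchyProblem_semigroup.exists_transport hA hP he⟩
  refine (e.surjective.denseRange.dense_image he hP.dense_domain).mono ?_
  rintro _ ⟨x, hx, rfl⟩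
  exact A.mem_domain_of_mem_graph
    (mem_graph_pullbackSub.1 ((DegenerateWaveHeat.pullbackSub A e ω).mem_graph ⟨x, hx⟩))

end FinerNorm

/-! ### Primitives and square integrable functions on an interval -/

section Calculus

variable {E : Type*} [NormedAddCommGroup E] [NormedSpace ℝ E]
  {E' : Type*} [NormedAddCommGroup E'] [NormedSpace ℝ E']
  {E'' : Type*} [NormedAddCommGroup E''] [NormedSpace ℝ E'']
  {I J : Set ℝ} {F f : ℝ → E} {G g : ℝ → E'} {p q : ℝ}

theorem intervalIntegrable_of_mem_Icc {E : Type*} [NormedAddCommGroup E] {f : ℝ → E}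
    {p q x y : ℝ} (hf : IntervalIntegrable f volume p q) (hx : x ∈ Icc p q) (hy : y ∈ Icc p q) :
    IntervalIntegrable f volume x y := by
  refine hf.mono_set ?_
  rw [uIcc_of_le (hx.1.trans hx.2)]
  exact OrdConnected.uIcc_subset inferInstance hx hy

theorem isPrimitiveOn_integral (hf : ∀ x ∈ I, ∀ y ∈ I, IntervalIntegrable f volume x y) {c : ℝ}
    (hc : c ∈ I) (e : E) : IsPrimitiveOn I (fun x => e + ∫ t in c..x, f t) f := fun x hx y hy =>
  ⟨hf x hx y hy, by
    rw [add_sub_add_left_eq_sub,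
      intervalIntegral.integral_interval_sub_left (hf c hc y hy) (hf c hc x hx)]⟩

theorem isPrimitiveOn_of_le (h : ∀ x ∈ I, ∀ y ∈ I, x ≤ y →
    IntervalIntegrable f volume x y ∧ F y - F x = ∫ t in x..y, f t) : IsPrimitiveOn I F f := by
  intro x hx y hy
  rcases le_total x y with hxy | hyx
  · exact h x hx y hy hxy
  · obtain ⟨hint, heq⟩ := h y hy x hx hyx
    refine ⟨hint.symm, ?_⟩
    rw [intervalIntegral.integral_symm, ← heq, neg_sub]

namespace IsPrimitiveOn

theorem mono (h : IsPrimitiveOn I F f) (hJ : J ⊆ I) : IsPrimitiveOn J F f :=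
  fun x hx y hy => h x (hJ hx) y (hJ hy)

theorem intervalIntegrable (h : IsPrimitiveOn (Icc p q) F f) (hpq : p ≤ q) :
    IntervalIntegrable f volume p q :=
  (h p (left_mem_Icc.2 hpq) q (right_mem_Icc.2 hpq)).1

theorem eqOn_Icc (h : IsPrimitiveOn (Icc p q) F f) :
    EqOn F (fun x => F p + ∫ t in p..x, f t) (Icc p q) := fun x hx => by
  simp only [← (h p (left_mem_Icc.2 (hx.1.trans hx.2)) x hx).2, add_sub_cancel]

theorem continuousOn_Icc (h : IsPrimitiveOn (Icc p q) F f) : ContinuousOn F (Icc p q) := by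
  rcases le_or_gt p q with hpq | hpq
  · have hcont := intervalIntegral.continuousOn_primitive_interval'
      (h.intervalIntegrable hpq) left_mem_uIcc
    rw [uIcc_of_le hpq] at hcont
    exact (continuousOn_const.add hcont).congr h.eqOn_Icc
  · simp [Icc_eq_empty_of_lt hpq]

theorem tendsto_nhdsGT (h : IsPrimitiveOn (Icc p q) F f) (hpq : p < q) :
    Tendsto F (𝓝[>] p) (𝓝 (F p)) := by
  have hF := (h.continuousOn_Icc p (left_mem_Icc.2 hpq.le)).mono_left
    (nhdsWithin_mono p Ioc_subset_Icc_self)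
  rwa [nhdsWithin_Ioc_eq_nhdsGT hpq] at hF

theorem ae_hasDerivAt [CompleteSpace E] (h : IsPrimitiveOn (Icc p q) F f) (hpq : p ≤ q) :
    ∀ᵐ x, x ∈ Icc p q → HasDerivAt F (f x) x := by
  filter_upwards [(h.intervalIntegrable hpq).ae_hasDerivAt_integral, volume.ae_ne p,
    volume.ae_ne q] with x hx hxp hxq hxI
  have hderiv := hx (by rwa [uIcc_of_le hpq]) p left_mem_uIcc
  have hxo : x ∈ Ioo p q := ⟨lt_of_le_of_ne hxI.1 hxp.symm, lt_of_le_of_ne hxI.2 hxq⟩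
  refine (hderiv.const_add (F p)).congr_of_eventuallyEq ?_
  filter_upwards [isOpen_Ioo.mem_nhds hxo] with z hz
  exact h.eqOn_Icc (Ioo_subset_Icc_self hz)

theorem norm_sub_le (h : IsPrimitiveOn I F f) {x y : ℝ} (hx : x ∈ I) (hy : y ∈ I)
    (hxy : x ≤ y) : ‖F y - F x‖ ≤ ∫ t in x..y, ‖f t‖ := by
  rw [(h x hx y hy).2]
  exact intervalIntegral.norm_integral_le_integral_norm hxy

end IsPrimitiveOn

theorem tendsto_integral_nhdsGT (hf : IntervalIntegrable f volume p q) (hpq : p < q) :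
    Tendsto (fun x => ∫ t in x..q, f t) (𝓝[>] p) (𝓝 (∫ t in p..q, f t)) := by
  have h := isPrimitiveOn_integral (fun x hx y hy => intervalIntegrable_of_mem_Icc hf hx hy)
    (right_mem_Icc.2 hpq.le) (0 : E)
  refine ((h.tendsto_nhdsGT hpq).neg.congr fun x => ?_).trans_eq ?_ <;>
    rw [zero_add, intervalIntegral.integral_symm, neg_neg]

theorem absolutelyContinuousOnInterval_of_norm_sub_le {E : Type*} [NormedAddCommGroup E]
    {F : ℝ → E} {n : ℝ → ℝ} (hpq : p ≤ q) (hn : IntervalIntegrable n volume p q)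
    (h : ∀ x ∈ Icc p q, ∀ y ∈ Icc p q, x ≤ y → ‖F y - F x‖ ≤ ∫ t in x..y, n t) :
    AbsolutelyContinuousOnInterval F p q := by
  have hN := hn.absolutelyContinuousOnInterval_intervalIntegral (c := p) left_mem_uIcc
  have hle : ∀ x ∈ Icc p q, ∀ y ∈ Icc p q, x ≤ y →
      dist (F x) (F y) ≤ dist (∫ t in p..x, n t) (∫ t in p..y, n t) := by
    intro x hx y hy hxy
    have hp := left_mem_Icc.2 hpq
    rw [dist_comm, dist_eq_norm, dist_comm, Real.dist_eq,
      intervalIntegral.integral_interval_sub_left (intervalIntegrable_of_mem_Icc hn hp hy)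
        (intervalIntegrable_of_mem_Icc hn hp hx)]
    exact (h x hx y hy hxy).trans (le_abs_self _)
  refine squeeze_zero' (Eventually.of_forall fun _ => Finset.sum_nonneg fun _ _ => dist_nonneg)
    (Eventually.filter_mono inf_le_right (eventually_principal.2 fun e he => ?_)) hN
  refine Finset.sum_le_sum fun i hi => ?_
  obtain ⟨hfst, hsnd⟩ := he.1 i hi
  rw [uIcc_of_le hpq] at hfst hsnd
  rcases le_total (e.2 i).1 (e.2 i).2 with hi | hi
  · exact hle _ hfst _ hsnd hi
  · rw [dist_comm, dist_comm (∫ t in p..(e.2 i).1, n t)]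
    exact hle _ hsnd _ hfst hi

theorem IsPrimitiveOn.absolutelyContinuousOnInterval (h : IsPrimitiveOn (Icc p q) F f)
    (hpq : p ≤ q) : AbsolutelyContinuousOnInterval F p q :=
  absolutelyContinuousOnInterval_of_norm_sub_le hpq (h.intervalIntegrable hpq).norm
    fun _ hx _ hy hxy => h.norm_sub_le hx hy hxy

theorem integral_eq_sub_of_absolutelyContinuousOnInterval [CompleteSpace E] (hpq : p ≤ q)
    (hF : AbsolutelyContinuousOnInterval F p q) (hf : IntervalIntegrable f volume p q)
    (hderiv : ∀ᵐ x, x ∈ Icc p q → HasDerivAt F (f x) x) :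
    F q - F p = ∫ t in p..q, f t := by
  have hΨ : IsPrimitiveOn (Icc p q) (fun x => ∫ t in p..x, f t) f := by
    simpa only [zero_add] using isPrimitiveOn_integral
      (fun x hx y hy => intervalIntegrable_of_mem_Icc hf hx hy) (left_mem_Icc.2 hpq) 0
  have hdiff := hF.sub (hΨ.absolutelyContinuousOnInterval hpq)
  obtain ⟨c, hc⟩ := hdiff.const_of_ae_hasDerivAt_zero (by
    rw [uIcc_of_le hpq]
    filter_upwards [hderiv, hΨ.ae_hasDerivAt hpq] with x hFx hΨx hx
    exact ((hFx hx).sub (hΨx hx)).congr_deriv (sub_self _))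
  have hp := hc p left_mem_uIcc
  have hq := hc q right_mem_uIcc
  simp only [Pi.sub_apply, intervalIntegral.integral_same, sub_zero] at hp hq
  rw [hp, ← hq, sub_sub_cancel]

variable (B : E →L[ℝ] E' →L[ℝ] E'')

theorem intervalIntegrable_bilin (hpq : p ≤ q) (hf : IntervalIntegrable f volume p q)
    (hG : ContinuousOn G (Icc p q)) : IntervalIntegrable (fun x => B (f x) (G x)) volume p q := by
  obtain ⟨M, hM⟩ := isCompact_Icc.exists_bound_of_continuousOn hG
  rw [intervalIntegrable_iff_integrableOn_Ioc_of_le hpq] at hf ⊢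
  have hGm : AEStronglyMeasurable G (volume.restrict (Ioc p q)) :=
    (hG.aestronglyMeasurable measurableSet_Icc).mono_measure
      (Measure.restrict_mono Ioc_subset_Icc_self le_rfl)
  refine (hf.norm.const_mul (‖B‖ * M)).mono'
    (B.aestronglyMeasurable_comp₂ hf.aestronglyMeasurable hGm) ?_
  filter_upwards [ae_restrict_mem measurableSet_Ioc] with x hx
  calc ‖B (f x) (G x)‖ ≤ ‖B‖ * ‖f x‖ * ‖G x‖ := B.le_opNorm₂ _ _
    _ ≤ ‖B‖ * ‖f x‖ * M := by
      gcongr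
      exact hM x (Ioc_subset_Icc_self hx)
    _ = ‖B‖ * M * ‖f x‖ := by ring

namespace IsPrimitiveOn

variable {B}

theorem absolutelyContinuousOnInterval_bilin (hF : IsPrimitiveOn (Icc p q) F f)
    (hG : IsPrimitiveOn (Icc p q) G g) (hpq : p ≤ q) :
    AbsolutelyContinuousOnInterval (fun x => B (F x) (G x)) p q := by
  obtain ⟨M, hM⟩ := isCompact_Icc.exists_bound_of_continuousOn hF.continuousOn_Icc
  obtain ⟨N, hN⟩ := isCompact_Icc.exists_bound_of_continuousOn hG.continuousOn_Icc
  have hM0 := (norm_nonneg _).trans (hM p (left_mem_Icc.2 hpq))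
  have hf := (hF.intervalIntegrable hpq).norm.const_mul (‖B‖ * N)
  have hg := (hG.intervalIntegrable hpq).norm.const_mul (‖B‖ * M)
  refine absolutelyContinuousOnInterval_of_norm_sub_le hpq (hf.add hg) fun x hx y hy hxy => ?_
  have hle := hF.norm_sub_le hx hy hxy
  have hle0 := (norm_nonneg _).trans hle
  rw [intervalIntegral.integral_add (intervalIntegrable_of_mem_Icc hf hx hy)
    (intervalIntegrable_of_mem_Icc hg hx hy), intervalIntegral.integral_const_mul,
    intervalIntegral.integral_const_mul]
  calc ‖B (F y) (G y) - B (F x) (G x)‖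
      = ‖B (F y - F x) (G y) + B (F x) (G y - G x)‖ := by
        rw [map_sub, sub_apply, map_sub, sub_add_sub_cancel]
    _ ≤ ‖B‖ * ‖F y - F x‖ * ‖G y‖ + ‖B‖ * ‖F x‖ * ‖G y - G x‖ :=
        (norm_add_le _ _).trans (add_le_add (B.le_opNorm₂ _ _) (B.le_opNorm₂ _ _))
    _ ≤ ‖B‖ * (∫ t in x..y, ‖f t‖) * N + ‖B‖ * M * ∫ t in x..y, ‖g t‖ := by
        gcongr
        exacts [hN y hy, hM x hx, hG.norm_sub_le hx hy hxy]
    _ = ‖B‖ * N * (∫ t in x..y, ‖f t‖) + ‖B‖ * M * ∫ t in x..y, ‖g t‖ := by ring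

theorem bilin [CompleteSpace E] [CompleteSpace E'] [CompleteSpace E''] [I.OrdConnected]
    (hF : IsPrimitiveOn I F f) (hG : IsPrimitiveOn I G g) :
    IsPrimitiveOn I (fun x => B (F x) (G x)) (fun x => B (f x) (G x) + B (F x) (g x)) := by
  refine isPrimitiveOn_of_le fun p hp q hq hpq => ?_
  have hsub : Icc p q ⊆ I := OrdConnected.out ‹_› hp hq
  replace hF := hF.mono hsub
  replace hG := hG.mono hsub
  have hint := (intervalIntegrable_bilin B hpq (hF.intervalIntegrable hpq)
    hG.continuousOn_Icc).add (intervalIntegrable_bilin B.flip hpq (hG.intervalIntegrable hpq)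
      hF.continuousOn_Icc)
  refine ⟨hint, integral_eq_sub_of_absolutelyContinuousOnInterval hpq
    (hF.absolutelyContinuousOnInterval_bilin hG hpq) hint ?_⟩
  filter_upwards [hF.ae_hasDerivAt hpq, hG.ae_hasDerivAt hpq] with x hFx hGx hx
  rw [add_comm]
  exact B.hasDerivAt_of_bilinear (fun _ => hFx hx) fun _ => hGx hx

theorem integral_bilin_eq_sub [CompleteSpace E] [CompleteSpace E'] [CompleteSpace E'']
    (hF : IsPrimitiveOn (Icc p q) F f) (hG : IsPrimitiveOn (Icc p q) G g) (hpq : p ≤ q) :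
    ∫ t in p..q, B (F t) (g t) =
      B (F q) (G q) - B (F p) (G p) - ∫ t in p..q, B (f t) (G t) := by
  rw [((hF.bilin hG) p (left_mem_Icc.2 hpq) q (right_mem_Icc.2 hpq)).2,
    intervalIntegral.integral_add, add_sub_cancel_left]
  exacts [intervalIntegrable_bilin B hpq (hF.intervalIntegrable hpq) hG.continuousOn_Icc,
    intervalIntegrable_bilin B.flip hpq (hG.intervalIntegrable hpq) hF.continuousOn_Icc]

end IsPrimitiveOn

end Calculus

section L2Interval

variable {p q : ℝ}

theorem memLp_of_continuousOn {E : Type*} [NormedAddCommGroup E] {f : ℝ → E} {p q : ℝ}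
    (hf : ContinuousOn f (Icc p q)) (r : ℝ≥0∞) : MemLp f r (volume.restrict (Ioo p q)) := by
  obtain ⟨C, hC⟩ := isCompact_Icc.exists_bound_of_continuousOn hf
  refine MemLp.of_bound
    ((hf.mono Ioo_subset_Icc_self).aestronglyMeasurable measurableSet_Ioo) C ?_
  filter_upwards [ae_restrict_mem measurableSet_Ioo] with x hx
  exact hC x (Ioo_subset_Icc_self hx)

theorem intervalIntegrable_L2 (g : L2 p q) {x y : ℝ} (hx : x ∈ Icc p q) (hy : y ∈ Icc p q) :
    IntervalIntegrable g volume x y := by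
  refine intervalIntegrable_of_mem_Icc ?_ hx hy
  rw [intervalIntegrable_iff_integrableOn_Ioo_of_le (hx.1.trans hx.2)]
  exact (Lp.memLp g).integrable one_le_two

theorem exists_integral_eq_inner {x y : ℝ} (hx : x ∈ Icc p q) (hy : y ∈ Icc p q) (hxy : x ≤ y) :
    ∃ e : L2 p q, ‖e‖ = √(y - x) ∧ ∀ g : L2 p q, ∫ t in x..y, g t = inner ℂ e g := by
  have hs : MeasurableSet (Ioo x y) := measurableSet_Ioo
  have hsub : Ioo x y ⊆ Ioo p q := Ioo_subset_Ioo hx.1 hy.2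
  have hμ : (volume.restrict (Ioo p q)) (Ioo x y) ≠ ∞ :=
    ((Measure.restrict_apply_le _ _).trans_lt measure_Ioo_lt_top).ne
  refine ⟨indicatorConstLp 2 hs hμ 1, ?_, fun g => ?_⟩
  · rw [norm_indicatorConstLp two_ne_zero ENNReal.ofNat_ne_top, norm_one, one_mul, Measure.real,
      Measure.restrict_apply hs, inter_eq_self_of_subset_left hsub, Real.volume_Ioo,
      ENNReal.toReal_ofReal (sub_nonneg.2 hxy), Real.sqrt_eq_rpow, ENNReal.toReal_ofNat]
  · rw [L2.inner_indicatorConstLp_one, Measure.restrict_restrict hs,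
      inter_eq_self_of_subset_left hsub, ← integral_Ioc_eq_integral_Ioo,
      ← intervalIntegral.integral_of_le hxy]

theorem norm_integral_L2_le (g : L2 p q) {x y : ℝ} (hx : x ∈ Icc p q) (hy : y ∈ Icc p q)
    (hxy : x ≤ y) : ‖∫ t in x..y, g t‖ ≤ √(y - x) * ‖g‖ := by
  obtain ⟨e, he, heq⟩ := exists_integral_eq_inner hx hy hxy
  rw [heq, ← he]
  exact norm_inner_le_norm _ _

theorem tendsto_integral_L2 {ι : Type*} {l : Filter ι} {g : ι → L2 p q} {g₀ : L2 p q}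
    (hg : Tendsto g l (𝓝 g₀)) {x y : ℝ} (hx : x ∈ Icc p q) (hy : y ∈ Icc p q) (hxy : x ≤ y) :
    Tendsto (fun i => ∫ t in x..y, g i t) l (𝓝 (∫ t in x..y, g₀ t)) := by
  obtain ⟨e, -, heq⟩ := exists_integral_eq_inner hx hy hxy
  simp only [heq]
  exact tendsto_const_nhds.inner hg

theorem integrable_norm_sq (g : L2 p q) : IntegrableOn (fun x => ‖g x‖ ^ 2) (Ioo p q) :=
  (memLp_two_iff_integrable_sq_norm (Lp.aestronglyMeasurable g)).1 (Lp.memLp g)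

theorem norm_sq_L2 (g : L2 p q) : ‖g‖ ^ 2 = ∫ x in Ioo p q, ‖g x‖ ^ 2 := by
  have h : ((‖g‖ ^ 2 : ℝ) : ℂ) = ((∫ x in Ioo p q, ‖g x‖ ^ 2 : ℝ) : ℂ) := by
    rw [← integral_complex_ofReal, Complex.ofReal_pow, ← Complex.coe_algebraMap,
      ← inner_self_eq_norm_sq_to_K, L2.inner_def]
    refine integral_congr_ae (Eventually.of_forall fun x => ?_)
    simp [inner_self_eq_norm_sq_to_K, -RCLike.inner_apply]
  exact_mod_cast h

end L2Interval

/-! ### Sobolev spaces and the energy space -/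

namespace H1R

theorem norm_eq (y : H1R) : ‖y‖ = ‖y.dx‖ := (dxIso.norm_map y).symm

theorem inner_eq (y z : H1R) : inner ℂ y z = inner ℂ y.dx z.dx := rfl

theorem fn_eq_integral (y : H1R) {x : ℝ} (hx : x ∈ Icc (1 : ℝ) 2) :
    y.fn x = - ∫ t in x..2, y.dx t := by
  rw [← (y.isPrimitiveOn x hx 2 (by norm_num)).2, fn_two, zero_sub, neg_neg]

theorem norm_fn_le (y : H1R) {x : ℝ} (hx : x ∈ Icc (1 : ℝ) 2) : ‖y.fn x‖ ≤ ‖y‖ := by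
  have hsqrt : √(2 - x) ≤ 1 := Real.sqrt_le_one.2 (by linarith [hx.1])
  rw [fn_eq_integral y hx, norm_neg, norm_eq]
  calc ‖∫ t in x..2, y.dx t‖ ≤ √(2 - x) * ‖y.dx‖ :=
        norm_integral_L2_le _ hx (by norm_num) hx.2
    _ ≤ ‖y.dx‖ := mul_le_of_le_one_left (norm_nonneg _) hsqrt

theorem memLp_fn (y : H1R) : MemLp y.fn 2 (volume.restrict (Ioo 1 2)) :=
  memLp_of_continuousOn y.isPrimitiveOn.continuousOn_Icc 2

theorem norm_toLp_le (y : H1R) : ‖y.memLp_fn.toLp‖ ≤ ‖y‖ := by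
  have hunit : measureUnivNNReal (volume.restrict (Ioo (1 : ℝ) 2)) = 1 := by
    rw [measureUnivNNReal, Measure.restrict_apply_univ, Real.volume_Ioo]
    norm_num
  have hle := Lp.norm_le_of_ae_bound (f := y.memLp_fn.toLp) (norm_nonneg y) (by
    filter_upwards [y.memLp_fn.coeFn_toLp, ae_restrict_mem measurableSet_Ioo] with x hx hxI
    exact hx ▸ y.norm_fn_le (Ioo_subset_Icc_self hxI))
  rwa [hunit, NNReal.coe_one, Real.one_rpow, one_mul] at hle

/-- The embedding of `H¹_R(1, 2)` into `L²(1, 2)`. -/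
noncomputable def toL2 : H1R →L[ℂ] L2 1 2 :=
  LinearMap.mkContinuous
    { toFun := fun y => y.memLp_fn.toLp
      map_add' := fun y z => by
        rw [← MemLp.toLp_add]
        exact MemLp.toLp_congr _ _ (Eventually.of_forall fun x => by rw [fn_add])
      map_smul' := fun r y => by
        rw [RingHom.id_apply, ← MemLp.toLp_const_smul]
        exact MemLp.toLp_congr _ _ (Eventually.of_forall fun x => by rw [fn_smul]) }
    1 fun y => (one_mul ‖y‖).symm ▸ y.norm_toLp_le

theorem coeFn_toL2 (y : H1R) : toL2 y =ᵐ[volume.restrict (Ioo 1 2)] y.fn :=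
  y.memLp_fn.coeFn_toLp

/-- The trace at `1`. -/
noncomputable def trace : H1R →L[ℂ] ℂ :=
  LinearMap.mkContinuous
    { toFun := fun y => y.fn 1
      map_add' := fun y z => by rw [fn_add]; rfl
      map_smul' := fun r y => by rw [fn_smul]; rfl }
    1 fun y => (one_mul ‖y‖).symm ▸ y.norm_fn_le (by norm_num)

end H1R

theorem ofReal_mul_conj_mul_self (r : ℝ) (z : ℂ) :
    (r : ℂ) * (starRingEnd ℂ z * z) = ((r * ‖z‖ ^ 2 : ℝ) : ℂ) := by
  rw [Complex.conj_mul']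
  push_cast
  ring

namespace TransmissionData

variable {S : TransmissionData}

variable (S) in
theorem exists_η_bounds :
    ∃ k > 0, ∃ K > 0, ∀ x ∈ Icc (0 : ℝ) 1, k ≤ S.η x ∧ S.η x ≤ K := by
  obtain ⟨x, -, hxmin⟩ := isCompact_Icc.exists_isMinOn (nonempty_Icc.2 zero_le_one) S.η_cont
  obtain ⟨y, -, hymax⟩ := isCompact_Icc.exists_isMaxOn (nonempty_Icc.2 zero_le_one) S.η_cont
  exact ⟨S.η x, S.η_pos x, S.η y, S.η_pos y, fun z hz => ⟨hxmin hz, hymax hz⟩⟩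

namespace H1σL

theorem inner_eq (u v : S.H1σL) : inner ℂ u v =
    ∫ x in Ioo (0 : ℝ) 1, (S.η x : ℂ) * (starRingEnd ℂ (u.dx x) * v.dx x) := rfl

theorem norm_sq_eq (u : S.H1σL) : ‖u‖ ^ 2 = ∫ x in Ioo (0 : ℝ) 1, S.η x * ‖u.dx x‖ ^ 2 := by
  have h : ((‖u‖ ^ 2 : ℝ) : ℂ) = ((∫ x in Ioo (0 : ℝ) 1, S.η x * ‖u.dx x‖ ^ 2 : ℝ) : ℂ) := by
    rw [Complex.ofReal_pow, ← Complex.coe_algebraMap, ← inner_self_eq_norm_sq_to_K, inner_eq]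
    simp only [ofReal_mul_conj_mul_self]
    exact integral_complex_ofReal
  exact_mod_cast h

theorem integrable_η_norm_sq (f : L2 0 1) :
    IntegrableOn (fun x => S.η x * ‖f x‖ ^ 2) (Ioo 0 1) := by
  have h := integrable_η_mul (S := S) f f
  simp only [ofReal_mul_conj_mul_self] at h
  exact h.re

variable (S) in
theorem exists_norm_dx_le : ∃ C > 0, ∀ u : S.H1σL, ‖u.dx‖ ≤ C * ‖u‖ := by
  obtain ⟨k, hk, K, -, hη⟩ := S.exists_η_bounds
  refine ⟨√k⁻¹, by positivity, fun u => abs_le_of_sq_le_sq' ?_ (by positivity) |>.2⟩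
  rw [mul_pow, Real.sq_sqrt (by positivity), inv_mul_eq_div, le_div_iff₀' hk, norm_sq_eq,
    norm_sq_L2, ← integral_const_mul]
  refine setIntegral_mono_on ((integrable_norm_sq _).const_mul _) (integrable_η_norm_sq _)
    measurableSet_Ioo fun x hx => ?_
  exact mul_le_mul_of_nonneg_right (hη x (Ioo_subset_Icc_self hx)).1 (sq_nonneg _)

variable (S) in
theorem exists_norm_le_norm_dx : ∃ C > 0, ∀ u : S.H1σL, ‖u‖ ≤ C * ‖u.dx‖ := by
  obtain ⟨k, -, K, hK, hη⟩ := S.exists_η_bounds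
  refine ⟨√K, by positivity, fun u => abs_le_of_sq_le_sq' ?_ (by positivity) |>.2⟩
  rw [mul_pow, Real.sq_sqrt hK.le, norm_sq_eq, norm_sq_L2, ← integral_const_mul]
  refine setIntegral_mono_on (integrable_η_norm_sq _) ((integrable_norm_sq _).const_mul _)
    measurableSet_Ioo fun x hx => ?_
  exact mul_le_mul_of_nonneg_right (hη x (Ioo_subset_Icc_self hx)).2 (sq_nonneg _)

theorem fn_eq_integral (u : S.H1σL) {x : ℝ} (hx : x ∈ Icc (0 : ℝ) 1) :
    u.fn x = ∫ t in 0..x, u.dx t := by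
  rw [← (u.isPrimitiveOn 0 (by norm_num) x hx).2, fn_zero, sub_zero]

theorem norm_fn_le (u : S.H1σL) {x : ℝ} (hx : x ∈ Icc (0 : ℝ) 1) :
    ‖u.fn x‖ ≤ √x * ‖u.dx‖ := by
  rw [fn_eq_integral u hx]
  simpa only [sub_zero] using norm_integral_L2_le u.dx (by norm_num) hx hx.1

theorem memLp_fn (u : S.H1σL) : MemLp u.fn 2 S.invσMeasure := u.2.2.2

/-- The embedding of `H¹_{1/σ,L}(0, 1)` into `L²_{1/σ}(0, 1)`; in general it is not continuous for
the energy norm. -/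
noncomputable def toL2σ : S.H1σL →ₗ[ℂ] S.L2σ where
  toFun u := u.memLp_fn.toLp
  map_add' u v := by
    rw [← MemLp.toLp_add]
    exact MemLp.toLp_congr _ _ (Eventually.of_forall fun x => by rw [fn_add])
  map_smul' r u := by
    rw [RingHom.id_apply, ← MemLp.toLp_const_smul]
    exact MemLp.toLp_congr _ _ (Eventually.of_forall fun x => by rw [fn_smul])

theorem coeFn_toL2σ (u : S.H1σL) : toL2σ u =ᵐ[S.invσMeasure] u.fn := u.memLp_fn.coeFn_toLp

/-- The trace at `1`. -/
noncomputable def trace : S.H1σL →L[ℂ] ℂ :=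
  LinearMap.mkContinuousOfExistsBound
    { toFun := fun u => u.fn 1
      map_add' := fun y z => by rw [fn_add]; rfl
      map_smul' := fun r y => by rw [fn_smul]; rfl }
    (by
      obtain ⟨C, -, hC⟩ := exists_norm_dx_le S
      refine ⟨C, fun u => ?_⟩
      have hfn := u.norm_fn_le (x := 1) (by norm_num)
      rw [Real.sqrt_one, one_mul] at hfn
      exact hfn.trans (hC u))

theorem exists_dx_eq (g : L2 0 1)
    (hg : MemLp (fun x => ∫ t in (0 : ℝ)..x, g t) 2 S.invσMeasure) :
    ∃ u : S.H1σL, u.dx = g ∧ ∀ x ∈ Icc (0 : ℝ) 1, u.fn x = ∫ t in (0 : ℝ)..x, g t := by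
  have h0 : (0 : ℝ) ∈ Icc (0 : ℝ) 1 := by norm_num
  have hprim : IsPrimitiveOn (Icc 0 1) (fun x => ∫ t in (0 : ℝ)..x, g t) g := by
    simpa only [zero_add] using
      isPrimitiveOn_integral (fun x hx y hy => intervalIntegrable_L2 g hx hy) h0 0
  let w : C(Icc (0 : ℝ) 1, ℂ) :=
    ⟨fun x => ∫ t in (0 : ℝ)..x, g t, hprim.continuousOn_Icc.domRestrict⟩
  have hw : ∀ x ∈ Icc (0 : ℝ) 1, zeroExt w x = ∫ t in (0 : ℝ)..x, g t := fun x hx =>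
    zeroExt_apply w hx
  refine ⟨⟨(w, g), ?_, ?_, ?_⟩, rfl, hw⟩
  · exact hprim.congr (fun x hx => (hw x hx).symm) (Eventually.of_forall fun _ _ => rfl)
  · simp only [hw 0 h0, intervalIntegral.integral_same]
  · refine hg.ae_eq (ae_invσ.2 ?_)
    filter_upwards [ae_restrict_mem measurableSet_Ioo] with x hx
    exact (hw x (Ioo_subset_Icc_self hx)).symm

theorem coeFn_eq_integral_of_tendsto {u : ℕ → S.H1σL} {g : L2 0 1} {w : S.L2σ}
    (hu : Tendsto (fun n => (u n).dx) atTop (𝓝 g))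
    (hw : Tendsto (fun n => toL2σ (u n)) atTop (𝓝 w)) :
    w =ᵐ[S.invσMeasure] fun x => ∫ t in (0 : ℝ)..x, g t := by
  obtain ⟨ns, hns, hae⟩ := (tendstoInMeasure_of_tendsto_Lp hw).exists_seq_tendsto_ae
  have hfn : ∀ᵐ x ∂S.invσMeasure, ∀ n, toL2σ (u n) x = (u n).fn x :=
    ae_all_iff.2 fun n => coeFn_toL2σ (u n)
  filter_upwards [hae, hfn, ae_invσ.2 (ae_restrict_mem measurableSet_Ioo)] with x hx hxfn hxI
  have hxI := Ioo_subset_Icc_self hxI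
  simp only [hxfn, fn_eq_integral _ hxI] at hx
  exact tendsto_nhds_unique hx ((tendsto_integral_L2 hu (by norm_num) hxI hxI.1).comp
    hns.tendsto_atTop)

theorem exists_tendsto {u : ℕ → S.H1σL} (hu : CauchySeq u) {w : S.L2σ}
    (hw : Tendsto (fun n => toL2σ (u n)) atTop (𝓝 w)) :
    ∃ v : S.H1σL, Tendsto u atTop (𝓝 v) ∧ toL2σ v = w := by
  obtain ⟨C, -, hC⟩ := exists_norm_dx_le S
  obtain ⟨C', -, hC'⟩ := exists_norm_le_norm_dx S
  have hdx : UniformContinuous (dx (S := S)) :=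
    (AddMonoidHomClass.lipschitz_of_bound _ C hC).uniformContinuous
  obtain ⟨g, hg⟩ := cauchySeq_tendsto_of_complete (hdx.comp_cauchySeq hu)
  have hwg := coeFn_eq_integral_of_tendsto hg hw
  obtain ⟨v, hv, hvg⟩ := exists_dx_eq (S := S) g ((Lp.memLp w).ae_eq hwg)
  refine ⟨v, ?_, Lp.ext ((coeFn_toL2σ v).trans (EventuallyEq.trans ?_ hwg.symm))⟩
  · rw [tendsto_iff_norm_sub_tendsto_zero] at hg ⊢
    refine squeeze_zero (fun _ => norm_nonneg _) (fun n => ?_)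
      ((hg.const_mul C').trans_eq (by rw [mul_zero]))
    simpa only [map_sub, hv, Function.comp_apply] using hC' (u n - v)
  · filter_upwards [ae_invσ.2 (ae_restrict_mem measurableSet_Ioo)] with x hx
    exact hvg x (Ioo_subset_Icc_self hx)

end H1σL

variable (S) in
/-- The graph of the embedding `U ↦ u` of the energy space into `L²_{1/σ}(0, 1)`, that is, the
energy space with the additional term `‖u‖²` in its norm. Unlike the energy space, which is not
assumed to be complete, it is always a Hilbert space. -/
def graphSpace : Submodule ℂ (WithLp 2 (S.Energy × S.L2σ)) where
  carrier := {p | p.snd = H1σL.toL2σ p.fst.u}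
  zero_mem' := (map_zero (H1σL.toL2σ (S := S))).symm
  add_mem' := by
    intro p p' hp hp'
    change p.snd + p'.snd = H1σL.toL2σ (p.fst.u + p'.fst.u)
    rw [map_add, ← hp, ← hp']
  smul_mem' := by
    intro r p hp
    change r • p.snd = H1σL.toL2σ (r • p.fst.u)
    rw [map_smul, ← hp]

instance : CompleteSpace S.graphSpace := by
  refine Metric.complete_of_cauchySeq_tendsto fun x hx => ?_
  have hx' := (uniformContinuous_subtype_val (p := (· ∈ S.graphSpace))).comp_cauchySeq hx
  have hU := (WithLp.fstL 2 ℂ S.Energy S.L2σ).uniformContinuous.comp_cauchySeq hx'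
  have hw := (WithLp.sndL 2 ℂ S.Energy S.L2σ).uniformContinuous.comp_cauchySeq hx'
  have hu := (WithLp.fstL 2 ℂ S.H1σL _).uniformContinuous.comp_cauchySeq hU
  have hr := (WithLp.sndL 2 ℂ S.H1σL _).uniformContinuous.comp_cauchySeq hU
  obtain ⟨w, hw⟩ := cauchySeq_tendsto_of_complete hw
  obtain ⟨r, hr⟩ := cauchySeq_tendsto_of_complete hr
  obtain ⟨v, hv, hvw⟩ := H1σL.exists_tendsto hu (hw.congr fun n => (x n).2)
  refine ⟨⟨WithLp.toLp 2 (WithLp.toLp 2 (v, r), w), hvw.symm⟩, ?_⟩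
  rw [tendsto_subtype_rng]
  exact ((WithLp.prod_continuous_toLp 2 S.Energy S.L2σ).tendsto _).comp
    (Tendsto.prodMk_nhds (((WithLp.prod_continuous_toLp 2 S.H1σL _).tendsto _).comp
      (hv.prodMk_nhds hr)) hw)

/-- The projection of the graph space onto the energy space. -/
noncomputable def graphEquiv : S.graphSpace ≃ₗ[ℂ] S.Energy where
  toFun x := x.1.fst
  map_add' _ _ := rfl
  map_smul' _ _ := rfl
  invFun U := ⟨WithLp.toLp 2 (U, H1σL.toL2σ U.u), rfl⟩
  left_inv x := Subtype.ext (congrArg (WithLp.toLp 2) (Prod.ext rfl x.2.symm))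
  right_inv _ := rfl

theorem continuous_graphEquiv : Continuous (graphEquiv (S := S)) :=
  (WithLp.fstL 2 ℂ S.Energy S.L2σ).continuous.comp continuous_subtype_val

theorem norm_graphEquiv_le (x : S.graphSpace) : ‖graphEquiv x‖ ≤ ‖x‖ :=
  WithLp.norm_fst_le _ x.1

theorem norm_toL2σ_graphEquiv_le (x : S.graphSpace) : ‖H1σL.toL2σ (graphEquiv x).u‖ ≤ ‖x‖ :=
  (congrArg norm x.2).symm.trans_le (WithLp.norm_snd_le _ x.1)

theorem inner_graphSpace (x y : S.graphSpace) :
    inner ℂ x y = inner ℂ (graphEquiv x) (graphEquiv y) +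
      inner ℂ (H1σL.toL2σ (graphEquiv x).u) (H1σL.toL2σ (graphEquiv y).u) := by
  have hx : x.1.snd = H1σL.toL2σ (graphEquiv x).u := x.2
  have hy : y.1.snd = H1σL.toL2σ (graphEquiv y).u := y.2
  rw [← hx, ← hy]
  rfl

theorem Energy.norm_v_le (U : S.Energy) : ‖U.v‖ ≤ ‖U‖ :=
  (WithLp.norm_fst_le _ U.snd).trans (WithLp.norm_snd_le _ U)

theorem IsValue.toL2σ_eq {U F : S.Energy} {q : ℝ → ℂ} {y : H1R} {z : H1 1 2} {Γ : ℝ → H1R}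
    {γs : S.W} (h : IsValue U F q y z Γ γs) : H1σL.toL2σ F.u = U.v :=
  Lp.ext ((H1σL.coeFn_toL2σ F.u).trans h.v_eq.symm)

theorem toL2σ_eq_of_mem_graph {U F : S.Energy} (h : (U, F) ∈ S.operator.graph) :
    H1σL.toL2σ F.u = U.v := by
  rw [operator_graph] at h
  obtain ⟨_, _, _, _, _, hvalue⟩ := h
  exact hvalue.toL2σ_eq

theorem re_inner_graphSpace_le (hA : IsMDissipative S.operator) (x y : S.graphSpace)
    (hxy : (graphEquiv x, graphEquiv y) ∈ S.operator.graph) :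
    (inner ℂ x y).re ≤ 1 * ‖x‖ ^ 2 := by
  have henergy := hA.re_inner_nonpos hxy
  have hcross : (inner ℂ (H1σL.toL2σ (graphEquiv x).u) (graphEquiv x).v).re ≤ ‖x‖ * ‖x‖ :=
    calc _ ≤ ‖H1σL.toL2σ (graphEquiv x).u‖ * ‖(graphEquiv x).v‖ := re_inner_le_norm (𝕜 := ℂ) _ _
      _ ≤ ‖x‖ * ‖x‖ := mul_le_mul (norm_toL2σ_graphEquiv_le x)
        ((Energy.norm_v_le _).trans (norm_graphEquiv_le x)) (norm_nonneg _) (norm_nonneg _)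
  rw [inner_graphSpace, toL2σ_eq_of_mem_graph hxy, Complex.add_re]
  linarith

end TransmissionData

/-! ### Dissipativity -/

section BoundaryTerms

theorem not_integrableOn_inv {d : ℝ} (hd : 0 < d) :
    ¬ IntegrableOn (fun x : ℝ => x⁻¹) (Ioo 0 d) := by
  rw [← intervalIntegrable_iff_integrableOn_Ioo_of_le hd.le, intervalIntegrable_inv_iff]
  simp [hd.ne]

/-- If the limit `L` were not zero, `‖q x‖ ^ 2` would dominate a multiple of `1 / x`. -/
theorem eq_zero_of_tendsto_of_le_sqrt_mul {h : ℝ → ℝ} {q : ℝ → ℂ} {b K L : ℝ} (hb : 0 < b)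
    (hq : IntegrableOn (fun x => ‖q x‖ ^ 2) (Ioo 0 b))
    (hle : ∀ x ∈ Ioo 0 b, |h x| ≤ √x * K * ‖q x‖) (hL : Tendsto h (𝓝[>] 0) (𝓝 L)) : L = 0 := by
  by_contra hne
  have hLpos : 0 < |L| / 2 := by positivity
  obtain ⟨δ, hδ, hδsub⟩ := mem_nhdsGT_iff_exists_Ioo_subset.1
    (hL.abs.eventually (lt_mem_nhds (half_lt_self (abs_pos.2 hne))))
  have hsub : Ioo 0 (min δ b) ⊆ Ioo 0 b := Ioo_subset_Ioo_right (min_le_right _ _)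
  refine not_integrableOn_inv (lt_min hδ hb) (Integrable.mono'
    ((hq.mono_set hsub).const_mul (K ^ 2 / (|L| / 2) ^ 2)) measurable_inv.aestronglyMeasurable ?_)
  filter_upwards [ae_restrict_mem measurableSet_Ioo] with x hx
  have hLx : |L| / 2 ≤ √x * K * ‖q x‖ :=
    (hδsub ⟨hx.1, hx.2.trans_le (min_le_left _ _)⟩).le.trans (hle x (hsub hx))
  have hsq : (|L| / 2) ^ 2 ≤ K ^ 2 * ‖q x‖ ^ 2 * x := by
    calc (|L| / 2) ^ 2 ≤ (√x * K * ‖q x‖) ^ 2 := pow_le_pow_left₀ hLpos.le hLx 2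
      _ = √x ^ 2 * (K ^ 2 * ‖q x‖ ^ 2) := by ring
      _ = K ^ 2 * ‖q x‖ ^ 2 * x := by rw [Real.sq_sqrt hx.1.le, mul_comm]
  rwa [norm_inv, Real.norm_of_nonneg hx.1.le, inv_le_iff_one_le_mul₀ hx.1, div_mul_eq_mul_div,
    div_mul_eq_mul_div, one_le_div₀ (by positivity)]

theorem integral_eq_of_le_sqrt_mul {G D : ℝ → ℝ} {q : ℝ → ℂ} {b K : ℝ} (hb : 0 < b)
    (hG : IsPrimitiveOn (Ioc 0 b) G D) (hD : IntervalIntegrable D volume 0 b)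
    (hq : IntegrableOn (fun x => ‖q x‖ ^ 2) (Ioo 0 b))
    (hle : ∀ x ∈ Ioo 0 b, |G x| ≤ √x * K * ‖q x‖) : ∫ x in 0..b, D x = G b := by
  have hlim : Tendsto G (𝓝[>] 0) (𝓝 (G b - ∫ x in 0..b, D x)) := by
    refine ((tendsto_integral_nhdsGT hD hb).const_sub (G b)).congr' ?_
    filter_upwards [Ioc_mem_nhdsGT hb] with x hx
    rw [← (hG x hx b (right_mem_Ioc.2 hb)).2, sub_sub_cancel]
  exact (sub_eq_zero.1 (eq_zero_of_tendsto_of_le_sqrt_mul hb hq hle hlim)).symm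

end BoundaryTerms

section Damping

variable {w w' g g' : ℝ → ℝ}

theorem neg_mul_le_integral_mul_deriv {p q : ℝ} (hpq : p ≤ q) (hw : IsPrimitiveOn (Icc p q) w w')
    (hw' : ∀ s ∈ Icc p q, w' s ≤ 0) (hwq : 0 ≤ w q) (hg : IsPrimitiveOn (Icc p q) g g')
    (hg0 : ∀ s ∈ Icc p q, 0 ≤ g s) : -(w p * g p) ≤ ∫ s in p..q, w s * g' s := by
  have hparts := hw.integral_bilin_eq_sub (B := ContinuousLinearMap.mul ℝ ℝ) hg hpq
  simp only [ContinuousLinearMap.mul_apply'] at hparts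
  have hle : 0 ≤ ∫ s in p..q, -(w' s * g s) := intervalIntegral.integral_nonneg hpq fun s hs =>
    neg_nonneg.2 (mul_nonpos_of_nonpos_of_nonneg (hw' s hs) (hg0 s hs))
  rw [intervalIntegral.integral_neg] at hle
  have hq := mul_nonneg hwq (hg0 q (right_mem_Icc.2 hpq))
  linarith

theorem integral_mul_deriv_nonneg {T M : ℝ} (hT : 0 < T) (hw : IsPrimitiveOn (Ioc 0 T) w w')
    (hw' : ∀ s ∈ Ioc 0 T, w' s ≤ 0) (hwT : 0 ≤ w T) (hM : ∀ s ∈ Ioc 0 T, w s ≤ M)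
    (hg : IsPrimitiveOn (Icc 0 T) g g') (hg0 : ∀ s ∈ Icc 0 T, 0 ≤ g s) (hg_zero : g 0 = 0)
    (hint : IntervalIntegrable (fun s => w s * g' s) volume 0 T) :
    0 ≤ ∫ s in 0..T, w s * g' s := by
  have hlim : Tendsto (fun e => -(M * g e)) (𝓝[>] 0) (𝓝 0) := by
    simpa only [hg_zero, mul_zero, neg_zero] using ((hg.tendsto_nhdsGT hT).const_mul M).neg
  refine le_of_tendsto_of_tendsto hlim (tendsto_integral_nhdsGT hint hT) ?_
  filter_upwards [Ioc_mem_nhdsGT hT] with e he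
  have hIoc : Icc e T ⊆ Ioc 0 T := fun s hs => ⟨he.1.trans_le hs.1, hs.2⟩
  have hIcc : Icc e T ⊆ Icc 0 T := Icc_subset_Icc_left he.1.le
  calc -(M * g e) ≤ -(w e * g e) :=
        neg_le_neg (mul_le_mul_of_nonneg_right (hM e he) (hg0 e ⟨he.1.le, he.2⟩))
    _ ≤ ∫ s in e..T, w s * g' s := neg_mul_le_integral_mul_deriv he.2 (hw.mono hIoc)
        (fun s hs => hw' s (hIoc hs)) hwT (hg.mono hIcc) (fun s hs => hg0 s (hIcc hs))

theorem IsPrimitiveOn.norm_sq {E : Type*} [NormedAddCommGroup E] [InnerProductSpace ℂ E]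
    [CompleteSpace E] {I : Set ℝ} [I.OrdConnected] {F f : ℝ → E} (hF : IsPrimitiveOn I F f) :
    IsPrimitiveOn I (fun s => ‖F s‖ ^ 2) (fun s => 2 * (inner ℂ (F s) (f s)).re) := by
  let _ : InnerProductSpace ℝ E := InnerProductSpace.complexToReal
  refine (hF.bilin (B := innerSL ℝ) hF).congr (fun s _ => by exact real_inner_self_eq_norm_sq (F s))
    (Eventually.of_forall fun s _ => ?_)
  rw [innerSL_apply_apply, innerSL_apply_apply, real_inner_comm, ← two_mul]
  rfl

end Damping

theorem re_integral_eq_of_ae_eq {α : Type*} [MeasurableSpace α] {ν : Measure α} {f : α → ℂ}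
    {g : α → ℝ} (hf : Integrable f ν) (hfg : (fun x => (f x).re) =ᵐ[ν] g) :
    (∫ x, f x ∂ν).re = ∫ x, g x ∂ν :=
  (integral_re hf).symm.trans (integral_congr_ae hfg)

section WithDensity

variable {α E : Type*} [MeasurableSpace α] {ν : Measure α} [NormedAddCommGroup E] [NormedSpace ℝ E]
  {w : α → ℝ} {f : α → E}

theorem toReal_ofReal_smul_ae_eq (hw : 0 ≤ᵐ[ν] w) :
    (fun x => (ENNReal.ofReal (w x)).toReal • f x) =ᵐ[ν] fun x => w x • f x := by
  filter_upwards [hw] with x hx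
  rw [ENNReal.toReal_ofReal hx]

theorem integral_withDensity_ofReal (hwm : AEMeasurable w ν) (hw : 0 ≤ᵐ[ν] w) :
    ∫ x, f x ∂ν.withDensity (fun x => ENNReal.ofReal (w x)) = ∫ x, w x • f x ∂ν := by
  rw [integral_withDensity_eq_integral_toReal_smul₀ hwm.ennreal_ofReal
    (Eventually.of_forall fun _ => ENNReal.ofReal_lt_top)]
  exact integral_congr_ae (toReal_ofReal_smul_ae_eq hw)

theorem integrable_withDensity_ofReal_iff (hwm : AEMeasurable w ν) (hw : 0 ≤ᵐ[ν] w) :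
    Integrable f (ν.withDensity fun x => ENNReal.ofReal (w x)) ↔
      Integrable (fun x => w x • f x) ν := by
  rw [integrable_withDensity_iff_integrable_smul₀' hwm.ennreal_ofReal
    (Eventually.of_forall fun _ => ENNReal.ofReal_lt_top)]
  exact integrable_congr (toReal_ofReal_smul_ae_eq hw)

end WithDensity

theorem H1R.integral_inner_eq (y : H1R) (z : H1 1 2) :
    ∫ x in Ioo (1 : ℝ) 2, inner ℂ (y.fn x) (z.1.2 x) =
      - inner ℂ (y.fn 1) (zeroExt z.1.1 1) -
        ∫ x in Ioo (1 : ℝ) 2, inner ℂ (y.dx x) (zeroExt z.1.1 x) := by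
  have hz : IsPrimitiveOn (Icc 1 2) (zeroExt z.1.1) z.1.2 := z.2
  have hparts := y.isPrimitiveOn.integral_bilin_eq_sub
    (B := (isBoundedBilinearMap_inner (𝕜 := ℂ)).toContinuousLinearMap) hz one_le_two
  simp only [IsBoundedBilinearMap.toContinuousLinearMap_apply,
    intervalIntegral.integral_of_le one_le_two, integral_Ioc_eq_integral_Ioo, y.fn_two,
    inner_zero_left, zero_sub] at hparts
  exact hparts

namespace TransmissionData

variable {S : TransmissionData}

section Wave

theorem continuousOn_inv_σ : ContinuousOn (fun x => 1 / S.σ x) (Ioc 0 1) :=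
  continuousOn_const.div (S.σ_cont.mono Ioc_subset_Icc_self) fun _ hx => (S.σ_pos hx).ne'

theorem aemeasurable_inv_σ : AEMeasurable (fun x => 1 / S.σ x) (volume.restrict (Ioo 0 1)) :=
  (continuousOn_inv_σ.mono Ioo_subset_Ioc_self).aemeasurable measurableSet_Ioo

theorem inv_σ_nonneg : 0 ≤ᵐ[volume.restrict (Ioo 0 1)] fun x => 1 / S.σ x := by
  filter_upwards [ae_restrict_mem measurableSet_Ioo] with x hx
  exact one_div_nonneg.2 (S.σ_pos (Ioo_subset_Ioc_self hx)).le

theorem integral_invσ {E : Type*} [NormedAddCommGroup E] [NormedSpace ℝ E] (f : ℝ → E) :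
    ∫ x, f x ∂S.invσMeasure = ∫ x in Ioo 0 1, (1 / S.σ x) • f x :=
  integral_withDensity_ofReal aemeasurable_inv_σ inv_σ_nonneg

theorem integrable_invσ_iff {E : Type*} [NormedAddCommGroup E] [NormedSpace ℝ E] {f : ℝ → E} :
    Integrable f S.invσMeasure ↔ IntegrableOn (fun x => (1 / S.σ x) • f x) (Ioo 0 1) :=
  integrable_withDensity_ofReal_iff aemeasurable_inv_σ inv_σ_nonneg

theorem aestronglyMeasurable_η_mul {u : ℝ → ℂ}
    (hu : AEStronglyMeasurable u (volume.restrict (Ioo 0 1))) :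
    AEStronglyMeasurable (fun x => (S.η x : ℂ) * u x) (volume.restrict (Ioo 0 1)) :=
  ((Complex.continuous_ofReal.comp_continuousOn
    (S.η_cont.mono Ioo_subset_Icc_self)).aestronglyMeasurable measurableSet_Ioo).mul hu

theorem memLp_η_mul (f : L2 0 1) :
    MemLp (fun x => (S.η x : ℂ) * f x) 2 (volume.restrict (Ioo 0 1)) := by
  obtain ⟨k, -, K, -, hη⟩ := S.exists_η_bounds
  refine (Lp.memLp f).of_le_mul (c := K)
    (aestronglyMeasurable_η_mul (Lp.aestronglyMeasurable f)) ?_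
  filter_upwards [ae_restrict_mem measurableSet_Ioo] with x hx
  rw [norm_mul, Complex.norm_real, Real.norm_of_nonneg (S.η_pos x).le]
  exact mul_le_mul_of_nonneg_right (hη x (Ioo_subset_Icc_self hx)).2 (norm_nonneg _)

theorem integrableOn_norm_sq_flux {u : S.H1σL} {q : ℝ → ℂ}
    (hq : q =ᵐ[volume.restrict (Ioo 0 1)] fun x => (S.η x : ℂ) * u.dx x) :
    IntegrableOn (fun x => ‖q x‖ ^ 2) (Ioo 0 1) :=
  ((memLp_η_mul u.dx).ae_eq hq.symm).integrable_norm_pow two_ne_zero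

variable {U F : S.Energy} {q : ℝ → ℂ} {y : H1R} {z : H1 1 2} {Γ : ℝ → H1R} {γs : S.W}

theorem IsValue.re_η_mul_ae_eq (h : IsValue U F q y z Γ γs) :
    (fun x => ((S.η x : ℂ) * (starRingEnd ℂ (U.u.dx x) * F.u.dx x)).re)
      =ᵐ[volume.restrict (Ioo 0 1)] fun x => inner ℝ (F.u.dx x) (q x) := by
  filter_upwards [h.flux_eq] with x hx
  rw [hx, Complex.inner, mul_left_comm]
  simp only [Complex.mul_re, Complex.mul_im, Complex.conj_re, Complex.conj_im,
    Complex.ofReal_re, Complex.ofReal_im]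
  ring

theorem IsValue.re_inv_σ_smul_ae_eq (h : IsValue U F q y z Γ γs) :
    (fun x => ((1 / S.σ x) • inner ℂ (U.v x) (F.v x)).re)
      =ᵐ[volume.restrict (Ioo 0 1)] fun x => inner ℝ (F.u.fn x) (F.v x / (S.σ x : ℂ)) := by
  filter_upwards [ae_invσ.1 h.v_eq] with x hx
  rw [hx, Complex.inner, RCLike.inner_apply, div_eq_mul_inv (F.v x), ← Complex.ofReal_inv,
    Complex.real_smul, one_div]
  congr 1
  ring

theorem IsValue.re_wave_eq (h : IsValue U F q y z Γ γs) :
    ((∫ x in Ioo (0 : ℝ) 1, (S.η x : ℂ) * (starRingEnd ℂ (U.u.dx x) * F.u.dx x)) +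
      ∫ x, inner ℂ (U.v x) (F.v x) ∂S.invσMeasure).re = inner ℝ (F.u.fn 1) (q 1) := by
  have hη_int := integrable_η_mul (S := S) U.u.dx F.u.dx
  have hσ_int : IntegrableOn (fun x => (1 / S.σ x) • inner ℂ (U.v x) (F.v x)) (Ioo 0 1) :=
    integrable_invσ_iff.1 (L2.integrable_inner _ _)
  have hdx_int := hη_int.re.congr h.re_η_mul_ae_eq
  have hfn_int := (Integrable.re hσ_int).congr h.re_inv_σ_smul_ae_eq
  rw [integral_invσ, Complex.add_re, re_integral_eq_of_ae_eq hη_int h.re_η_mul_ae_eq,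
    re_integral_eq_of_ae_eq hσ_int h.re_inv_σ_smul_ae_eq,
    ← integral_add hdx_int hfn_int, ← integral_Ioc_eq_integral_Ioo,
    ← intervalIntegral.integral_of_le zero_le_one]
  refine integral_eq_of_le_sqrt_mul (G := fun x => inner ℝ (F.u.fn x) (q x)) (K := ‖F.u.dx‖)
    one_pos ((F.u.isPrimitiveOn.mono Ioc_subset_Icc_self).bilin (B := innerSL ℝ) h.flux_deriv
      |>.congr (fun _ _ => rfl) (Eventually.of_forall fun _ _ => rfl)) ?_
    (integrableOn_norm_sq_flux h.flux_eq) fun x hx => ?_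
  · rw [intervalIntegrable_iff_integrableOn_Ioo_of_le zero_le_one]
    exact hdx_int.add hfn_int
  · exact (abs_real_inner_le_norm _ _).trans
      (mul_le_mul_of_nonneg_right (F.u.norm_fn_le (Ioo_subset_Icc_self hx)) (norm_nonneg _))

theorem IsValue.heat_eq (h : IsValue U F q y z Γ γs) :
    ∫ x in Ioo (1 : ℝ) 2, inner ℂ (U.y x) (F.y x) =
      - inner ℂ (F.u.fn 1) (q 1) - inner ℂ y (zeta y U.γ) := by
  have hfn : ∫ x in Ioo (1 : ℝ) 2, inner ℂ (U.y x) (F.y x) =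
      ∫ x in Ioo (1 : ℝ) 2, inner ℂ (y.fn x) (z.1.2 x) := by
    rw [h.zeta_deriv]
    refine integral_congr_ae ?_
    filter_upwards [h.y_eq] with x hx
    rw [hx]
  rw [hfn, y.integral_inner_eq z, h.v_one, h.flux_one, H1R.inner_eq, L2.inner_def]
  congr 1
  refine integral_congr_ae ?_
  filter_upwards [h.zeta_eq] with x hx
  rw [hx]

end Wave

section Memory

variable (S) in
/-- The weight `c m μ` of the memory space. -/
def memoryWeight (s : ℝ) : ℝ := S.c * S.m * S.μ s

theorem c_mul_m_nonneg : 0 ≤ S.c * S.m := mul_nonneg S.c_pos.le S.m_mem.1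

theorem memoryWeight_nonneg {s : ℝ} (hs : 0 < s) : 0 ≤ S.memoryWeight s :=
  mul_nonneg c_mul_m_nonneg (S.μ_nonneg s hs)

theorem memoryWeight_antitone {s t : ℝ} (hs : 0 < s) (hst : s ≤ t) :
    S.memoryWeight t ≤ S.memoryWeight s :=
  mul_le_mul_of_nonneg_left (S.μ_antitone hs (hs.trans_le hst) hst) c_mul_m_nonneg

theorem memoryWeight_le {s : ℝ} (hs : 0 < s) : S.memoryWeight s ≤ S.memoryWeight 0 := by
  refine mul_le_mul_of_nonneg_left (ge_of_tendsto S.μ_tendsto ?_) c_mul_m_nonneg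
  filter_upwards [Ioc_mem_nhdsGT hs] with t ht
  exact S.μ_antitone ht.1 hs ht.2

theorem continuousOn_memoryWeight : ContinuousOn S.memoryWeight (Ioi 0) :=
  continuousOn_const.mul S.μ_contDiff.continuousOn

theorem isPrimitiveOn_memoryWeight :
    IsPrimitiveOn (Ioi 0) S.memoryWeight (fun s => S.c * S.m * deriv S.μ s) := by
  intro x hx y hy
  have hsub : uIcc x y ⊆ Ioi 0 := OrdConnected.uIcc_subset inferInstance hx hy
  have hcont : ContinuousOn (fun s => S.c * S.m * deriv S.μ s) (Ioi 0) :=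
    continuousOn_const.mul (S.μ_contDiff.continuousOn_deriv_of_isOpen isOpen_Ioi le_rfl)
  have hint := (hcont.mono hsub).intervalIntegrable (μ := volume)
  refine ⟨hint, (intervalIntegral.integral_eq_sub_of_hasDerivAt (fun s hs => ?_) hint).symm⟩
  exact ((S.μ_contDiff.differentiableOn one_ne_zero).differentiableAt
    (isOpen_Ioi.mem_nhds (hsub hs))).hasDerivAt.const_mul _

theorem deriv_memoryWeight_nonpos {s : ℝ} (hs : 0 < s) : S.c * S.m * deriv S.μ s ≤ 0 := by
  obtain ⟨K, hK, hdecay⟩ := S.μ_dafermos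
  refine mul_nonpos_of_nonneg_of_nonpos c_mul_m_nonneg ((hdecay s hs).trans ?_)
  exact mul_nonpos_of_nonpos_of_nonneg (neg_nonpos.2 hK.le) (S.μ_nonneg s hs)

theorem nonneg_of_mem_memoryInterval {T : ℝ} (hT : T ∈ S.memoryInterval) : 0 ≤ T := by
  rcases hT with rfl | hT
  exacts [le_rfl, hT.1.le]

theorem zero_mem_memoryInterval : (0 : ℝ) ∈ S.memoryInterval := Or.inl rfl

theorem Icc_subset_memoryInterval {T : ℝ} (hT : T ∈ S.memoryInterval) :
    Icc 0 T ⊆ S.memoryInterval := OrdConnected.out inferInstance zero_mem_memoryInterval hT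

instance : Nonempty S.memoryInterval := ⟨⟨0, zero_mem_memoryInterval⟩⟩

variable (S) in
theorem aecover_memory : AECover S.memoryMeasure atTop
    (fun T : S.memoryInterval => Ioc (0 : ℝ) T) where
  ae_eventually_mem := by
    refine ae_memory.2 ?_
    filter_upwards [volume.ae_ne 0] with s hs hsI
    filter_upwards [eventually_ge_atTop (⟨s, hsI⟩ : S.memoryInterval)] with T hT
    exact ⟨lt_of_le_of_ne (nonneg_of_mem_memoryInterval hsI) (Ne.symm hs), hT⟩
  measurableSet _ := measurableSet_Ioc

theorem restrict_memoryMeasure (T : ℝ) : S.memoryMeasure.restrict (Ioc 0 T) =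
    (volume.restrict (Ioc 0 T)).withDensity fun s => ENNReal.ofReal (S.memoryWeight s) := by
  rw [memoryMeasure, restrict_withDensity measurableSet_Ioc,
    Measure.restrict_restrict measurableSet_Ioc,
    inter_eq_self_of_subset_left Ioc_subset_Ioi_self]
  rfl

theorem aestronglyMeasurable_memoryWeight (T : ℝ) :
    AEStronglyMeasurable S.memoryWeight (volume.restrict (Ioc 0 T)) :=
  (continuousOn_memoryWeight.mono Ioc_subset_Ioi_self).aestronglyMeasurable measurableSet_Ioc

theorem memoryWeight_nonneg_ae (T : ℝ) :
    0 ≤ᵐ[volume.restrict (Ioc 0 T)] S.memoryWeight := by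
  filter_upwards [ae_restrict_mem measurableSet_Ioc] with s hs
  exact memoryWeight_nonneg hs.1

variable {E : Type*} [NormedAddCommGroup E] [NormedSpace ℝ E]

theorem setIntegral_memory (f : ℝ → E) {T : ℝ} (hT : 0 ≤ T) :
    ∫ s in Ioc 0 T, f s ∂S.memoryMeasure = ∫ s in 0..T, S.memoryWeight s • f s := by
  rw [restrict_memoryMeasure, intervalIntegral.integral_of_le hT, integral_withDensity_ofReal
    (aestronglyMeasurable_memoryWeight T).aemeasurable (memoryWeight_nonneg_ae T)]

theorem integrableOn_memory_iff {f : ℝ → E} {T : ℝ} : IntegrableOn f (Ioc 0 T) S.memoryMeasure ↔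
    IntegrableOn (fun s => S.memoryWeight s • f s) (Ioc 0 T) := by
  rw [IntegrableOn, restrict_memoryMeasure]
  exact integrable_withDensity_ofReal_iff
    (aestronglyMeasurable_memoryWeight T).aemeasurable (memoryWeight_nonneg_ae T)

theorem restrict_absolutelyContinuous_memory {T : ℝ} (hT : T ∈ S.memoryInterval) :
    volume.restrict (Ioc 0 T) ≪ S.memoryMeasure := by
  rw [← Measure.ae_le_iff_absolutelyContinuous]
  intro s hs
  refine (ae_restrict_iff' measurableSet_Ioc).2 ?_
  filter_upwards [ae_memory.1 (show ∀ᵐ x ∂S.memoryMeasure, x ∈ s from hs)] with x hx hxT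
  exact hx (Icc_subset_memoryInterval hT (Ioc_subset_Icc_self hxT))

theorem integrableOn_of_integrable_memory {f : ℝ → E} (hf : Integrable f S.memoryMeasure) {T : ℝ}
    (hT : T ∈ S.memoryInterval) : IntegrableOn f (Ioc 0 T) := by
  rcases hT with rfl | hT
  · simp
  have hpos : 0 < S.memoryWeight T := hT.2
  have hint := integrableOn_memory_iff.1 (hf.integrableOn (s := Ioc 0 T))
  refine Integrable.mono' (hint.norm.const_mul (S.memoryWeight T)⁻¹)
    (hf.aestronglyMeasurable.mono_ac (restrict_absolutelyContinuous_memory (Or.inr hT))) ?_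
  filter_upwards [ae_restrict_mem measurableSet_Ioc] with s hs
  rw [norm_smul, Real.norm_of_nonneg (memoryWeight_nonneg hs.1), inv_mul_eq_div,
    le_div_iff₀ hpos, mul_comm]
  exact mul_le_mul_of_nonneg_right (memoryWeight_antitone hs.1 hs.2) (norm_nonneg _)

theorem intervalIntegrable_memory (γ : S.W) {s t : ℝ} (hs : s ∈ S.memoryInterval)
    (ht : t ∈ S.memoryInterval) : IntervalIntegrable γ volume s t := by
  have h : ∀ T ∈ S.memoryInterval, IntervalIntegrable γ volume 0 T := fun T hT => by
    rw [intervalIntegrable_iff_integrableOn_Ioc_of_le (nonneg_of_mem_memoryInterval hT)]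
    exact integrableOn_of_integrable_memory (integrable_memory γ) hT
  exact (h s hs).symm.trans (h t ht)

theorem intervalIntegrable_memoryWeight_mul {g : ℝ → ℝ} {T : ℝ} (hT : 0 ≤ T)
    (hg : IntervalIntegrable g volume 0 T) :
    IntervalIntegrable (fun s => S.memoryWeight s * g s) volume 0 T := by
  rw [intervalIntegrable_iff_integrableOn_Ioc_of_le hT] at hg ⊢
  refine Integrable.bdd_mul (c := S.memoryWeight 0) hg (aestronglyMeasurable_memoryWeight T) ?_
  filter_upwards [ae_restrict_mem measurableSet_Ioc] with s hs
  rw [Real.norm_of_nonneg (memoryWeight_nonneg hs.1)]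
  exact memoryWeight_le hs.1

theorem setIntegral_re_inner_nonneg {Γ γs : ℝ → H1R}
    (hΓ : IsPrimitiveOn S.memoryInterval Γ γs) (hΓ_zero : Γ 0 = 0) {T : ℝ}
    (hT : T ∈ S.memoryInterval) :
    0 ≤ ∫ s in Ioc 0 T, (inner ℂ (Γ s) (γs s)).re ∂S.memoryMeasure := by
  rw [setIntegral_memory _ (nonneg_of_mem_memoryInterval hT)]
  rcases (nonneg_of_mem_memoryInterval hT).eq_or_lt with rfl | hTpos
  · rw [intervalIntegral.integral_same]
  have hsq := (hΓ.mono (Icc_subset_memoryInterval hT)).norm_sq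
  have hnonneg := integral_mul_deriv_nonneg hTpos
    ((isPrimitiveOn_memoryWeight (S := S)).mono Ioc_subset_Ioi_self)
    (fun s hs => deriv_memoryWeight_nonpos hs.1) (memoryWeight_nonneg hTpos)
    (fun s hs => memoryWeight_le hs.1) hsq (fun s _ => sq_nonneg _) (by simp [hΓ_zero])
    (intervalIntegrable_memoryWeight_mul hTpos.le (hsq.intervalIntegrable hTpos.le))
  simp only [mul_left_comm _ (2 : ℝ), intervalIntegral.integral_const_mul] at hnonneg
  exact nonneg_of_mul_nonneg_right hnonneg two_pos

variable {U F : S.Energy} {q : ℝ → ℂ} {y : H1R} {z : H1 1 2} {Γ : ℝ → H1R} {γs : S.W}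

theorem IsValue.re_inner_memory_nonneg (h : IsValue U F q y z Γ γs) :
    0 ≤ (inner ℂ U.γ γs).re := by
  have hint : Integrable (fun s => inner ℂ (U.γ s) (γs s)) S.memoryMeasure :=
    L2.integrable_inner _ _
  have hΓ : (fun s => (inner ℂ (U.γ s) (γs s)).re) =ᵐ[S.memoryMeasure]
      fun s => (inner ℂ (Γ s) (γs s)).re := by
    filter_upwards [h.γ_eq] with s hs
    rw [hs]
  rw [L2.inner_def, re_integral_eq_of_ae_eq hint hΓ]
  refine ge_of_tendsto ((aecover_memory S).integral_tendsto_of_countably_generated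
    (hint.re.congr hΓ)) (Eventually.of_forall fun T => ?_)
  exact setIntegral_re_inner_nonneg h.γ_deriv h.γ_zero T.2

theorem integral_inner_memory_const (γ : S.W) (y : H1R) :
    ∫ s, inner ℂ (γ s) y ∂S.memoryMeasure = inner ℂ (∫ s, γ s ∂S.memoryMeasure) y := by
  rw [← inner_conj_symm, ← integral_inner (integrable_memory γ), ← integral_conj]
  simp only [inner_conj_symm]

theorem IsValue.memory_eq (h : IsValue U F q y z Γ γs) :
    ∫ s, inner ℂ (U.γ s) (F.γ s) ∂S.memoryMeasure =
      inner ℂ (∫ s, U.γ s ∂S.memoryMeasure) y - inner ℂ U.γ γs := by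
  have hγs : Integrable (fun s => inner ℂ (U.γ s) (γs s)) S.memoryMeasure :=
    L2.integrable_inner _ _
  have hy : Integrable (fun s => inner ℂ (U.γ s) y) S.memoryMeasure :=
    (integrable_memory U.γ).inner_const y
  rw [← integral_inner_memory_const, L2.inner_def, ← integral_sub hy hγs]
  refine integral_congr_ae ?_
  filter_upwards [h.γ_value] with s hs
  rw [hs, inner_add_right, inner_neg_right, neg_add_eq_sub]

theorem re_inner_zeta (y : H1R) (γ : S.W) : (inner ℂ y (zeta y γ)).re =
    S.c * (1 - S.m) * ‖y‖ ^ 2 + (inner ℂ (∫ s, γ s ∂S.memoryMeasure) y).re := by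
  have hself : (inner ℂ y y).re = ‖y‖ ^ 2 := inner_self_eq_norm_sq (𝕜 := ℂ) y
  rw [zeta_eq_integral, inner_add_right, inner_smul_right, Complex.add_re, Complex.re_ofReal_mul,
    hself]
  exact congrArg _ (inner_re_symm (𝕜 := ℂ) _ _)

theorem IsValue.re_inner_eq (h : IsValue U F q y z Γ γs) :
    (inner ℂ U F).re = -(S.c * (1 - S.m) * ‖y‖ ^ 2) - (inner ℂ U.γ γs).re := by
  have hflux : (inner ℂ (F.u.fn 1) (q 1)).re = inner ℝ (F.u.fn 1) (q 1) := by
    rw [Complex.inner, RCLike.inner_apply, mul_comm]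
  rw [energy_inner, ← add_assoc, Complex.add_re, h.re_wave_eq, h.heat_eq, h.memory_eq,
    Complex.add_re, Complex.sub_re, Complex.sub_re, Complex.neg_re, re_inner_zeta, hflux]
  ring

theorem IsValue.dissipative (h : IsValue U F q y z Γ γs) : (inner ℂ U F).re ≤ 0 := by
  have hy : 0 ≤ S.c * (1 - S.m) * ‖y‖ ^ 2 :=
    mul_nonneg (mul_nonneg S.c_pos.le (sub_nonneg.2 S.m_mem.2)) (sq_nonneg _)
  rw [h.re_inner_eq]
  linarith [h.re_inner_memory_nonneg]

end Memory

end TransmissionData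

/-! ### The memory variable in the resolvent equation -/

theorem isPrimitiveOn_exp (I : Set ℝ) (r : ℝ) :
    IsPrimitiveOn I (fun s => Real.exp (r * s)) (fun s => r * Real.exp (r * s)) := by
  intro x _ y _
  have hcont : Continuous fun s => r * Real.exp (r * s) := by fun_prop
  refine ⟨hcont.intervalIntegrable _ _, ?_⟩
  rw [intervalIntegral.integral_eq_sub_of_hasDerivAt (f := fun s => Real.exp (r * s))
    (fun s _ => ?_) (hcont.intervalIntegrable _ _)]
  simpa only [id_eq, mul_one, mul_comm r (Real.exp _)] using ((hasDerivAt_id s).const_mul r).exp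

theorem re_inner_sub_smul_le {E : Type*} [NormedAddCommGroup E] [InnerProductSpace ℂ E] {l : ℝ}
    (hl : 0 < l) (x f : E) :
    (inner ℂ x (f - l • x)).re ≤ (2 * l)⁻¹ * ‖f‖ ^ 2 - l / 2 * ‖x‖ ^ 2 := by
  have hself : (inner ℂ x x).re = ‖x‖ ^ 2 := inner_self_eq_norm_sq (𝕜 := ℂ) x
  have hxf : (inner ℂ x f).re ≤ ‖x‖ * ‖f‖ := re_inner_le_norm (𝕜 := ℂ) x f
  have hsquare : (2 * l)⁻¹ * ‖f‖ ^ 2 + l / 2 * ‖x‖ ^ 2 - ‖x‖ * ‖f‖ =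
      (2 * l)⁻¹ * (‖f‖ - l * ‖x‖) ^ 2 := by
    field_simp
    ring
  have hnonneg : 0 ≤ (2 * l)⁻¹ * (‖f‖ - l * ‖x‖) ^ 2 := by positivity
  rw [inner_sub_right, ← Complex.coe_smul, inner_smul_right, Complex.sub_re,
    Complex.re_ofReal_mul, hself]
  linarith

/-- The solution of `p' + l p = 1`, `p 0 = 0`. -/
noncomputable def unitResponse (l s : ℝ) : ℝ := l⁻¹ * (1 - Real.exp (-l * s))

theorem unitResponse_zero (l : ℝ) : unitResponse l 0 = 0 := by simp [unitResponse]

theorem continuous_unitResponse (l : ℝ) : Continuous (unitResponse l) := by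
  unfold unitResponse
  fun_prop

theorem unitResponse_pos {l s : ℝ} (hl : 0 < l) (hs : 0 < s) : 0 < unitResponse l s :=
  mul_pos (inv_pos.2 hl)
    (sub_pos.2 (Real.exp_lt_one_iff.2 (mul_neg_of_neg_of_pos (neg_neg_of_pos hl) hs)))

theorem unitResponse_le {l : ℝ} (hl : 0 < l) (s : ℝ) : unitResponse l s ≤ l⁻¹ :=
  mul_le_of_le_one_right (inv_nonneg.2 hl.le) (sub_le_self _ (Real.exp_pos _).le)

theorem isPrimitiveOn_unitResponse_smul {l : ℝ} (hl : l ≠ 0) (I : Set ℝ) (y : H1R) :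
    IsPrimitiveOn I (fun s => unitResponse l s • y) (fun s => y - l • (unitResponse l s • y)) := by
  intro x hx z hz
  obtain ⟨hint, heq⟩ := isPrimitiveOn_exp I (-l) x hx z hz
  have hderiv : ∀ s, y - l • (unitResponse l s • y) =
      (-l⁻¹ * (-l * Real.exp (-l * s))) • y := fun s => by
    rw [smul_smul, unitResponse, mul_inv_cancel_left₀ hl, sub_smul, one_smul, sub_sub_cancel,
      neg_mul, neg_mul, neg_mul, mul_neg, neg_neg, inv_mul_cancel_left₀ hl]
  simp_rw [hderiv]
  have hint := hint.const_mul (-l⁻¹)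
  refine ⟨⟨hint.1.smul_const y, hint.2.smul_const y⟩, ?_⟩
  rw [intervalIntegral.integral_smul_const, intervalIntegral.integral_const_mul, ← heq, ← sub_smul]
  congr 1
  simp only [unitResponse]
  ring

namespace TransmissionData

variable {S : TransmissionData}

section MemoryResolvent

theorem exists_memory_primitive (f : S.W) (l : ℝ) :
    ∃ Φ : ℝ → H1R, Φ 0 = 0 ∧ IsPrimitiveOn S.memoryInterval Φ (fun s => f s - l • Φ s) := by
  have hint : ∀ x ∈ S.memoryInterval, ∀ y ∈ S.memoryInterval,
      IntervalIntegrable (fun t => Real.exp (l * t) • f t) volume x y := fun x hx y hy =>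
    (intervalIntegrable_memory f hx hy).continuousOn_smul (by fun_prop)
  refine ⟨fun s => Real.exp (-l * s) • (0 + ∫ t in 0..s, Real.exp (l * t) • f t), by simp, ?_⟩
  refine ((isPrimitiveOn_exp S.memoryInterval (-l)).bilin (B := ContinuousLinearMap.lsmul ℝ ℝ)
    (isPrimitiveOn_integral hint zero_mem_memoryInterval 0)).congr (fun _ _ => rfl)
    (Eventually.of_forall fun s _ => ?_)
  have hexp : Real.exp (-l * s) * Real.exp (l * s) = 1 := by
    rw [← Real.exp_add, neg_mul, neg_add_cancel, Real.exp_zero]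
  simp only [ContinuousLinearMap.lsmul_apply]
  rw [smul_smul (Real.exp (-l * s)), hexp, one_smul, mul_smul, neg_smul]
  abel

section Primitive

variable {Φ φ : ℝ → H1R} {T : ℝ}

theorem integrableOn_norm_sq_of_isPrimitiveOn (hΦ : IsPrimitiveOn S.memoryInterval Φ φ)
    (hT : T ∈ S.memoryInterval) :
    IntegrableOn (fun s => ‖Φ s‖ ^ 2) (Ioc 0 T) S.memoryMeasure :=
  ((hΦ.mono (Icc_subset_memoryInterval hT)).continuousOn_Icc.norm.pow 2).integrableOn_Icc.mono_set
    Ioc_subset_Icc_self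

theorem integrableOn_re_inner_of_isPrimitiveOn (hΦ : IsPrimitiveOn S.memoryInterval Φ φ)
    (hT : T ∈ S.memoryInterval) :
    IntegrableOn (fun s => (inner ℂ (Φ s) (φ s)).re) (Ioc 0 T) S.memoryMeasure := by
  have hT0 := nonneg_of_mem_memoryInterval hT
  have hint := ((hΦ.mono (Icc_subset_memoryInterval hT)).norm_sq.intervalIntegrable hT0).const_mul
    2⁻¹
  simp only [inv_mul_cancel_left₀ (two_ne_zero (α := ℝ))] at hint
  rw [integrableOn_memory_iff, ← intervalIntegrable_iff_integrableOn_Ioc_of_le hT0]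
  exact intervalIntegrable_memoryWeight_mul hT0 hint

theorem aestronglyMeasurable_of_isPrimitiveOn (hΦ : IsPrimitiveOn S.memoryInterval Φ φ) :
    AEStronglyMeasurable Φ S.memoryMeasure :=
  (aecover_memory S).aestronglyMeasurable fun T =>
    ((hΦ.mono (Icc_subset_memoryInterval T.2)).continuousOn_Icc.mono
      Ioc_subset_Icc_self).aestronglyMeasurable measurableSet_Ioc

end Primitive

theorem integrable_norm_sq_memory (f : S.W) : Integrable (fun s => ‖f s‖ ^ 2) S.memoryMeasure :=
  (memLp_two_iff_integrable_sq_norm (Lp.aestronglyMeasurable f)).1 (Lp.memLp f)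

theorem sq_mul_setIntegral_norm_sq_le {l : ℝ} (hl : 0 < l) (f : S.W) {Φ : ℝ → H1R}
    (hΦ_zero : Φ 0 = 0) (hΦ : IsPrimitiveOn S.memoryInterval Φ (fun s => f s - l • Φ s)) {T : ℝ}
    (hT : T ∈ S.memoryInterval) :
    l ^ 2 * ∫ s in Ioc 0 T, ‖Φ s‖ ^ 2 ∂S.memoryMeasure ≤
      ∫ s in Ioc 0 T, ‖f s‖ ^ 2 ∂S.memoryMeasure := by
  have hf_int := (integrable_norm_sq_memory f).integrableOn (s := Ioc 0 T) |>.const_mul (2 * l)⁻¹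
  have hΦ_int := (integrableOn_norm_sq_of_isPrimitiveOn hΦ hT).const_mul (l / 2)
  have hyoung : 0 ≤ (2 * l)⁻¹ * ∫ s in Ioc 0 T, ‖f s‖ ^ 2 ∂S.memoryMeasure -
      l / 2 * ∫ s in Ioc 0 T, ‖Φ s‖ ^ 2 ∂S.memoryMeasure := by
    rw [← integral_const_mul, ← integral_const_mul, ← integral_sub hf_int hΦ_int]
    exact (setIntegral_re_inner_nonneg hΦ hΦ_zero hT).trans (setIntegral_mono
      (integrableOn_re_inner_of_isPrimitiveOn hΦ hT) (hf_int.sub hΦ_int)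
      fun s => re_inner_sub_smul_le hl _ _)
  rw [inv_mul_eq_div, sub_nonneg, le_div_iff₀ (by positivity)] at hyoung
  linarith

theorem memLp_of_isPrimitiveOn {l : ℝ} (hl : 0 < l) (f : S.W) {Φ : ℝ → H1R} (hΦ_zero : Φ 0 = 0)
    (hΦ : IsPrimitiveOn S.memoryInterval Φ (fun s => f s - l • Φ s)) :
    MemLp Φ 2 S.memoryMeasure := by
  rw [memLp_two_iff_integrable_sq_norm (aestronglyMeasurable_of_isPrimitiveOn hΦ)]
  refine (aecover_memory S).integrable_of_integral_norm_bounded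
    ((l ^ 2)⁻¹ * ∫ s, ‖f s‖ ^ 2 ∂S.memoryMeasure)
    (fun T => integrableOn_norm_sq_of_isPrimitiveOn hΦ T.2) (Eventually.of_forall fun T => ?_)
  simp only [norm_pow, norm_norm]
  rw [inv_mul_eq_div, le_div_iff₀' (by positivity)]
  exact (sq_mul_setIntegral_norm_sq_le hl f hΦ_zero hΦ T.2).trans
    (setIntegral_le_integral (integrable_norm_sq_memory f)
      (Eventually.of_forall fun s => sq_nonneg _))

theorem ae_pos_memory : ∀ᵐ s ∂S.memoryMeasure, 0 < s := by
  refine ae_memory.2 ?_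
  filter_upwards [volume.ae_ne 0] with s hs hsI
  exact lt_of_le_of_ne (nonneg_of_mem_memoryInterval hsI) (Ne.symm hs)

variable {l : ℝ}

theorem unitResponse_nonneg_ae (hl : 0 < l) : 0 ≤ᵐ[S.memoryMeasure] unitResponse l := by
  filter_upwards [ae_pos_memory] with s hs using (unitResponse_pos hl hs).le

theorem memLp_unitResponse (hl : 0 < l) : MemLp (unitResponse l) 2 S.memoryMeasure := by
  refine MemLp.of_bound (continuous_unitResponse l).aestronglyMeasurable l⁻¹ ?_
  filter_upwards [unitResponse_nonneg_ae hl] with s hs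
  exact (Real.norm_of_nonneg hs).trans_le (unitResponse_le hl s)

theorem integrable_unitResponse (hl : 0 < l) : Integrable (unitResponse l) S.memoryMeasure :=
  (memLp_unitResponse hl).integrable one_le_two

variable (S) in
/-- The conductivity `c (1 - m) + c m ∫₀^∞ μ(s) (1 - e^{-ls}) / l ds` of the heat equation that the
third component of the resolvent equation becomes once the memory is eliminated. -/
noncomputable def conductivity (l : ℝ) : ℝ :=
  S.c * (1 - S.m) + ∫ s, unitResponse l s ∂S.memoryMeasure

theorem memoryMeasure_ne_zero (hm : 0 < S.m) : S.memoryMeasure ≠ 0 := by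
  have hnonneg : 0 ≤ᵐ[volume.restrict (Ioi 0)] fun s => S.c * S.m * S.μ s := by
    filter_upwards [ae_restrict_mem measurableSet_Ioi] with s hs
    exact memoryWeight_nonneg (S := S) hs
  rw [← Measure.measure_univ_ne_zero, memoryMeasure, withDensity_apply _ MeasurableSet.univ,
    Measure.restrict_univ, ← ofReal_integral_eq_lintegral_ofReal S.integrable_μ hnonneg,
    integral_const_mul]
  exact (ENNReal.ofReal_pos.2 (mul_pos (mul_pos S.c_pos hm) S.μ_integral_pos)).ne'

theorem integral_unitResponse_pos (hl : 0 < l) (hm : 0 < S.m) :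
    0 < ∫ s, unitResponse l s ∂S.memoryMeasure := by
  have : NeZero S.memoryMeasure := ⟨memoryMeasure_ne_zero hm⟩
  refine lt_of_le_of_ne (integral_nonneg_of_ae (unitResponse_nonneg_ae hl)) fun hzero => ?_
  have hae := (integral_eq_zero_iff_of_nonneg_ae (unitResponse_nonneg_ae hl)
    (integrable_unitResponse hl)).1 hzero.symm
  obtain ⟨s, hs, hspos⟩ := (hae.and ae_pos_memory).exists
  exact (unitResponse_pos hl hspos).ne' hs

theorem conductivity_pos (hl : 0 < l) : 0 < S.conductivity l := by
  rcases S.m_mem.1.eq_or_lt with hm | hm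
  · exact add_pos_of_pos_of_nonneg (by simp [← hm, S.c_pos])
      (integral_nonneg_of_ae (unitResponse_nonneg_ae hl))
  · exact add_pos_of_nonneg_of_pos (mul_nonneg S.c_pos.le (sub_nonneg.2 S.m_mem.2))
      (integral_unitResponse_pos hl hm)

theorem memLp_unitResponse_smul (hl : 0 < l) (y : H1R) :
    MemLp (fun s => unitResponse l s • y) 2 S.memoryMeasure := by
  refine MemLp.of_le_mul (memLp_unitResponse hl) (c := ‖y‖)
    ((continuous_unitResponse l).smul continuous_const).aestronglyMeasurable
    (Eventually.of_forall fun s => ?_)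
  rw [norm_smul, mul_comm]

theorem zeta_eq_conductivity_smul_add (hl : 0 < l) {Φ : ℝ → H1R} (hΦ : Integrable Φ S.memoryMeasure)
    {γ : S.W} {y : H1R} (hγ : γ =ᵐ[S.memoryMeasure] fun s => Φ s + unitResponse l s • y) :
    zeta y γ = (S.conductivity l : ℂ) • y + ∫ s, Φ s ∂S.memoryMeasure := by
  rw [zeta_eq_integral, integral_congr_ae hγ,
    integral_add hΦ ((memLp_unitResponse_smul hl y).integrable one_le_two),
    integral_smul_const, conductivity, Complex.ofReal_add, add_smul,
    Complex.coe_smul (∫ s, unitResponse l s ∂S.memoryMeasure)]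
  abel

theorem exists_memory_solution (hl : 0 < l) (f : S.W) :
    ∃ φ : H1R, ∀ y : H1R, ∃ (γ γs : S.W) (Γ : ℝ → H1R), γ =ᵐ[S.memoryMeasure] Γ ∧ Γ 0 = 0 ∧
      IsPrimitiveOn S.memoryInterval Γ γs ∧
      ((l : ℂ) • γ - f : S.W) =ᵐ[S.memoryMeasure] (fun s => -γs s + y) ∧
      zeta y γ = (S.conductivity l : ℂ) • y + φ := by
  obtain ⟨Φ, hΦ_zero, hΦ⟩ := exists_memory_primitive f l
  have hΦ_mem := memLp_of_isPrimitiveOn hl f hΦ_zero hΦ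
  refine ⟨∫ s, Φ s ∂S.memoryMeasure, fun y => ?_⟩
  have hΓ_mem := hΦ_mem.add (memLp_unitResponse_smul hl y)
  have hy_mem : MemLp (fun _ : ℝ => y) 2 S.memoryMeasure := memLp_const y
  set γ : S.W := hΓ_mem.toLp
  have hγ : γ =ᵐ[S.memoryMeasure] fun s => Φ s + unitResponse l s • y := hΓ_mem.coeFn_toLp
  set γs : S.W := hy_mem.toLp - ((l : ℂ) • γ - f) with hγs_def
  have hγs : γs =ᵐ[S.memoryMeasure] fun s => y - ((l : ℂ) • γ - f : S.W) s := by
    filter_upwards [Lp.coeFn_sub hy_mem.toLp ((l : ℂ) • γ - f), hy_mem.coeFn_toLp] with s hsub hs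
    rw [hγs_def, hsub, Pi.sub_apply, hs]
  refine ⟨γ, γs, fun s => Φ s + unitResponse l s • y, hγ, ?_, ?_, ?_,
    zeta_eq_conductivity_smul_add hl (hΦ_mem.integrable one_le_two) hγ⟩
  · simp only [hΦ_zero, unitResponse_zero, zero_smul, add_zero]
  · refine (hΦ.add (isPrimitiveOn_unitResponse_smul hl.ne' S.memoryInterval y)).congr
      (fun _ _ => rfl) ?_
    have hγs_eq : γs =ᵐ[S.memoryMeasure]
        fun s => y - (l • (Φ s + unitResponse l s • y) - f s) := by
      filter_upwards [hγs, Lp.coeFn_sub ((l : ℂ) • γ) f, Lp.coeFn_smul (l : ℂ) γ, hγ]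
        with s hs hsub hsmul hγ_s
      rw [hs, hsub, Pi.sub_apply, hsmul, Pi.smul_apply, hγ_s, Complex.coe_smul]
    filter_upwards [ae_memory.1 hγs_eq] with s hs hsI
    rw [hs hsI, Pi.add_apply, smul_add]
    abel
  · filter_upwards [hγs] with s hs
    rw [hs]
    abel

end MemoryResolvent

end TransmissionData

/-! ### Weak solutions of the resolvent equation -/

theorem H1R.exists_fn_one_eq_one : ∃ e : H1R, e.fn 1 = 1 := by
  have hconst : MemLp (fun _ : ℝ => (-1 : ℂ)) 2 (volume.restrict (Ioo (1 : ℝ) 2)) := memLp_const _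
  obtain ⟨e, he⟩ := H1R.dx_surjective hconst.toLp
  refine ⟨e, ?_⟩
  rw [e.fn_eq_integral (by norm_num), he, intervalIntegral.integral_of_le one_le_two,
    integral_Ioc_eq_integral_Ioo, integral_congr_ae hconst.coeFn_toLp]
  norm_num

namespace TransmissionData

variable {S : TransmissionData}

section WeakSolutions

/-- The weak form, with test pairs `(w, v)` such that `w(1) = v(1)`, of the transmission problem
`(η u')' = g / σ` on `(0, 1)`, `ζ'' = f` on `(1, 2)`, `η(1) u'(1) = ζ'(1)`. -/
def IsWeakSolution (u : S.H1σL) (g : S.L2σ) (f : L2 1 2) (ζ : H1R) : Prop :=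
  ∀ (w : S.H1σL) (v : H1R), w.fn 1 = v.fn 1 →
    inner ℂ w u + inner ℂ (H1σL.toL2σ w) g + inner ℂ (H1R.toL2 v) f + inner ℂ v ζ = 0

variable (S) in
/-- The inner product space in which the weak form of the resolvent equation becomes an
orthogonality relation. -/
abbrev FormSpace : Type := WithLp 2 (S.H1σL × WithLp 2 (S.L2σ × WithLp 2 (L2 1 2 × H1R)))

/-- The embedding `(u, y) ↦ (u, l u, l y, r y)`, which turns the sesquilinear form of the resolvent
equation into an inner product. -/
noncomputable def formMap (l r : ℂ) : S.H1σL × H1R →ₗ[ℂ] S.FormSpace where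
  toFun p := WithLp.toLp 2 (p.1, WithLp.toLp 2 (l • H1σL.toL2σ p.1,
    WithLp.toLp 2 (l • H1R.toL2 p.2, r • p.2)))
  map_add' p p' := by
    rw [Prod.fst_add, Prod.snd_add, map_add, map_add, smul_add, smul_add, smul_add]
    rfl
  map_smul' c p := by
    rw [Prod.smul_fst, Prod.smul_snd, map_smul, map_smul, smul_comm l, smul_comm l, smul_comm r]
    rfl

variable (S) in
/-- The pairs `(u, y)` with `u(1) = y(1)`, embedded by `formMap`. -/
noncomputable def formDomain (l r : ℂ) : Submodule ℂ S.FormSpace :=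
  (LinearMap.eqLocus (H1σL.trace.toLinearMap ∘ₗ LinearMap.fst ℂ S.H1σL H1R)
    (H1R.trace.toLinearMap ∘ₗ LinearMap.snd ℂ S.H1σL H1R)).map (formMap l r)

theorem mem_formDomain {l r : ℂ} {p : S.FormSpace} : p ∈ S.formDomain l r ↔
    ∃ (u : S.H1σL) (y : H1R), u.fn 1 = y.fn 1 ∧ formMap l r (u, y) = p := by
  rw [formDomain, Submodule.mem_map, Prod.exists]
  rfl

theorem tendsto_formMap {l r : ℂ} {u : ℕ → S.H1σL} {a : S.H1σL} {y : ℕ → H1R} {b : H1R}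
    (hu : Tendsto u atTop (𝓝 a))
    (hw : Tendsto (fun n => H1σL.toL2σ (u n)) atTop (𝓝 (H1σL.toL2σ a)))
    (hy : Tendsto y atTop (𝓝 b)) :
    Tendsto (fun n => formMap l r (u n, y n)) atTop (𝓝 (formMap l r (a, b))) := by
  have hyL2 : Tendsto (fun n => l • H1R.toL2 (y n)) atTop (𝓝 (l • H1R.toL2 b)) :=
    ((H1R.toL2.continuous.tendsto b).comp hy).const_smul l
  exact ((WithLp.prod_continuous_toLp 2 _ _).tendsto _).comp (hu.prodMk_nhds
    (((WithLp.prod_continuous_toLp 2 _ _).tendsto _).comp ((hw.const_smul l).prodMk_nhds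
      (((WithLp.prod_continuous_toLp 2 _ _).tendsto _).comp
        (hyL2.prodMk_nhds (hy.const_smul r))))))

theorem cauchySeq_of_cauchySeq_formMap {l r : ℂ} (hl : l ≠ 0) (hr : r ≠ 0) {u : ℕ → S.H1σL}
    {y : ℕ → H1R} (h : CauchySeq fun n => formMap l r (u n, y n)) :
    CauchySeq u ∧ CauchySeq (fun n => H1σL.toL2σ (u n)) ∧ CauchySeq y := by
  have hu : CauchySeq u :=
    (WithLp.fstL 2 ℂ S.H1σL (WithLp 2 (S.L2σ × WithLp 2
      (L2 1 2 × H1R)))).uniformContinuous.comp_cauchySeq h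
  have hvel : CauchySeq fun n => WithLp.toLp 2 (l • H1σL.toL2σ (u n),
      WithLp.toLp 2 (l • H1R.toL2 (y n), r • y n)) :=
    (WithLp.sndL 2 ℂ S.H1σL (WithLp 2 (S.L2σ × WithLp 2
      (L2 1 2 × H1R)))).uniformContinuous.comp_cauchySeq h
  have hw : CauchySeq fun n => l • H1σL.toL2σ (u n) :=
    (WithLp.fstL 2 ℂ S.L2σ (WithLp 2 (L2 1 2 × H1R))).uniformContinuous.comp_cauchySeq hvel
  have hheat : CauchySeq fun n => WithLp.toLp 2 (l • H1R.toL2 (y n), r • y n) :=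
    (WithLp.sndL 2 ℂ S.L2σ (WithLp 2 (L2 1 2 × H1R))).uniformContinuous.comp_cauchySeq hvel
  have hy : CauchySeq fun n => r • y n :=
    (WithLp.sndL 2 ℂ (L2 1 2) H1R).uniformContinuous.comp_cauchySeq hheat
  refine ⟨hu, ?_, ?_⟩
  · simpa only [Function.comp_def, inv_smul_smul₀ hl] using
      (uniformContinuous_const_smul l⁻¹).comp_cauchySeq hw
  · simpa only [Function.comp_def, inv_smul_smul₀ hr] using
      (uniformContinuous_const_smul r⁻¹).comp_cauchySeq hy

theorem completeSpace_formDomain {l r : ℂ} (hl : l ≠ 0) (hr : r ≠ 0) :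
    CompleteSpace (S.formDomain l r) := by
  refine Metric.complete_of_cauchySeq_tendsto fun p hp => ?_
  choose u y huy hp_eq using fun n => mem_formDomain.1 (p n).2
  have hval : CauchySeq fun n => (p n : S.FormSpace) :=
    uniformContinuous_subtype_val.comp_cauchySeq hp
  simp only [← hp_eq] at hval
  obtain ⟨hu, hw, hy⟩ := cauchySeq_of_cauchySeq_formMap hl hr hval
  obtain ⟨w, hw⟩ := cauchySeq_tendsto_of_complete hw
  obtain ⟨b, hb⟩ := cauchySeq_tendsto_of_complete hy
  obtain ⟨a, ha, rfl⟩ := H1σL.exists_tendsto hu hw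
  have htrace : a.fn 1 = b.fn 1 := by
    refine tendsto_nhds_unique (((H1σL.trace (S := S)).continuous.tendsto a).comp ha)
      (((H1R.trace.continuous.tendsto b).comp hb).congr fun n => ?_)
    exact (huy n).symm
  refine ⟨⟨_, mem_formDomain.2 ⟨a, b, htrace, rfl⟩⟩, ?_⟩
  rw [tendsto_subtype_rng]
  simpa only [hp_eq] using tendsto_formMap (l := l) (r := r) ha hw hb

theorem exists_inner_formMap_sub_eq_zero {l r : ℂ} (hl : l ≠ 0) (hr : r ≠ 0) (d : S.FormSpace) :
    ∃ (u : S.H1σL) (y : H1R), u.fn 1 = y.fn 1 ∧ ∀ (w : S.H1σL) (v : H1R), w.fn 1 = v.fn 1 →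
      inner ℂ (formMap l r (w, v)) (d - formMap l r (u, y)) = 0 := by
  have := completeSpace_formDomain (S := S) hl hr
  obtain ⟨u, y, huy, hproj⟩ := mem_formDomain.1
    ((S.formDomain l r).starProjection_apply_mem d)
  refine ⟨u, y, huy, fun w v hwv => ?_⟩
  rw [hproj]
  exact (Submodule.mem_orthogonal _ _).1 ((S.formDomain l r).sub_starProjection_mem_orthogonal d) _
    (mem_formDomain.2 ⟨w, v, hwv, rfl⟩)

theorem inner_formMap_sub {l r : ℝ} (hl : l ≠ 0) (hr : r ≠ 0) (g : S.L2σ) (f : L2 1 2) (φ : H1R)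
    (u w : S.H1σL) (x v : H1R) :
    inner ℂ (formMap (l : ℂ) r (w, v)) (WithLp.toLp 2 (0, WithLp.toLp 2 ((l : ℂ)⁻¹ • g,
      WithLp.toLp 2 ((l : ℂ)⁻¹ • f, -((r : ℂ)⁻¹ • φ)))) - formMap (l : ℂ) r (u, x)) =
    -(inner ℂ w u + inner ℂ (H1σL.toL2σ w) ((l ^ 2 : ℂ) • H1σL.toL2σ u - g) +
      inner ℂ (H1R.toL2 v) ((l ^ 2 : ℂ) • H1R.toL2 x - f) +
      inner ℂ v ((r ^ 2 : ℂ) • x + φ)) := by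
  have hlc : (l : ℂ) ≠ 0 := Complex.ofReal_ne_zero.2 hl
  have hrc : (r : ℂ) ≠ 0 := Complex.ofReal_ne_zero.2 hr
  change inner ℂ w (0 - u) + (inner ℂ ((l : ℂ) • H1σL.toL2σ w)
      ((l : ℂ)⁻¹ • g - (l : ℂ) • H1σL.toL2σ u) + (inner ℂ ((l : ℂ) • H1R.toL2 v)
      ((l : ℂ)⁻¹ • f - (l : ℂ) • H1R.toL2 x) +
      inner ℂ ((r : ℂ) • v) (-((r : ℂ)⁻¹ • φ) - (r : ℂ) • x))) = _
  simp only [inner_sub_right, inner_smul_left, inner_smul_right, inner_neg_right, inner_add_right,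
    inner_zero_right, Complex.conj_ofReal]
  field_simp
  ring

theorem exists_weak_solution_of_fn_one_eq {l k : ℝ} (hl : 0 < l) (hk : 0 < k) (g : S.L2σ)
    (f : L2 1 2) (φ : H1R) :
    ∃ (u : S.H1σL) (x : H1R), u.fn 1 = x.fn 1 ∧
      IsWeakSolution u ((l ^ 2 : ℂ) • H1σL.toL2σ u - g) ((l ^ 2 : ℂ) • H1R.toL2 x - f)
        ((k : ℂ) • x + φ) := by
  have hsqrt : √k ≠ 0 := (Real.sqrt_pos.2 hk).ne'
  obtain ⟨u, x, hux, horth⟩ := exists_inner_formMap_sub_eq_zero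
    (Complex.ofReal_ne_zero.2 hl.ne') (Complex.ofReal_ne_zero.2 hsqrt) (WithLp.toLp 2 ((0 : S.H1σL),
      WithLp.toLp 2 ((l : ℂ)⁻¹ • g, WithLp.toLp 2 ((l : ℂ)⁻¹ • f, -((√k : ℂ)⁻¹ • φ)))))
  refine ⟨u, x, hux, fun w v hwv => ?_⟩
  have hinner := horth w v hwv
  rwa [inner_formMap_sub hl.ne' hsqrt, neg_eq_zero, ← Complex.ofReal_pow √k, Real.sq_sqrt hk.le]
    at hinner

theorem exists_weak_solution {l k : ℝ} (hl : 0 < l) (hk : 0 < k) (g : S.L2σ) (f : L2 1 2)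
    (φ : H1R) (t : ℂ) :
    ∃ (u : S.H1σL) (y : H1R), (l : ℂ) * u.fn 1 - t = y.fn 1 ∧
      IsWeakSolution u ((l ^ 2 : ℂ) • H1σL.toL2σ u - g) ((l : ℂ) • H1R.toL2 y - f)
        ((k : ℂ) • y + φ) := by
  obtain ⟨e, he⟩ := H1R.exists_fn_one_eq_one
  set y₀ : H1R := (-t) • e with hy₀_def
  have hy₀ : y₀.fn 1 = -t := by
    rw [hy₀_def, H1R.fn_smul, Pi.smul_apply, he, smul_eq_mul, mul_one]
  obtain ⟨u, x, hux, hweak⟩ := exists_weak_solution_of_fn_one_eq hl (mul_pos hl hk) g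
    (f - (l : ℂ) • H1R.toL2 y₀) (φ + (k : ℂ) • y₀)
  refine ⟨u, (l : ℂ) • x + y₀, ?_, ?_⟩
  · rw [H1R.fn_add, H1R.fn_smul, Pi.add_apply, Pi.smul_apply, hy₀, hux, smul_eq_mul, sub_eq_add_neg]
  · convert hweak using 1
    · rw [map_add, map_smul, smul_add, smul_smul, sq]
      abel
    · rw [smul_add, smul_smul, Complex.ofReal_mul, mul_comm (l : ℂ)]
      abel

end WeakSolutions

end TransmissionData

/-! ### Regularity of weak solutions -/

theorem H1.exists_deriv_eq {p q : ℝ} (hpq : p ≤ q) (g : L2 p q) (e : ℂ) :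
    ∃ z : H1 p q, z.1.2 = g ∧ zeroExt z.1.1 p = e := by
  have hp : p ∈ Icc p q := left_mem_Icc.2 hpq
  have hprim := isPrimitiveOn_integral (fun x hx y hy => intervalIntegrable_L2 g hx hy) hp e
  let w : C(Icc p q, ℂ) := ⟨fun x => e + ∫ t in p..x, g t, hprim.continuousOn_Icc.domRestrict⟩
  have hw : ∀ x ∈ Icc p q, zeroExt w x = e + ∫ t in p..x, g t := fun x hx => zeroExt_apply w hx
  refine ⟨⟨(w, g), ?_⟩, rfl, ?_⟩
  · exact hprim.congr (fun x hx => (hw x hx).symm) (Eventually.of_forall fun _ _ => rfl)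
  · simp only [hw p hp, intervalIntegral.integral_same, add_zero]

theorem H1.memLp_zeroExt {p q : ℝ} (z : H1 p q) :
    MemLp (zeroExt z.1.1) 2 (volume.restrict (Ioo p q)) :=
  memLp_of_continuousOn (IsPrimitiveOn.continuousOn_Icc z.2) 2

theorem H1R.inner_toL2_deriv (v : H1R) (z : H1 1 2) :
    inner ℂ (H1R.toL2 v) z.1.2 =
      - inner ℂ (v.fn 1) (zeroExt z.1.1 1) - inner ℂ v.dx (H1.memLp_zeroExt z).toLp := by
  rw [L2.inner_def, L2.inner_def]
  refine Eq.trans (integral_congr_ae ?_) ((v.integral_inner_eq z).trans ?_)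
  · filter_upwards [H1R.coeFn_toL2 v] with x hx
    rw [hx]
  · congr 1
    refine integral_congr_ae ?_
    filter_upwards [(H1.memLp_zeroExt z).coeFn_toLp] with x hx
    rw [hx]

theorem setIntegral_Ioo_eq_of_ae_eq_zero {E : Type*} [NormedAddCommGroup E] [NormedSpace ℝ E]
    {f : ℝ → E} {p q r : ℝ} (hpr : p ≤ r) (hrq : r ≤ q)
    (hf : ∀ᵐ x ∂(volume.restrict (Ioo p q)), x ≤ r → f x = 0) :
    ∫ x in Ioo p q, f x = ∫ x in r..q, f x := by
  rw [intervalIntegral.integral_of_le hrq, integral_Ioc_eq_integral_Ioo]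
  refine setIntegral_eq_of_subset_of_ae_sdiff_eq_zero measurableSet_Ioo.nullMeasurableSet
    (Ioo_subset_Ioo_left hpr) ?_
  filter_upwards [(ae_restrict_iff' measurableSet_Ioo).1 hf] with x hx hxd
  exact hx hxd.1 (not_lt.1 fun hrx => hxd.2 ⟨hrx, hxd.1.2⟩)

theorem indicator_Ioo_eq_zero_of_le {E : Type*} [Zero E] (f : ℝ → E) {r q x : ℝ} (hx : x ≤ r) :
    (Ioo r q).indicator f x = 0 :=
  indicator_of_notMem (fun h => (h.1.trans_le hx).false) f

theorem inner_self_eq_sub_of_ae_eq_indicator {p q r : ℝ} (hpr : p ≤ r) (hrq : r ≤ q) {f g : ℝ → ℂ}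
    {ψ : L2 p q} (hψ : ψ =ᵐ[volume.restrict (Ioo p q)] (Ioo r q).indicator fun x => f x - g x)
    (hf : MemLp f 2 (volume.restrict (Ioo r q))) (hg : MemLp g 2 (volume.restrict (Ioo r q))) :
    inner ℂ ψ ψ = (∫ x in r..q, inner ℂ (ψ x) (f x)) - ∫ x in r..q, inner ℂ (ψ x) (g x) := by
  have hsub : Ioo r q ⊆ Ioo p q := Ioo_subset_Ioo_left hpr
  have hint : ∀ {h : ℝ → ℂ}, MemLp h 2 (volume.restrict (Ioo r q)) →
      IntervalIntegrable (fun x => inner ℂ (ψ x) (h x)) volume r q := fun hh =>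
    (intervalIntegrable_iff_integrableOn_Ioo_of_le hrq).2 <| hh.integrable_mul
      ((Lp.memLp ψ).mono_measure (Measure.restrict_mono hsub le_rfl)).star
  rw [L2.inner_def, setIntegral_Ioo_eq_of_ae_eq_zero hpr hrq,
    ← intervalIntegral.integral_sub (hint hf) (hint hg), intervalIntegral.integral_of_le hrq,
    intervalIntegral.integral_of_le hrq, integral_Ioc_eq_integral_Ioo, integral_Ioc_eq_integral_Ioo]
  · refine integral_congr_ae ?_
    filter_upwards [ae_restrict_of_ae_restrict_of_subset hsub hψ,
      ae_restrict_mem measurableSet_Ioo] with x hx hxI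
    rw [← inner_sub_right, hx, indicator_of_mem hxI]
  · filter_upwards [hψ] with x hx hxr
    rw [hx, indicator_Ioo_eq_zero_of_le _ hxr, inner_zero_left]

namespace TransmissionData

variable {S : TransmissionData}

section CutOff

theorem integrableOn_invσ_iff {E : Type*} [NormedAddCommGroup E] [NormedSpace ℝ E] {f : ℝ → E}
    {s : Set ℝ} (hs : MeasurableSet s) (hs_sub : s ⊆ Ioo 0 1) :
    IntegrableOn f s S.invσMeasure ↔ IntegrableOn (fun x => (1 / S.σ x) • f x) s := by
  rw [IntegrableOn, invσMeasure, restrict_withDensity hs, Measure.restrict_restrict hs,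
    inter_eq_self_of_subset_left hs_sub]
  have hle : volume.restrict s ≤ volume.restrict (Ioo 0 1) := Measure.restrict_mono hs_sub le_rfl
  exact integrable_withDensity_ofReal_iff (aemeasurable_inv_σ.mono_measure hle)
    (ae_mono hle inv_σ_nonneg)

theorem isFiniteMeasure_invσ_restrict {ε : ℝ} (hε : 0 < ε) :
    IsFiniteMeasure (S.invσMeasure.restrict (Ioo ε 1)) := by
  have hcont : ContinuousOn (fun x => (1 / S.σ x) • (1 : ℝ)) (Icc ε 1) :=
    (continuousOn_inv_σ.mono (Icc_subset_Ioc hε le_rfl)).smul continuousOn_const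
  have hone : IntegrableOn (fun _ => (1 : ℝ)) (Ioo ε 1) S.invσMeasure :=
    (integrableOn_invσ_iff measurableSet_Ioo (Ioo_subset_Ioo_left hε.le)).2
      (hcont.integrableOn_Icc.mono_set Ioo_subset_Icc_self)
  exact isFiniteMeasure_restrict.2 (((integrableOn_const_iff (by simp)).1 hone).resolve_left
    (enorm_ne_zero.2 one_ne_zero)).ne

theorem memLp_invσ_of_eq_zero {f : ℝ → ℂ} {ε : ℝ} (hε : 0 < ε) (hf : ContinuousOn f (Icc 0 1))
    (hf_zero : ∀ x ∈ Ioo (0 : ℝ) 1, x ≤ ε → f x = 0) : MemLp f 2 S.invσMeasure := by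
  have hcut : (Ioo ε 1).indicator f =ᵐ[S.invσMeasure] f := by
    filter_upwards [ae_invσ.2 (ae_restrict_mem measurableSet_Ioo)] with x hx
    refine indicator_apply_eq_self.2 fun hxε => hf_zero x hx (not_lt.1 fun h => hxε ⟨h, hx.2⟩)
  have := isFiniteMeasure_invσ_restrict (S := S) hε
  obtain ⟨C, hC⟩ := isCompact_Icc.exists_bound_of_continuousOn hf
  have hsub : Ioo ε 1 ⊆ Icc 0 1 := (Ioo_subset_Ioo_left hε.le).trans Ioo_subset_Icc_self
  refine (memLp_congr_ae hcut).1 ((memLp_indicator_iff_restrict measurableSet_Ioo).2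
    (MemLp.of_bound ((hf.mono hsub).aestronglyMeasurable measurableSet_Ioo) C ?_))
  filter_upwards [ae_restrict_mem measurableSet_Ioo] with x hx using hC x (hsub hx)

namespace H1σL

theorem exists_dx_eq_of_ae_eq_zero {ε : ℝ} (hε : 0 < ε) (g : L2 0 1)
    (hg : ∀ᵐ x ∂(volume.restrict (Ioo (0 : ℝ) 1)), x ≤ ε → g x = 0) :
    ∃ u : S.H1σL, u.dx = g ∧ ∀ x ∈ Icc (0 : ℝ) 1, x ≤ ε → u.fn x = 0 := by
  have hzero : ∀ x ∈ Icc (0 : ℝ) 1, x ≤ ε → ∫ t in (0 : ℝ)..x, g t = 0 := by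
    refine fun x hx hxε => intervalIntegral.integral_zero_ae ?_
    filter_upwards [ae_mem_Icc_of_ae_restrict hg] with t ht htI
    rw [uIoc_of_le hx.1] at htI
    exact ht ⟨htI.1.le, htI.2.trans hx.2⟩ (htI.2.trans hxε)
  have hcont : ContinuousOn (fun x => ∫ t in (0 : ℝ)..x, g t) (Icc 0 1) := by
    simpa only [zero_add] using
      (isPrimitiveOn_integral (fun x hx y hy => intervalIntegrable_L2 g hx hy)
        (left_mem_Icc.2 (zero_le_one (α := ℝ))) 0).continuousOn_Icc
  obtain ⟨u, hu, hux⟩ := exists_dx_eq (S := S) g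
    (memLp_invσ_of_eq_zero hε hcont fun x hx => hzero x (Ioo_subset_Icc_self hx))
  exact ⟨u, hu, fun x hx hxε => (hux x hx).trans (hzero x hx hxε)⟩

variable (S) in
theorem exists_fn_one_eq_one : ∃ u : S.H1σL, u.fn 1 = 1 := by
  have hcut : MemLp ((Ioo (1 / 2 : ℝ) 1).indicator fun _ => (2 : ℂ)) 2
      (volume.restrict (Ioo (0 : ℝ) 1)) := (memLp_const 2).indicator measurableSet_Ioo
  obtain ⟨u, hu, -⟩ := exists_dx_eq_of_ae_eq_zero (S := S) one_half_pos hcut.toLp (by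
    filter_upwards [hcut.coeFn_toLp] with x hx hxε
    rw [hx, indicator_Ioo_eq_zero_of_le _ hxε])
  refine ⟨u, ?_⟩
  rw [fn_eq_integral u (by norm_num), hu, intervalIntegral.integral_of_le zero_le_one,
    integral_Ioc_eq_integral_Ioo, integral_congr_ae hcut.coeFn_toLp,
    integral_indicator measurableSet_Ioo, Measure.restrict_restrict measurableSet_Ioo,
    inter_eq_self_of_subset_left (Ioo_subset_Ioo_left (by norm_num))]
  simp only [integral_const, measureReal_restrict_apply_univ, Real.volume_real_Ioo]
  norm_num

theorem inner_eq_of_ae_eq_zero {w : S.H1σL} {ε : ℝ} (hε : ε ∈ Ioc (0 : ℝ) 1)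
    (hw : ∀ᵐ x ∂(volume.restrict (Ioo (0 : ℝ) 1)), x ≤ ε → w.dx x = 0) (u : S.H1σL) :
    inner ℂ w u = ∫ x in ε..1, inner ℂ (w.dx x) ((S.η x : ℂ) * u.dx x) := by
  rw [inner_eq, ← setIntegral_Ioo_eq_of_ae_eq_zero hε.1.le hε.2]
  · refine integral_congr_ae (Eventually.of_forall fun x => ?_)
    simp only [RCLike.inner_apply]
    ring
  · filter_upwards [hw] with x hx hxε
    rw [hx hxε, inner_zero_left]

theorem inner_toL2σ_eq_of_eq_zero {w : S.H1σL} {ε : ℝ} (hε : ε ∈ Ioc (0 : ℝ) 1)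
    (hw : ∀ x ∈ Icc (0 : ℝ) 1, x ≤ ε → w.fn x = 0) (g : S.L2σ) :
    inner ℂ (toL2σ w) g = ∫ x in ε..1, inner ℂ (w.fn x) (g x / (S.σ x : ℂ)) := by
  rw [L2.inner_def, integral_invσ, ← setIntegral_Ioo_eq_of_ae_eq_zero hε.1.le hε.2]
  · refine integral_congr_ae ?_
    filter_upwards [ae_invσ.1 (coeFn_toL2σ w)] with x hx
    rw [hx, RCLike.inner_apply, RCLike.inner_apply, Complex.real_smul, Complex.ofReal_div,
      Complex.ofReal_one]
    ring
  · filter_upwards [ae_restrict_mem measurableSet_Ioo] with x hx hxε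
    rw [hw x (Ioo_subset_Icc_self hx) hxε, inner_zero_left]

end H1σL

end CutOff

section Regularity

theorem integrableOn_div_σ (g : S.L2σ) {ε : ℝ} (hε : 0 < ε) :
    IntegrableOn (fun t => g t / (S.σ t : ℂ)) (Ioo ε 1) := by
  have := isFiniteMeasure_invσ_restrict (S := S) hε
  refine IntegrableOn.congr_fun ((integrableOn_invσ_iff measurableSet_Ioo
    (Ioo_subset_Ioo_left hε.le)).1 (((Lp.memLp g).restrict _).integrable one_le_two))
    (fun t _ => ?_) measurableSet_Ioo
  rw [Complex.real_smul, Complex.ofReal_div, Complex.ofReal_one, one_div_mul_eq_div]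

theorem intervalIntegrable_div_σ (g : S.L2σ) {x y : ℝ} (hx : x ∈ Ioc (0 : ℝ) 1)
    (hy : y ∈ Ioc (0 : ℝ) 1) : IntervalIntegrable (fun t => g t / (S.σ t : ℂ)) volume x y := by
  have hone : ∀ ε ∈ Ioc (0 : ℝ) 1,
      IntervalIntegrable (fun t => g t / (S.σ t : ℂ)) volume ε 1 := fun ε hε =>
    (intervalIntegrable_iff_integrableOn_Ioo_of_le hε.2).2 (integrableOn_div_σ g hε.1)
  exact (hone x hx).trans (hone y hy).symm

variable {u : S.H1σL} {g : S.L2σ} {e : ℂ} {q : ℝ → ℂ} {ε : ℝ}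

theorem memLp_flux_sub (u : S.H1σL) (hε : 0 ≤ ε) (hq : ContinuousOn q (Icc ε 1)) :
    MemLp ((Ioo ε 1).indicator fun x => (S.η x : ℂ) * u.dx x - q x) 2
      (volume.restrict (Ioo 0 1)) := by
  have hsub : Ioo ε 1 ⊆ Ioo 0 1 := Ioo_subset_Ioo_left hε
  rw [memLp_indicator_iff_restrict measurableSet_Ioo,
    Measure.restrict_restrict measurableSet_Ioo, inter_eq_self_of_subset_left hsub]
  exact ((memLp_η_mul u.dx).mono_measure (Measure.restrict_mono hsub le_rfl)).sub
    (memLp_of_continuousOn hq 2)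

theorem integral_inner_flux_eq (hweak : ∀ w : S.H1σL,
      inner ℂ w u + inner ℂ (H1σL.toL2σ w) g = inner ℂ (w.fn 1) e)
    (hq : IsPrimitiveOn (Ioc 0 1) q fun x => g x / (S.σ x : ℂ)) (hq_one : q 1 = e)
    (hε : ε ∈ Ioc (0 : ℝ) 1) {w : S.H1σL}
    (hw_dx : ∀ᵐ x ∂(volume.restrict (Ioo (0 : ℝ) 1)), x ≤ ε → w.dx x = 0)
    (hw_fn : ∀ x ∈ Icc (0 : ℝ) 1, x ≤ ε → w.fn x = 0) :
    ∫ x in ε..1, inner ℂ (w.dx x) ((S.η x : ℂ) * u.dx x) = ∫ x in ε..1, inner ℂ (w.dx x) (q x) := by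
  have hparts := (w.isPrimitiveOn.mono (Icc_subset_Icc_left hε.1.le)).integral_bilin_eq_sub
    (B := (isBoundedBilinearMap_inner (𝕜 := ℂ)).toContinuousLinearMap)
    (hq.mono (Icc_subset_Ioc hε.1 le_rfl)) hε.2
  simp only [IsBoundedBilinearMap.toContinuousLinearMap_apply,
    hw_fn ε (Ioc_subset_Icc_self hε) le_rfl, inner_zero_left, sub_zero, hq_one] at hparts
  rw [← H1σL.inner_eq_of_ae_eq_zero hε hw_dx, eq_sub_of_add_eq (hweak w),
    H1σL.inner_toL2σ_eq_of_eq_zero hε hw_fn, hparts, sub_sub_cancel]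

theorem ae_flux_eq_of_lt (hweak : ∀ w : S.H1σL,
      inner ℂ w u + inner ℂ (H1σL.toL2σ w) g = inner ℂ (w.fn 1) e)
    (hq : IsPrimitiveOn (Ioc 0 1) q fun x => g x / (S.σ x : ℂ)) (hq_one : q 1 = e)
    (hε : ε ∈ Ioc (0 : ℝ) 1) :
    ∀ᵐ x ∂(volume.restrict (Ioo (0 : ℝ) 1)), ε < x → q x = (S.η x : ℂ) * u.dx x := by
  have hq_cont : ContinuousOn q (Icc ε 1) :=
    (hq.mono (Icc_subset_Ioc hε.1 le_rfl)).continuousOn_Icc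
  have hsub : Ioo ε 1 ⊆ Ioo 0 1 := Ioo_subset_Ioo_left hε.1.le
  have hψ_mem := memLp_flux_sub u hε.1.le hq_cont
  set ψ : L2 0 1 := hψ_mem.toLp
  have hψ : ψ =ᵐ[volume.restrict (Ioo (0 : ℝ) 1)]
      (Ioo ε 1).indicator fun x => (S.η x : ℂ) * u.dx x - q x := hψ_mem.coeFn_toLp
  have hψ_zero : ∀ᵐ x ∂(volume.restrict (Ioo (0 : ℝ) 1)), x ≤ ε → ψ x = 0 := by
    filter_upwards [hψ] with x hx hxε
    rw [hx, indicator_Ioo_eq_zero_of_le _ hxε]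
  obtain ⟨w, hw, hw_fn⟩ := H1σL.exists_dx_eq_of_ae_eq_zero (S := S) hε.1 ψ hψ_zero
  have hflux := integral_inner_flux_eq hweak hq hq_one hε (by rwa [hw]) hw_fn
  rw [hw] at hflux
  have hψψ : inner ℂ ψ ψ = 0 := by
    rw [inner_self_eq_sub_of_ae_eq_indicator hε.1.le hε.2 hψ
      ((memLp_η_mul u.dx).mono_measure (Measure.restrict_mono hsub le_rfl))
      (memLp_of_continuousOn hq_cont 2), hflux, sub_self]
  filter_upwards [hψ, (Lp.eq_zero_iff_ae_eq_zero).1 (inner_self_eq_zero.1 hψψ),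
    ae_restrict_mem measurableSet_Ioo] with x hx hx_zero hxI hεx
  rw [hx_zero, indicator_of_mem (show x ∈ Ioo ε 1 from ⟨hεx, hxI.2⟩)] at hx
  exact (sub_eq_zero.1 hx.symm).symm

theorem exists_flux_of_weak (hweak : ∀ w : S.H1σL,
      inner ℂ w u + inner ℂ (H1σL.toL2σ w) g = inner ℂ (w.fn 1) e) :
    ∃ q : ℝ → ℂ, q =ᵐ[volume.restrict (Ioo 0 1)] (fun x => (S.η x : ℂ) * u.dx x) ∧
      IsPrimitiveOn (Ioc 0 1) q (fun x => g x / (S.σ x : ℂ)) ∧ q 1 = e := by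
  have hq := isPrimitiveOn_integral (fun x hx y hy => intervalIntegrable_div_σ g hx hy)
    (right_mem_Ioc.2 zero_lt_one) e
  have hq_one : e + ∫ t in (1 : ℝ)..1, g t / (S.σ t : ℂ) = e := by
    rw [intervalIntegral.integral_same, add_zero]
  refine ⟨_, ?_, hq, hq_one⟩
  have hflux := ae_all_iff.2 fun n : ℕ => ae_flux_eq_of_lt hweak hq hq_one
    (ε := 1 / ((n : ℝ) + 1)) ⟨Nat.one_div_pos_of_nat,
      div_le_one_of_le₀ (le_add_of_nonneg_left n.cast_nonneg) (by positivity)⟩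
  filter_upwards [hflux, ae_restrict_mem measurableSet_Ioo] with x hx hxI
  obtain ⟨n, hn⟩ := exists_nat_one_div_lt hxI.1
  exact hx n hn

namespace IsWeakSolution

variable {f : L2 1 2} {ζ : H1R} {z : H1 1 2}

theorem dx_eq_toLp (h : IsWeakSolution u g f ζ) {χ : S.H1σL} (hχ : χ.fn 1 = 1)
    (hz : z.1.2 = f) (hz_one : zeroExt z.1.1 1 = inner ℂ χ u + inner ℂ (H1σL.toL2σ χ) g) :
    ζ.dx = (H1.memLp_zeroExt z).toLp := by
  refine ext_inner_left ℂ fun p => ?_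
  obtain ⟨v, rfl⟩ := H1R.dx_surjective p
  have htest := h (v.fn 1 • χ) v (by
    rw [H1σL.fn_smul, Pi.smul_apply, hχ, smul_eq_mul, mul_one])
  rw [inner_smul_left, map_smul, inner_smul_left, ← mul_add, ← hz_one, ← hz, H1R.inner_toL2_deriv,
    RCLike.inner_apply, H1R.inner_eq] at htest
  linear_combination htest

theorem inner_add_inner_eq (h : IsWeakSolution u g z.1.2 ζ)
    (hζ : ζ.dx = (H1.memLp_zeroExt z).toLp) (w : S.H1σL) :
    inner ℂ w u + inner ℂ (H1σL.toL2σ w) g = inner ℂ (w.fn 1) (zeroExt z.1.1 1) := by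
  obtain ⟨e, he⟩ := H1R.exists_fn_one_eq_one
  have hfn : (w.fn 1 • e).fn 1 = w.fn 1 := by
    rw [H1R.fn_smul, Pi.smul_apply, he, smul_eq_mul, mul_one]
  have htest := h w (w.fn 1 • e) hfn.symm
  rw [H1R.inner_toL2_deriv, hfn, H1R.inner_eq, hζ] at htest
  linear_combination htest

theorem exists_strong_solution (h : IsWeakSolution u g f ζ) :
    ∃ (z : H1 1 2) (q : ℝ → ℂ), f = z.1.2 ∧
      ζ.dx =ᵐ[volume.restrict (Ioo 1 2)] zeroExt z.1.1 ∧
      q =ᵐ[volume.restrict (Ioo 0 1)] (fun x => (S.η x : ℂ) * u.dx x) ∧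
      IsPrimitiveOn (Ioc 0 1) q (fun x => g x / (S.σ x : ℂ)) ∧ q 1 = zeroExt z.1.1 1 := by
  obtain ⟨χ, hχ⟩ := H1σL.exists_fn_one_eq_one S
  obtain ⟨z, rfl, hz_one⟩ := H1.exists_deriv_eq one_le_two f
    (inner ℂ χ u + inner ℂ (H1σL.toL2σ χ) g)
  have hζ := h.dx_eq_toLp hχ rfl hz_one
  obtain ⟨q, hq⟩ := exists_flux_of_weak (h.inner_add_inner_eq hζ)
  exact ⟨z, q, rfl, hζ ▸ (H1.memLp_zeroExt z).coeFn_toLp, hq⟩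

end IsWeakSolution

end Regularity

theorem exists_mem_graph {l : ℝ} (hl : 0 < l) (F : S.Energy) :
    ∃ U : S.Energy, (U, (l : ℂ) • U - F) ∈ S.graph := by
  obtain ⟨φ, hφ⟩ := exists_memory_solution hl F.γ
  obtain ⟨u, y, huy, hweak⟩ := exists_weak_solution hl (conductivity_pos hl)
    (F.v + (l : ℂ) • H1σL.toL2σ F.u) F.y φ (F.u.fn 1)
  obtain ⟨γ, γs, Γ, hγ, hΓ_zero, hΓ, hγs, hζ⟩ := hφ y
  rw [← hζ] at hweak
  obtain ⟨z, q, hz, hζz, hq, hq_deriv, hq_one⟩ := hweak.exists_strong_solution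
  have hv_deriv : (l ^ 2 : ℂ) • H1σL.toL2σ u - (F.v + (l : ℂ) • H1σL.toL2σ F.u) =
      (l : ℂ) • H1σL.toL2σ ((l : ℂ) • u - F.u) - F.v := by
    rw [map_sub, map_smul, smul_sub, smul_smul, sq]
    abel
  rw [hv_deriv] at hq_deriv
  have hv_one : ((l : ℂ) • u - F.u).fn 1 = y.fn 1 := by
    rw [← huy, sub_eq_add_neg, ← neg_one_smul ℂ F.u, H1σL.fn_add, H1σL.fn_smul, H1σL.fn_smul,
      Pi.add_apply, Pi.smul_apply, Pi.smul_apply, smul_eq_mul, neg_one_smul, sub_eq_add_neg]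
  exact ⟨WithLp.toLp 2 (u, WithLp.toLp 2 (H1σL.toL2σ ((l : ℂ) • u - F.u),
    WithLp.toLp 2 (H1R.toL2 y, γ))), q, y, z, Γ, γs,
    { v_eq := H1σL.coeFn_toL2σ ((l : ℂ) • u - F.u)
      flux_eq := hq
      flux_deriv := hq_deriv
      y_eq := H1R.coeFn_toL2 y
      zeta_eq := hζz
      zeta_deriv := hz
      γ_eq := hγ
      γ_zero := hΓ_zero
      γ_deriv := hΓ
      γ_value := hγs
      flux_one := hq_one
      v_one := hv_one }⟩

theorem isMDissipative_operator (S : TransmissionData) : IsMDissipative S.operator := by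
  rw [isMDissipative_iff_graph, operator_graph]
  refine ⟨fun U F ⟨_, _, _, _, _, h⟩ => h.dissipative, fun l hl F => ?_⟩
  obtain ⟨U, hU⟩ := exists_mem_graph hl F
  exact ⟨U, _, hU, sub_sub_cancel _ _⟩

theorem exists_solvesCauchyProblem (S : TransmissionData) :
    Dense (S.operator.domain : Set S.Energy) ∧
      ∃ T : ℝ → S.Energy →L[ℂ] S.Energy, SolvesCauchyProblem S.operator T :=
  S.isMDissipative_operator.exists_solvesCauchyProblem (K := S.graphSpace) continuous_graphEquiv
    zero_le_one (re_inner_graphSpace_le S.isMDissipative_operator)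

end TransmissionData

end DegenerateWaveHeat

theorem proposition2p1 (S : DegenerateWaveHeat.TransmissionData) :
    DegenerateWaveHeat.IsMDissipative S.operator ∧
      Dense (S.operator.domain : Set S.Energy) ∧
      ∃ T : ℝ → S.Energy →L[ℂ] S.Energy,
        DegenerateWaveHeat.IsContractionSemigroup T ∧
        DegenerateWaveHeat.IsGenerator S.operator T ∧
        ∀ U₀ ∈ S.operator.domain,
          DegenerateWaveHeat.IsClassicalSolution S.operator U₀ (fun t => T t U₀) ∧
          ∀ U : ℝ → S.Energy, DegenerateWaveHeat.IsClassicalSolution S.operator U₀ U →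
            Set.EqOn U (fun t => T t U₀) (Set.Ici 0) := by
  have hA := S.isMDissipative_operator
  obtain ⟨hdense, T, hT⟩ := S.exists_solvesCauchyProblem
  exact ⟨hA, hdense, T, hT.toIsContractionSemigroup, hT.isGenerator hA, fun U₀ hU₀ =>
    ⟨hT.isClassicalSolution hU₀, fun U hU => hU.eqOn hA (hT.isClassicalSolution hU₀)⟩⟩
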